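/- For a finite connected undirected simple graph $G=(V,E)$ with $n=|V|\ge 2$ vertices let $\Gamma=\Delta/\delta$, where $\Delta$ is the maximum and $\delta$ the minimum degree. Let $P$ be the transition matrix of the lazy random walk on $G$: $p_{u,u}=\tfrac12$, $p_{u,v}=\tfrac1{2\deg(u)}$ if $\{u,v\}\in E$, and $p_{u,v}=0$ otherwise. Let $\lambda_2$ be the second largest eigenvalue of $P$ (counted with multiplicity), and let $$\Phi=\min_{U\subseteq V,\ 0<\operatorname{vol}(U)\le \operatorname{vol}(V)/2}\frac{|E(U,V\setminus U)|}{\operatorname{vol}(U)},\qquad \operatorname{vol}(U)=\sum_{u\in U}\deg(u),$$ be the conductance of $G$. Let * $t_{\mathrm{hit}}$ be the maximum over $u,v\in V$ of the expected first time at which the lazy walk started at $u$ is at $v$; * $t_{\mathrm{meet}}$ be the maximum over $u,v\in V$ of the expected first time at which two independent lazy walks started at $u$ and $v$ are at the same vertex; * $t_{\mathrm{coal}}$ be the expected first time at which a single walk is left in the coalescence process: initially there is one walk on every vertex; in each step all remaining walks make independent lazy random walk steps; walks that are at the same vertex after the step merge into one; * $t_{\mathrm{cov}}$ be the maximum over $u\in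 V$ of the expected first time by which the lazy walk started at $u$ has visited every vertex. Then there is an absolute constant $C>0$ such that for every such graph $G$ $$t_{\mathrm{hit}}\le C\,\frac{\Gamma n}{\sqrt{1-\lambda_2}},\qquad \frac{\Gamma n}{\sqrt{1-\lambda_2}}\le C\,\frac{\Gamma n}{\Phi},\qquad t_{\mathrm{hit}}\le C\,\frac{\Gamma n}{\Phi},$$ $$t_{\mathrm{meet}}\le t_{\mathrm{coal}}\le C\,\frac{\Gamma n\,(1+\log\Gamma)}{\sqrt{1-\lambda_2}},\qquad t_{\mathrm{coal}}\le C\,\frac{\Gamma n\,(1+\log\Gamma)}{\Phi},$$ $$t_{\mathrm{cov}}\le C\,\frac{\Gamma n\log n}{\Phi}.$$ -/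

import Mathlib

open scoped ENNReal

noncomputable section

namespace LazyWalk

/-! ## Homogeneous Markov chains on a discrete state space -/

section Chain

variable {S : Type*}

/-- The `n`-th transition kernel, given the whole past, of the homogeneous Markov chain whose
one-step distribution from the state `x` is `step x`. -/
def stepKernel [MeasurableSpace S] [DiscreteMeasurableSpace S] (step : S → PMF S) (n : ℕ) :
    ProbabilityTheory.Kernel (Finset.Iic n → S) S where
  toFun x := (step (x ⟨n, Finset.mem_Iic.2 le_rfl⟩)).toMeasure
  measurable' :=
    (Measurable.of_discrete (f := fun s : S => (step s).toMeasure)).comp (measurable_pi_apply _)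

instance [MeasurableSpace S] [DiscreteMeasurableSpace S] (step : S → PMF S) (n : ℕ) :
    ProbabilityTheory.IsMarkovKernel (stepKernel step n) :=
  ⟨fun _ => PMF.toMeasure.isProbabilityMeasure _⟩

/-- The law, on the space of trajectories `ℕ → S`, of the Markov chain with one-step
distributions `step` started at `s`. -/
def chainLaw [MeasurableSpace S] [DiscreteMeasurableSpace S] (step : S → PMF S) (s : S) :
    MeasureTheory.Measure (ℕ → S) :=
  ProbabilityTheory.Kernel.traj (X := fun _ => S) (stepKernel step) 0 (fun _ => s)

/-- The expectation, for the Markov chain with one-step distributions `step` started at `s`, of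
the first time `t ≥ 0` at which the trajectory satisfies `E t` (the first time is `∞` on
trajectories which never do). The state space carries the discrete σ-algebra. -/
def expectedFirstTime (step : S → PMF S) (s : S) (E : ℕ → (ℕ → S) → Prop) : ℝ≥0∞ :=
  letI : MeasurableSpace S := ⊤
  haveI : DiscreteMeasurableSpace S := ⟨fun _ => trivial⟩
  ∫⁻ ω, (⨅ (t : ℕ) (_ : E t ω), (t : ℝ≥0∞)) ∂(chainLaw step s)

end Chain

/-! ## The lazy random walk on a graph -/

section Graph

variable {V : Type*} [Fintype V] [DecidableEq V] (G : SimpleGraph V) [DecidableRel G.Adj]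

/-- The transition matrix of the lazy random walk. -/
def transitionMatrix : Matrix V V ℝ :=
  Matrix.of fun u v => if u = v then 1 / 2 else if G.Adj u v then 1 / (2 * (G.degree u : ℝ)) else 0

theorem transitionMatrix_nonneg (u v : V) : 0 ≤ transitionMatrix G u v := by
  simp only [transitionMatrix, Matrix.of_apply]
  split_ifs <;> positivity

theorem transitionMatrix_row_sum (u : V) (hu : 0 < G.degree u) :
    ∑ v, transitionMatrix G u v = 1 := by
  have h : ∀ v, transitionMatrix G u v =
      (if u = v then 1 / 2 else 0) + (if G.Adj u v then 1 / (2 * (G.degree u : ℝ)) else 0) := by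
    intro v
    simp only [transitionMatrix, Matrix.of_apply]
    by_cases huv : u = v
    · subst huv; simp
    · simp [huv]
  have hd : (0 : ℝ) < G.degree u := by exact_mod_cast hu
  simp_rw [h]
  rw [Finset.sum_add_distrib, Finset.sum_ite_eq, ← Finset.sum_filter,
    ← G.neighborFinset_eq_filter, Finset.sum_const, G.card_neighborFinset_eq_degree, nsmul_eq_mul]
  simp only [Finset.mem_univ, if_true]
  field_simp
  norm_num

theorem transitionMatrix_row_sum_ofReal (u : V) (hu : 0 < G.degree u) :
    ∑ v, ENNReal.ofReal (transitionMatrix G u v) = 1 := by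
  rw [← ENNReal.ofReal_sum_of_nonneg fun v _ => transitionMatrix_nonneg G u v,
    transitionMatrix_row_sum G u hu, ENNReal.ofReal_one]

/-- The one-step distribution of the lazy random walk from `u`: the row `u` of the transition
matrix. (At an isolated vertex, which does not occur in a connected graph on at least two
vertices, the walk stays put.) -/
def walkStep (u : V) : PMF V :=
  if hu : 0 < G.degree u then
    PMF.ofFintype (fun v => ENNReal.ofReal (transitionMatrix G u v))
      (transitionMatrix_row_sum_ofReal G u hu)
  else PMF.pure u

/-- One step of two independent lazy random walks. -/
def pairStep (p : V × V) : PMF (V × V) :=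
  (walkStep G p.1).bind fun u => (walkStep G p.2).map fun v => (u, v)

/-- Independent lazy random walk steps `Y v`, one for each vertex `v`. -/
def jointStep : PMF (V → V) :=
  PMF.ofFintype (fun Y => ∏ v, walkStep G v (Y v)) <| by
    have h := Finset.prod_univ_sum (fun _ : V => (Finset.univ : Finset V))
      (fun v w => walkStep G v w)
    rw [Fintype.piFinset_univ] at h
    rw [← h]
    refine Finset.prod_eq_one fun v _ => ?_
    rw [← tsum_fintype (L := SummationFilter.unconditional V)]
    exact (walkStep G v).tsum_coe

/-- One step of the coalescence process: each vertex `v` of the current set of active vertices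
`A` moves, independently of the others, to `Y v`, and walks which arrive at the same vertex
merge. -/
def coalescenceStep (A : Finset V) : PMF (Finset V) :=
  (jointStep G).map fun Y => A.image Y

/-- The maximum over the start vertex and the target vertex of the expected time until the lazy
random walk hits the target. -/
def hittingTime : ℝ≥0∞ :=
  ⨆ (u : V) (v : V), expectedFirstTime (walkStep G) u fun t ω => ω t = v

/-- The maximum over the two start vertices of the expected time until two independent lazy
random walks are at the same vertex at the same time. -/
def meetingTime : ℝ≥0∞ :=
  ⨆ (u : V) (v : V), expectedFirstTime (pairStep G) (u, v) fun t ω => (ω t).1 = (ω t).2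

/-- The expected time until a single walk is left in the coalescence process started with one
walk on every vertex. -/
def coalescenceTime : ℝ≥0∞ :=
  expectedFirstTime (coalescenceStep G) Finset.univ fun t ω => (ω t).card = 1

/-- The maximum over the start vertex of the expected time until the lazy random walk has
visited every vertex. -/
def coverTime : ℝ≥0∞ :=
  ⨆ u : V, expectedFirstTime (walkStep G) u fun t ω => ∀ v, ∃ s ≤ t, ω s = v

/-- The second largest eigenvalue, counted with multiplicity, of the transition matrix of the lazy
random walk: the entry of index `1` of the list of real eigenvalues in decreasing order. (On a
graph with at least two vertices this list has at least two entries, as all eigenvalues are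
real.) -/
def lambda2 : ℝ :=
  ((transitionMatrix G).charpoly.roots.sort (· ≥ ·)).getD 1 0

/-- The volume of a set of vertices. -/
def vol (U : Finset V) : ℕ := ∑ u ∈ U, G.degree u

/-- The conductance: the minimum of `|E(U, V \ U)| / vol U` over all sets of vertices `U` with
`0 < vol U ≤ vol V / 2`. -/
def conductance : ℝ :=
  ⨅ U : {U : Finset V // 0 < vol G U ∧ 2 * vol G U ≤ vol G Finset.univ},
    ((G.interedges U.1 U.1ᶜ).card : ℝ) / (vol G U.1 : ℝ)

/-- The ratio of the maximum degree to the minimum degree. -/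
def degreeRatio : ℝ := (G.maxDegree : ℝ) / (G.minDegree : ℝ)

end Graph

end LazyWalk

end

/-!
Write `Γ = Δ / δ`, let `P` be the lazy walk operator, self-adjoint and (by laziness) positive
semidefinite for the inner product weighted by the degrees, and put `H = Γ n / √(1 - λ₂)`
(`hitScale`).

*Hitting and covering.* A vertex has at most three neighbours on a geodesic, which therefore
passes through a total degree of order `δ` times its length. This gives a Gagliardo–Nirenberg
inequality as in dimension one, `δ² ‖f‖_∞⁴ ≲ energy f * ‖f‖²` for `f` of mean zero (`sobolev`).
With the Poincaré inequality (`spectral_gap`) it shows that functions which vanish somewhere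
satisfy `‖f‖² ≲ H * energy f` (`degInner_le_energy_of_eq_zero`), so that the walk killed at a
vertex contracts by the factor `1 - c / H`. Since `⟨f, P g⟩` satisfies the Cauchy–Schwarz
inequality, the same rate holds when the killing vertex moves along an arbitrary trajectory
(`degInner_avoid_le`). The heat kernel bound obtained from the same two inequalities, as in Nash's
argument, provides mixing in the mean square after time `H`. Hence the walk meets every given
trajectory within `O(H)` steps with probability at least `1 / 2` (`avoid_halfTime_le`). The
hitting time is therefore `O(H)`, and by a union bound the cover time is `O(H log n)`.

*Coalescence.* The number of coalescing walks is dominated by declaring some of them immortal,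
letting them never merge with each other, and killing each other walk when it meets an immortal
one (`iterate_coalOp_card_le`). One immortal walk shows that `k` walks are reduced to `(k + 1) /
2` in expectation after `O(H)` steps. For `k ≥ 32 Γ`, the domination is averaged over all choices
of the set of immortal walks. The heat kernel bound controls the expected number of repeated
collisions of two walks, so that for a typical trajectory enough of the other walks hit it in time
`O(H / k)`, and a fixed fraction of the walks disappears (`iterate_coalOp_card_le_of_large`). A
potential function (`coalPotential`) adds up the two phases to `O(H (1 + log Γ))`
(`sum_coalTail_le`). Two walks are part of the coalescence process, which gives the comparison
with the meeting time.

*From analysis to probability.* The Markov property of the law on trajectories expresses the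
expected first times as sums of iterates of killed transition operators
(`expectedFirstTime_eq_tsum`). Finally, Cheeger's inequality `Φ ≤ 2 √(1 - λ₂)` (`conductance_le`)
replaces the spectral gap by the conductance.
-/

set_option linter.unusedSectionVars false

noncomputable section

namespace LazyWalk

/-! ### The Dirichlet form of the lazy walk -/

section Dirichlet

variable {V : Type*} [Fintype V] [DecidableEq V] (G : SimpleGraph V) [DecidableRel G.Adj]

/-- The ordered pairs of adjacent vertices; every edge occurs twice. -/
def arcs : Finset (V × V) := Finset.univ.filter fun p => G.Adj p.1 p.2

/-- The inner product of functions on the vertices, weighted by the degree. The lazy walk is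
self-adjoint with respect to it. -/
def degInner (f g : V → ℝ) : ℝ := ∑ x, (G.degree x : ℝ) * f x * g x

/-- The transition matrix, acting on functions: the expected value of `f` after one step. -/
def walkOp (f : V → ℝ) : V → ℝ := fun x => ∑ y, transitionMatrix G x y * f y

/-- The sum of `(f x - f y) ^ 2` over ordered pairs of adjacent vertices, which is four times the
Dirichlet form `⟨f, (1 - P) f⟩` of the lazy walk. -/
def energy (f : V → ℝ) : ℝ := ∑ p ∈ arcs G, (f p.1 - f p.2) ^ 2

/-- The total degree, as a real number. -/
def totalVol : ℝ := ∑ x, (G.degree x : ℝ)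

theorem mem_arcs {p : V × V} : p ∈ arcs G ↔ G.Adj p.1 p.2 := by
  simp [arcs]

theorem sum_arcs (F : V → V → ℝ) :
    ∑ p ∈ arcs G, F p.1 p.2 = ∑ x, ∑ y ∈ G.neighborFinset x, F x y := by
  rw [arcs, Finset.sum_filter, Fintype.sum_prod_type]
  refine Finset.sum_congr rfl fun x _ => ?_
  rw [G.neighborFinset_eq_filter, Finset.sum_filter]

theorem sum_arcs_swap (F : V → V → ℝ) :
    ∑ p ∈ arcs G, F p.1 p.2 = ∑ p ∈ arcs G, F p.2 p.1 := by
  refine Finset.sum_nbij' Prod.swap Prod.swap ?_ ?_ ?_ ?_ ?_ <;>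
    simp [mem_arcs, G.adj_comm]

theorem sum_arcs_fst (F : V → ℝ) :
    ∑ p ∈ arcs G, F p.1 = ∑ x, (G.degree x : ℝ) * F x := by
  rw [sum_arcs G fun x _ => F x]
  simp

theorem sum_arcs_snd (F : V → ℝ) :
    ∑ p ∈ arcs G, F p.2 = ∑ x, (G.degree x : ℝ) * F x := by
  rw [← sum_arcs_fst, sum_arcs_swap G fun _ y => F y]

theorem degree_mul_transitionMatrix (x y : V) (hx : 0 < G.degree x) :
    (G.degree x : ℝ) * transitionMatrix G x y =
      (if x = y then (G.degree x : ℝ) / 2 else 0) + (if G.Adj x y then 1 / 2 else 0) := by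
  have hd : (0 : ℝ) < G.degree x := by exact_mod_cast hx
  simp only [transitionMatrix, Matrix.of_apply]
  by_cases h : x = y
  · subst h; simp; ring
  · by_cases h' : G.Adj x y
    · simp [h, h']; field_simp
    · simp [h, h']

/-- The detailed balance equations. -/
theorem degree_mul_transitionMatrix_comm (hd : ∀ x, 0 < G.degree x) (x y : V) :
    (G.degree x : ℝ) * transitionMatrix G x y = (G.degree y : ℝ) * transitionMatrix G y x := by
  rw [degree_mul_transitionMatrix G x y (hd x), degree_mul_transitionMatrix G y x (hd y)]
  by_cases h : x = y
  · subst h; rfl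
  · simp [h, Ne.symm h, G.adj_comm]

theorem degree_mul_walkOp (hd : ∀ x, 0 < G.degree x) (f : V → ℝ) (x : V) :
    (G.degree x : ℝ) * walkOp G f x =
      (G.degree x : ℝ) * f x / 2 + (∑ y ∈ G.neighborFinset x, f y) / 2 := by
  rw [walkOp, Finset.mul_sum]
  simp_rw [← mul_assoc, degree_mul_transitionMatrix G x _ (hd x), add_mul]
  rw [Finset.sum_add_distrib, G.neighborFinset_eq_filter, Finset.sum_filter, Finset.sum_div]
  congr 1
  · simp [ite_mul]; ring
  · refine Finset.sum_congr rfl fun y _ => ?_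
    split_ifs <;> ring

theorem degInner_comm (f g : V → ℝ) : degInner G f g = degInner G g f :=
  Finset.sum_congr rfl fun _ _ => by ring

theorem degInner_add_left (f g h : V → ℝ) :
    degInner G (f + g) h = degInner G f h + degInner G g h := by
  simp only [degInner, ← Finset.sum_add_distrib, Pi.add_apply]
  exact Finset.sum_congr rfl fun _ _ => by ring

theorem degInner_smul_left (c : ℝ) (f g : V → ℝ) :
    degInner G (c • f) g = c * degInner G f g := by
  simp only [degInner, Finset.mul_sum, Pi.smul_apply, smul_eq_mul]
  exact Finset.sum_congr rfl fun _ _ => by ring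

theorem degInner_add_right (f g h : V → ℝ) :
    degInner G h (f + g) = degInner G h f + degInner G h g := by
  rw [degInner_comm, degInner_add_left, degInner_comm G f, degInner_comm G g]

theorem degInner_smul_right (c : ℝ) (f g : V → ℝ) :
    degInner G g (c • f) = c * degInner G g f := by
  rw [degInner_comm, degInner_smul_left, degInner_comm]

theorem degInner_self_nonneg (f : V → ℝ) : 0 ≤ degInner G f f :=
  Finset.sum_nonneg fun x _ => by
    rw [mul_assoc]; exact mul_nonneg (Nat.cast_nonneg _) (mul_self_nonneg _)

theorem degInner_self_eq_zero (hd : ∀ x, 0 < G.degree x) {f : V → ℝ} (h : degInner G f f = 0) :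
    f = 0 := by
  funext x
  have h0 := (Finset.sum_eq_zero_iff_of_nonneg (fun x _ => by
    rw [mul_assoc]; exact mul_nonneg (Nat.cast_nonneg _) (mul_self_nonneg _))).1 h x
    (Finset.mem_univ x)
  have hx : (0 : ℝ) < G.degree x := by exact_mod_cast hd x
  rw [mul_assoc] at h0
  simpa [hx.ne'] using h0

theorem degInner_sq_le (f g : V → ℝ) :
    degInner G f g ^ 2 ≤ degInner G f f * degInner G g g := by
  have h := Finset.sum_mul_sq_le_sq_mul_sq Finset.univ
    (fun x => Real.sqrt (G.degree x) * f x) (fun x => Real.sqrt (G.degree x) * g x)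
  have e : ∀ a b : V → ℝ, ∀ x, (Real.sqrt (G.degree x) * a x) * (Real.sqrt (G.degree x) * b x) =
      (G.degree x : ℝ) * a x * b x := fun a b x => by
    rw [mul_mul_mul_comm, Real.mul_self_sqrt (Nat.cast_nonneg _), mul_assoc]
  simpa only [pow_two (_ * _ : ℝ), e, degInner] using h

theorem degInner_one_one : degInner G 1 1 = totalVol G := by
  simp [degInner, totalVol]

/-- The lazy walk as a sum of squares: this shows both symmetry and positivity. -/
theorem degInner_walkOp (hd : ∀ x, 0 < G.degree x) (f g : V → ℝ) :
    degInner G f (walkOp G g) =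
      (∑ p ∈ arcs G, (f p.1 + f p.2) * (g p.1 + g p.2)) / 4 := by
  have h1 : degInner G f (walkOp G g) =
      (∑ p ∈ arcs G, f p.1 * g p.1) / 2 + (∑ p ∈ arcs G, f p.1 * g p.2) / 2 := by
    rw [sum_arcs_fst G fun x => f x * g x, sum_arcs G fun x y => f x * g y, degInner,
      Finset.sum_div, Finset.sum_div, ← Finset.sum_add_distrib]
    refine Finset.sum_congr rfl fun x _ => ?_
    rw [mul_right_comm, degree_mul_walkOp G hd, ← Finset.mul_sum]
    ring
  have h2 : ∑ p ∈ arcs G, f p.2 * g p.2 = ∑ p ∈ arcs G, f p.1 * g p.1 :=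
    (sum_arcs_swap G fun x y => f y * g y)
  have h3 : ∑ p ∈ arcs G, f p.2 * g p.1 = ∑ p ∈ arcs G, f p.1 * g p.2 :=
    (sum_arcs_swap G fun x y => f y * g x)
  have h4 : ∑ p ∈ arcs G, (f p.1 + f p.2) * (g p.1 + g p.2) =
      ∑ p ∈ arcs G, f p.1 * g p.1 + ∑ p ∈ arcs G, f p.1 * g p.2 +
        (∑ p ∈ arcs G, f p.2 * g p.1 + ∑ p ∈ arcs G, f p.2 * g p.2) := by
    rw [← Finset.sum_add_distrib, ← Finset.sum_add_distrib, ← Finset.sum_add_distrib]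
    exact Finset.sum_congr rfl fun _ _ => by ring
  rw [h1, h4, h2, h3]
  ring

theorem degInner_walkOp_comm (hd : ∀ x, 0 < G.degree x) (f g : V → ℝ) :
    degInner G f (walkOp G g) = degInner G (walkOp G f) g := by
  rw [degInner_comm G (walkOp G f), degInner_walkOp G hd, degInner_walkOp G hd]
  congr 1
  exact Finset.sum_congr rfl fun _ _ => mul_comm _ _

theorem degInner_walkOp_self_nonneg (hd : ∀ x, 0 < G.degree x) (f : V → ℝ) :
    0 ≤ degInner G f (walkOp G f) := by
  rw [degInner_walkOp G hd]
  exact div_nonneg (Finset.sum_nonneg fun _ _ => mul_self_nonneg _) (by norm_num)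

theorem energy_nonneg (f : V → ℝ) : 0 ≤ energy G f :=
  Finset.sum_nonneg fun _ _ => sq_nonneg _

theorem degInner_self_sub_walkOp (hd : ∀ x, 0 < G.degree x) (f : V → ℝ) :
    degInner G f f - degInner G f (walkOp G f) = energy G f / 4 := by
  have h1 : degInner G f f = ∑ p ∈ arcs G, f p.1 * f p.1 := by
    rw [sum_arcs_fst G fun x => f x * f x]
    exact Finset.sum_congr rfl fun _ _ => by ring
  have h2 : degInner G f f = ∑ p ∈ arcs G, f p.2 * f p.2 := by
    rw [sum_arcs_snd G fun x => f x * f x]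
    exact Finset.sum_congr rfl fun _ _ => by ring
  have h3 : energy G f + 4 * degInner G f (walkOp G f) =
      2 * (∑ p ∈ arcs G, f p.1 * f p.1 + ∑ p ∈ arcs G, f p.2 * f p.2) := by
    rw [degInner_walkOp G hd, energy, mul_div_cancel₀ _ (by norm_num), ← Finset.sum_add_distrib,
      ← Finset.sum_add_distrib, Finset.mul_sum]
    exact Finset.sum_congr rfl fun _ _ => by ring
  linarith

theorem walkOp_le_self (hd : ∀ x, 0 < G.degree x) (f : V → ℝ) :
    degInner G f (walkOp G f) ≤ degInner G f f := by
  linarith [degInner_self_sub_walkOp G hd f, energy_nonneg G f]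

theorem energy_le (hd : ∀ x, 0 < G.degree x) (f : V → ℝ) :
    energy G f ≤ 4 * degInner G f f := by
  linarith [degInner_self_sub_walkOp G hd f, degInner_walkOp_self_nonneg G hd f]

/-- The Cauchy–Schwarz inequality for the positive semidefinite form `⟨f, P g⟩`. -/
theorem degInner_walkOp_sq_le (hd : ∀ x, 0 < G.degree x) (f g : V → ℝ) :
    degInner G f (walkOp G g) ^ 2 ≤
      degInner G f (walkOp G f) * degInner G g (walkOp G g) := by
  have h := Finset.sum_mul_sq_le_sq_mul_sq (arcs G) (fun p => f p.1 + f p.2)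
    (fun p => g p.1 + g p.2)
  simp only [degInner_walkOp G hd, ← pow_two]
  rw [div_pow, div_mul_div_comm]
  exact (div_le_div_of_nonneg_right h (by norm_num)).trans_eq (by norm_num)

/-- As operators, `P ^ 2 ≤ P`. -/
theorem degInner_walkOp_walkOp_le (hd : ∀ x, 0 < G.degree x) (f : V → ℝ) :
    degInner G (walkOp G f) (walkOp G f) ≤ degInner G f (walkOp G f) := by
  have h1 := degInner_walkOp_sq_le G hd (walkOp G f) f
  have h2 := walkOp_le_self G hd (walkOp G f)
  have h3 := degInner_walkOp_self_nonneg G hd f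
  rcases (degInner_self_nonneg G (walkOp G f)).eq_or_lt with h | h
  · rw [← h]; exact h3
  · refine le_of_mul_le_mul_left ?_ h
    calc _ = degInner G (walkOp G f) (walkOp G f) ^ 2 := by ring
      _ ≤ _ := h1
      _ ≤ _ := mul_le_mul_of_nonneg_right h2 h3

theorem walkOp_one (hd : ∀ x, 0 < G.degree x) : walkOp G 1 = 1 := by
  funext x
  simp [walkOp, transitionMatrix_row_sum G x (hd x)]

theorem walkOp_add (f g : V → ℝ) : walkOp G (f + g) = walkOp G f + walkOp G g := by
  funext x
  simp [walkOp, mul_add, Finset.sum_add_distrib]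

theorem walkOp_smul (c : ℝ) (f : V → ℝ) : walkOp G (c • f) = c • walkOp G f := by
  funext x
  simp only [walkOp, Pi.smul_apply, smul_eq_mul, Finset.mul_sum]
  exact Finset.sum_congr rfl fun _ _ => by ring

theorem degInner_one_walkOp (hd : ∀ x, 0 < G.degree x) (f : V → ℝ) :
    degInner G 1 (walkOp G f) = degInner G 1 f := by
  rw [degInner_walkOp_comm G hd, walkOp_one G hd]

theorem energy_sub_const (f : V → ℝ) (c : ℝ) : energy G (fun x => f x - c) = energy G f :=
  Finset.sum_congr rfl fun _ _ => by ring

theorem degree_pos_of_connected (hG : G.Connected) (hV : 2 ≤ Fintype.card V) (x : V) :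
    0 < G.degree x := by
  have : Nontrivial V := Fintype.one_lt_card_iff_nontrivial.1 hV
  exact hG.preconnected.degree_pos_of_nontrivial x

/-- On a connected graph, only constants have energy zero. -/
theorem eq_of_energy_eq_zero (hG : G.Connected) {f : V → ℝ} (h : energy G f = 0) (x y : V) :
    f x = f y := by
  have hadj : ∀ a b, G.Adj a b → f a = f b := fun a b hab => by
    have := (Finset.sum_eq_zero_iff_of_nonneg (fun _ _ => sq_nonneg _)).1 h (a, b)
      ((mem_arcs G).2 hab)
    exact sub_eq_zero.1 (pow_eq_zero_iff (two_ne_zero)|>.1 this)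
  obtain ⟨w⟩ := hG.preconnected x y
  induction w with
  | nil => rfl
  | cons hab _ ih => exact (hadj _ _ hab).trans ih

end Dirichlet

/-! ### A one-dimensional Sobolev inequality -/

section Sobolev

variable {V : Type*} [Fintype V] [DecidableEq V] (G : SimpleGraph V) [DecidableRel G.Adj]

/-- A shortest path, as a sequence of vertices indexed by their distance from the start. -/
theorem exists_geodesic (hG : G.Connected) (u w : V) :
    ∃ x : ℕ → V, x 0 = u ∧ x (G.dist u w) = w ∧
      (∀ i < G.dist u w, G.Adj (x i) (x (i + 1))) ∧ ∀ i ≤ G.dist u w, G.dist u (x i) = i := by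
  obtain ⟨p, hp⟩ := hG.exists_walk_length_eq_dist u w
  refine ⟨p.getVert, p.getVert_zero, by rw [← hp]; exact p.getVert_length,
    fun i hi => p.adj_getVert_succ (hp ▸ hi), fun i hi => ?_⟩
  have h1 : G.dist u (p.getVert i) ≤ i := by
    refine (SimpleGraph.dist_le (p.take i)).trans ?_
    rw [SimpleGraph.Walk.take_length]; exact min_le_left _ _
  have h2 : G.dist (p.getVert i) w ≤ G.dist u w - i := by
    refine (SimpleGraph.dist_le (p.drop i)).trans ?_
    rw [SimpleGraph.Walk.drop_length, hp]
  have h3 := hG.dist_triangle (u := u) (v := p.getVert i) (w := w)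
  omega

/-- A vertex is adjacent to at most three vertices of a geodesic. -/
theorem card_geodesic_neighbors_le (hG : G.Connected) {u : V} {r : ℕ} {x : ℕ → V}
    (hx : ∀ i < r, G.dist u (x i) = i) (y : V) :
    ((Finset.range r).filter fun i => G.Adj (x i) y).card ≤ 3 := by
  have : ((Finset.range r).filter fun i => G.Adj (x i) y) ⊆
      Finset.Icc (G.dist u y - 1) (G.dist u y + 1) := by
    intro i hi
    rw [Finset.mem_filter, Finset.mem_range] at hi
    have h1 := hx i hi.1
    have h2 := hG.dist_triangle (u := u) (v := x i) (w := y)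
    have h3 := hG.dist_triangle (u := u) (v := y) (w := x i)
    rw [SimpleGraph.dist_eq_one_iff_adj.2 hi.2] at h2
    rw [SimpleGraph.dist_eq_one_iff_adj.2 hi.2.symm] at h3
    rw [Finset.mem_Icc]
    omega
  refine (Finset.card_le_card this).trans ?_
  rw [Nat.card_Icc]
  omega

/-- Summed over the vertices of a geodesic, `δ f²` is controlled by the norm and the energy, since
`f x ^ 2` is at most twice `f y ^ 2 + (f x - f y) ^ 2` for each of the at least `δ` neighbours `y`
of `x`. -/
theorem sum_geodesic_sq_le (hG : G.Connected) {u : V} {r : ℕ} {x : ℕ → V}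
    (hx : ∀ i < r, G.dist u (x i) = i) (f : V → ℝ) :
    (G.minDegree : ℝ) * ∑ i ∈ Finset.range r, f (x i) ^ 2 ≤
      6 * ∑ y, f y ^ 2 + 2 * energy G f := by
  have hinj : Set.InjOn x (Finset.range r) := by
    intro i hi j hj hij
    simp only [Finset.coe_range, Set.mem_Iio] at hi hj
    rw [← hx i hi, ← hx j hj, hij]
  have h1 : ∀ i ∈ Finset.range r, (G.minDegree : ℝ) * f (x i) ^ 2 ≤
      2 * (∑ y ∈ G.neighborFinset (x i), f y ^ 2) +
        2 * ∑ y ∈ G.neighborFinset (x i), (f (x i) - f y) ^ 2 := by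
    intro i _
    have hdeg : (G.minDegree : ℝ) ≤ G.degree (x i) := by exact_mod_cast G.minDegree_le_degree _
    calc (G.minDegree : ℝ) * f (x i) ^ 2 ≤ G.degree (x i) * f (x i) ^ 2 :=
          mul_le_mul_of_nonneg_right hdeg (sq_nonneg _)
      _ = ∑ y ∈ G.neighborFinset (x i), f (x i) ^ 2 := by simp
      _ ≤ ∑ y ∈ G.neighborFinset (x i), (2 * f y ^ 2 + 2 * (f (x i) - f y) ^ 2) :=
          Finset.sum_le_sum fun y _ => by nlinarith [sq_nonneg (f (x i) - 2 * f y)]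
      _ = _ := by rw [Finset.sum_add_distrib, Finset.mul_sum, Finset.mul_sum]
  have h2 : ∑ i ∈ Finset.range r, ∑ y ∈ G.neighborFinset (x i), f y ^ 2 ≤ 3 * ∑ y, f y ^ 2 := by
    calc _ = ∑ i ∈ Finset.range r, ∑ y, if G.Adj (x i) y then f y ^ 2 else 0 :=
          Finset.sum_congr rfl fun i _ => by
            rw [G.neighborFinset_eq_filter, Finset.sum_filter]
      _ = ∑ y, ∑ i ∈ Finset.range r, if G.Adj (x i) y then f y ^ 2 else 0 := Finset.sum_comm
      _ = ∑ y, (((Finset.range r).filter fun i => G.Adj (x i) y).card : ℝ) * f y ^ 2 :=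
          Finset.sum_congr rfl fun y _ => by
            rw [← Finset.sum_filter, Finset.sum_const, nsmul_eq_mul]
      _ ≤ ∑ y, 3 * f y ^ 2 := Finset.sum_le_sum fun y _ =>
          mul_le_mul_of_nonneg_right
            (by exact_mod_cast card_geodesic_neighbors_le G hG hx y) (sq_nonneg _)
      _ = _ := by rw [Finset.mul_sum]
  have h3 : ∑ i ∈ Finset.range r, ∑ y ∈ G.neighborFinset (x i), (f (x i) - f y) ^ 2 ≤
      energy G f := by
    rw [energy, sum_arcs G fun a b => (f a - f b) ^ 2,
      ← Finset.sum_image (f := fun a => ∑ y ∈ G.neighborFinset a, (f a - f y) ^ 2) hinj]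
    exact Finset.sum_le_sum_of_subset_of_nonneg (Finset.subset_univ _)
      fun _ _ _ => Finset.sum_nonneg fun _ _ => sq_nonneg _
  rw [Finset.mul_sum]
  refine (Finset.sum_le_sum h1).trans ?_
  rw [Finset.sum_add_distrib, ← Finset.mul_sum, ← Finset.mul_sum]
  linarith

/-- The increments of `f` along a geodesic, by Cauchy–Schwarz. -/
theorem sq_sub_le_mul_energy {u : V} {r : ℕ} {x : ℕ → V}
    (hx : ∀ i < r, G.dist u (x i) = i) (hadj : ∀ i < r, G.Adj (x i) (x (i + 1))) (f : V → ℝ) :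
    (f (x 0) - f (x r)) ^ 2 ≤ r * energy G f := by
  have hinj : Set.InjOn (fun i => (x i, x (i + 1))) (Finset.range r) := by
    intro i hi j hj hij
    simp only [Finset.coe_range, Set.mem_Iio] at hi hj
    rw [← hx i hi, ← hx j hj, (Prod.mk.inj hij).1]
  have h1 : f (x 0) - f (x r) = ∑ i ∈ Finset.range r, (f (x i) - f (x (i + 1))) :=
    (Finset.sum_range_sub' (fun i => f (x i)) r).symm
  have h2 : ∑ i ∈ Finset.range r, (f (x i) - f (x (i + 1))) ^ 2 ≤ energy G f := by
    rw [energy, ← Finset.sum_image (f := fun p : V × V => (f p.1 - f p.2) ^ 2) hinj]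
    refine Finset.sum_le_sum_of_subset_of_nonneg ?_ fun _ _ _ => sq_nonneg _
    intro p hp
    obtain ⟨i, hi, rfl⟩ := Finset.mem_image.1 hp
    exact (mem_arcs G).2 (hadj i (Finset.mem_range.1 hi))
  rw [h1]
  refine sq_sum_le_card_mul_sum_sq.trans ?_
  rw [Finset.card_range]
  exact mul_le_mul_of_nonneg_left h2 (Nat.cast_nonneg _)

theorem minDegree_pos_of_connected (hG : G.Connected) (hV : 2 ≤ Fintype.card V) :
    0 < G.minDegree := by
  have : Nontrivial V := Fintype.one_lt_card_iff_nontrivial.1 hV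
  exact hG.preconnected.minDegree_pos_of_nontrivial

theorem minDegree_mul_sum_sq_le (f : V → ℝ) :
    (G.minDegree : ℝ) * ∑ y, f y ^ 2 ≤ degInner G f f := by
  rw [Finset.mul_sum]
  refine Finset.sum_le_sum fun y _ => ?_
  rw [mul_assoc, ← pow_two]
  exact mul_le_mul_of_nonneg_right (by exact_mod_cast G.minDegree_le_degree y) (sq_nonneg _)

/-- A Gagliardo–Nirenberg inequality as in dimension one, for functions which are nonpositive
somewhere. Follow a geodesic from `u` to the set `{f ≤ f u / 2}`: if it is long, it has to pass
many vertices, with their at least `δ` neighbours, at which `f` is large. -/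
theorem sobolev_of_nonpos (hG : G.Connected) (hV : 2 ≤ Fintype.card V) (f : V → ℝ) {u w : V}
    (hu : 0 < f u) (hw : f w ≤ 0) :
    (G.minDegree : ℝ) ^ 2 * f u ^ 4 ≤ 1024 * (energy G f * degInner G f f) := by
  have hδ : (0 : ℝ) < G.minDegree := by exact_mod_cast minDegree_pos_of_connected G hG hV
  have hd := degree_pos_of_connected G hG hV
  obtain ⟨z, hz, hmin⟩ := Finset.exists_min_image (Finset.univ.filter fun y => f y ≤ f u / 2)
    (fun y => G.dist u y) ⟨w, by simp; linarith⟩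
  simp only [Finset.mem_filter, Finset.mem_univ, true_and] at hz hmin
  obtain ⟨x, hx0, hxr, hadj, hdist⟩ := exists_geodesic G hG u z
  set r := G.dist u z with hr
  have hbig : ∀ i ∈ Finset.range r, (f u / 2) ^ 2 ≤ f (x i) ^ 2 := by
    intro i hi
    rw [Finset.mem_range] at hi
    have : f u / 2 < f (x i) := by
      by_contra hcon
      have := hmin (x i) (not_lt.1 hcon)
      rw [hdist i hi.le] at this
      omega
    exact pow_le_pow_left₀ (by linarith) this.le 2
  -- Two bounds for the length `r` of the geodesic: from above, as `f` exceeds `f u / 2` before `z`,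
  -- and from below, as `f` drops by `f u / 2` along it.
  have h1 := sum_geodesic_sq_le G hG (fun i hi => hdist i hi.le) f
  have h2 := sq_sub_le_mul_energy G (fun i hi => hdist i hi.le) hadj f
  have h3 : (r : ℝ) * (f u / 2) ^ 2 ≤ ∑ i ∈ Finset.range r, f (x i) ^ 2 := by
    simpa using Finset.sum_le_sum hbig
  have h4 := minDegree_mul_sum_sq_le G f
  have h5 := energy_le G hd f
  have h6 := energy_nonneg G f
  have h7 : (f u / 2) ^ 2 ≤ r * energy G f := by
    refine le_trans ?_ h2
    rw [hx0, hxr]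
    exact pow_le_pow_left₀ (by linarith) (by linarith) 2
  have hr1 : (1 : ℝ) ≤ r := by
    have : r ≠ 0 := by
      intro h0
      rw [h0, hx0] at hxr
      rw [← hxr] at hz
      linarith
    exact_mod_cast Nat.one_le_iff_ne_zero.2 this
  set a := f u
  set D := energy G f
  set N := degInner G f f
  set δ := (G.minDegree : ℝ)
  have hN : 0 ≤ N := degInner_self_nonneg G f
  have h8 : δ * (δ * (r * (a / 2) ^ 2)) ≤ 6 * N + 2 * (δ * D) := by
    have := mul_le_mul_of_nonneg_left ((mul_le_mul_of_nonneg_left h3 hδ.le).trans h1) hδ.le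
    linarith
  have ha2 : 0 ≤ a ^ 2 := sq_nonneg a
  -- Either the norm or the energy dominates the sum over the geodesic.
  rcases le_total (2 * (δ * D)) (6 * N) with hc | hc
  · have h9 : δ ^ 2 * (r * a ^ 2) ≤ 48 * N := by nlinarith
    have h10 : a ^ 2 ≤ 4 * (r * D) := by nlinarith
    calc δ ^ 2 * a ^ 4 = δ ^ 2 * a ^ 2 * a ^ 2 := by ring
      _ ≤ δ ^ 2 * a ^ 2 * (4 * (r * D)) := mul_le_mul_of_nonneg_left h10 (by positivity)
      _ = (δ ^ 2 * (r * a ^ 2)) * (4 * D) := by ring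
      _ ≤ 48 * N * (4 * D) := mul_le_mul_of_nonneg_right h9 (by positivity)
      _ ≤ _ := by nlinarith [mul_nonneg h6 hN]
  · have h9 : δ * (δ * (r * a ^ 2)) ≤ δ * (16 * D) := by nlinarith
    have h10 : δ * (r * a ^ 2) ≤ 16 * D := le_of_mul_le_mul_left h9 hδ
    have h11 : δ * a ^ 2 ≤ 16 * D := by nlinarith [mul_nonneg hδ.le ha2]
    calc δ ^ 2 * a ^ 4 = (δ * a ^ 2) ^ 2 := by ring
      _ ≤ (16 * D) ^ 2 := pow_le_pow_left₀ (by positivity) h11 2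
      _ = 256 * (D * D) := by ring
      _ ≤ 256 * (D * (4 * N)) := by gcongr
      _ = _ := by ring

theorem exists_nonpos_of_degInner_one_eq_zero [Nonempty V] (hd : ∀ x, 0 < G.degree x) {f : V → ℝ}
    (hf : degInner G 1 f = 0) : ∃ w, f w ≤ 0 := by
  by_contra hcon
  push Not at hcon
  refine (Finset.sum_pos (fun x _ => ?_) Finset.univ_nonempty).ne' hf
  have hx : (0 : ℝ) < G.degree x := by exact_mod_cast hd x
  simpa using mul_pos hx (hcon x)

theorem energy_neg (f : V → ℝ) : energy G (-f) = energy G f :=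
  Finset.sum_congr rfl fun _ _ => by simp only [Pi.neg_apply]; ring

theorem degInner_neg_neg (f g : V → ℝ) : degInner G (-f) (-g) = degInner G f g :=
  Finset.sum_congr rfl fun _ _ => by simp

/-- The one-dimensional Gagliardo–Nirenberg inequality for functions of mean zero. -/
theorem sobolev (hG : G.Connected) (hV : 2 ≤ Fintype.card V) {f : V → ℝ}
    (hf : degInner G 1 f = 0) (u : V) :
    (G.minDegree : ℝ) ^ 2 * f u ^ 4 ≤ 1024 * (energy G f * degInner G f f) := by
  have hd := degree_pos_of_connected G hG hV
  have : Nonempty V := ⟨u⟩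
  rcases lt_trichotomy (f u) 0 with h | h | h
  · have hf' : degInner G 1 (-f) = 0 := by
      rw [← neg_one_smul ℝ f, degInner_smul_right, hf, mul_zero]
    obtain ⟨w, hw⟩ := exists_nonpos_of_degInner_one_eq_zero G hd hf'
    have := sobolev_of_nonpos G hG hV (-f) (u := u) (by simpa using h) hw
    rw [energy_neg, degInner_neg_neg] at this
    simpa [Even.neg_pow (by decide : Even 4)] using this
  · rw [h]
    have := mul_nonneg (energy_nonneg G f) (degInner_self_nonneg G f)
    norm_num
    linarith
  · obtain ⟨w, hw⟩ := exists_nonpos_of_degInner_one_eq_zero G hd hf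
    exact sobolev_of_nonpos G hG hV f h hw

end Sobolev

/-! ### The spectral gap -/

section Spectral

variable {V : Type*} [Fintype V] [DecidableEq V] (G : SimpleGraph V) [DecidableRel G.Adj]

/-- The matrix `D^{1/2} P D^{-1/2}`, where `D` is the diagonal matrix of the degrees. It is similar
to the transition matrix, and symmetric. -/
def symmetrizedMatrix : Matrix V V ℝ :=
  Matrix.diagonal (fun x => Real.sqrt (G.degree x)) *
    (transitionMatrix G * Matrix.diagonal fun x => (Real.sqrt (G.degree x))⁻¹)

theorem symmetrizedMatrix_apply (x y : V) :
    symmetrizedMatrix G x y =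
      Real.sqrt (G.degree x) * (transitionMatrix G x y * (Real.sqrt (G.degree y))⁻¹) := by
  simp [symmetrizedMatrix, Matrix.diagonal_mul, Matrix.mul_diagonal]

theorem symmetrizedMatrix_isHermitian (hd : ∀ x, 0 < G.degree x) :
    (symmetrizedMatrix G).IsHermitian := by
  ext x y
  rw [Matrix.conjTranspose_apply, star_trivial, symmetrizedMatrix_apply, symmetrizedMatrix_apply]
  have hx : 0 < Real.sqrt (G.degree x) := Real.sqrt_pos.2 (by exact_mod_cast hd x)
  have hy : 0 < Real.sqrt (G.degree y) := Real.sqrt_pos.2 (by exact_mod_cast hd y)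
  have hx2 := Real.mul_self_sqrt (Nat.cast_nonneg (α := ℝ) (G.degree x))
  have hy2 := Real.mul_self_sqrt (Nat.cast_nonneg (α := ℝ) (G.degree y))
  have h := degree_mul_transitionMatrix_comm G hd x y
  rw [← hx2, ← hy2] at h
  field_simp
  linarith

theorem symmetrizedMatrix_charpoly (hd : ∀ x, 0 < G.degree x) :
    (symmetrizedMatrix G).charpoly = (transitionMatrix G).charpoly := by
  rw [symmetrizedMatrix, Matrix.charpoly_mul_comm, mul_assoc, Matrix.diagonal_mul_diagonal]
  have : (fun x => (Real.sqrt (G.degree x))⁻¹ * Real.sqrt (G.degree x)) = fun _ => (1 : ℝ) := by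
    funext x
    have hx : 0 < Real.sqrt (G.degree x) := Real.sqrt_pos.2 (by exact_mod_cast hd x)
    exact inv_mul_cancel₀ hx.ne'
  rw [this, Matrix.diagonal_one, mul_one]

/-- The spectral theorem for the lazy walk: a basis of eigenfunctions which is orthonormal for
`degInner`, ordered by decreasing eigenvalue. -/
theorem exists_eigenbasis (hd : ∀ x, 0 < G.degree x) (hV : 2 ≤ Fintype.card V) :
    ∃ (e : Fin (Fintype.card V) → V → ℝ) (μ : Fin (Fintype.card V) → ℝ),
      Antitone μ ∧ (∀ i j, degInner G (e i) (e j) = if i = j then 1 else 0) ∧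
      (∀ i, walkOp G (e i) = μ i • e i) ∧ lambda2 G = μ ⟨1, hV⟩ ∧
      ∀ f : V → ℝ, f = ∑ i, degInner G (e i) f • e i := by
  have hB := symmetrizedMatrix_isHermitian G hd
  have hs : ∀ x, 0 < Real.sqrt (G.degree x) := fun x => Real.sqrt_pos.2 (by exact_mod_cast hd x)
  have hs2 : ∀ x, Real.sqrt (G.degree x) * Real.sqrt (G.degree x) = G.degree x :=
    fun x => Real.mul_self_sqrt (Nat.cast_nonneg _)
  set k : Fin (Fintype.card V) ≃ V := Fintype.equivOfCardEq (Fintype.card_fin _)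
  set b := hB.eigenvectorBasis
  have hinner : ∀ F H : EuclideanSpace ℝ V, inner ℝ F H = ∑ x, F x * H x := fun F H => by
    rw [PiLp.inner_apply]
    exact Finset.sum_congr rfl fun _ _ => by simp [mul_comm]
  refine ⟨fun i x => b (k i) x / Real.sqrt (G.degree x), hB.eigenvalues₀,
    hB.eigenvalues₀_antitone, fun i j => ?_, fun i => ?_, ?_, fun f => ?_⟩
  · have h := orthonormal_iff_ite.1 b.orthonormal (k i) (k j)
    rw [hinner] at h
    simp only [EmbeddingLike.apply_eq_iff_eq] at h
    rw [← h]
    refine Finset.sum_congr rfl fun x _ => ?_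
    have := (hs x).ne'
    rw [← hs2 x]
    field_simp
  · funext x
    have h := congrFun (hB.mulVec_eigenvectorBasis (k i)) x
    have hev : hB.eigenvalues (k i) = hB.eigenvalues₀ i := by
      simp [Matrix.IsHermitian.eigenvalues, k]
    rw [hev] at h
    simp only [Matrix.mulVec, dotProduct, symmetrizedMatrix_apply, Pi.smul_apply, smul_eq_mul]
      at h
    simp only [walkOp, Pi.smul_apply, smul_eq_mul]
    rw [← mul_div_assoc, eq_div_iff (hs x).ne', ← h, Finset.sum_mul]
    refine Finset.sum_congr rfl fun y _ => ?_
    have := (hs y).ne'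
    simp only [b]
    field_simp
  · -- The two matrices are similar, so the roots in `lambda2` are the sorted eigenvalues.
    have h := hB.sort_roots_charpoly_eq_eigenvalues₀
    rw [symmetrizedMatrix_charpoly G hd] at h
    have hre : (RCLike.re : ℝ → ℝ) = id := by funext x; simp
    rw [hre, Multiset.map_id] at h
    rw [lambda2, h, List.getD_eq_getElem _ _ (by simpa using (show 1 < Fintype.card V from hV))]
    simp
  · have h := b.sum_repr' (WithLp.toLp 2 fun x => Real.sqrt (G.degree x) * f x)
    funext x
    have hx := congrFun (congrArg WithLp.ofLp h) x
    simp only [WithLp.ofLp_sum, WithLp.ofLp_smul, Finset.sum_apply, Pi.smul_apply, smul_eq_mul]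
      at hx
    simp only [Finset.sum_apply, Pi.smul_apply, smul_eq_mul]
    rw [← mul_right_inj' (hs x).ne', ← hx, ← k.sum_comp, Finset.mul_sum]
    refine Finset.sum_congr rfl fun i _ => ?_
    have := (hs x).ne'
    rw [hinner]
    have hc : degInner G (fun x => b (k i) x / Real.sqrt (G.degree x)) f =
        ∑ y, b (k i) y * (Real.sqrt (G.degree y) * f y) := by
      refine Finset.sum_congr rfl fun y _ => ?_
      have := (hs y).ne'
      nth_rewrite 1 [← hs2 y]
      field_simp
    rw [hc]
    field_simp

theorem degInner_sum_right {ι : Type*} (s : Finset ι) (f : V → ℝ) (g : ι → V → ℝ) :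
    degInner G f (∑ i ∈ s, g i) = ∑ i ∈ s, degInner G f (g i) := by
  simp only [degInner, Finset.sum_apply, Finset.mul_sum]
  exact Finset.sum_comm

/-- What is needed about the second eigenvalue: it is in `[0, 1)`, it has an eigenfunction of mean
zero, and it satisfies the Poincaré inequality. -/
theorem spectral_gap (hG : G.Connected) (hV : 2 ≤ Fintype.card V) :
    0 ≤ lambda2 G ∧ lambda2 G < 1 ∧
    (∃ f : V → ℝ, f ≠ 0 ∧ degInner G 1 f = 0 ∧ walkOp G f = lambda2 G • f) ∧
    ∀ f : V → ℝ, degInner G 1 f = 0 → (1 - lambda2 G) * degInner G f f ≤ energy G f / 4 := by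
  have hd := degree_pos_of_connected G hG hV
  obtain ⟨e, μ, hμ, horth, heig, hl, hrep⟩ := exists_eigenbasis G hd hV
  set i0 : Fin (Fintype.card V) := ⟨0, by omega⟩
  set i1 : Fin (Fintype.card V) := ⟨1, hV⟩
  have hself : ∀ i, degInner G (e i) (e i) = 1 := fun i => by rw [horth, if_pos rfl]
  have hRay : ∀ i, degInner G (e i) (walkOp G (e i)) = μ i := fun i => by
    rw [heig, degInner_smul_right, hself, mul_one]
  have hle1 : ∀ i, μ i ≤ 1 := fun i => by
    rw [← hRay, ← hself i]; exact walkOp_le_self G hd _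
  have h0 : 0 ≤ μ i1 := by rw [← hRay]; exact degInner_walkOp_self_nonneg G hd _
  have hconst : ∀ i, μ i = 1 → e i = e i (hG.nonempty.some) • (1 : V → ℝ) := fun i hi => by
    have hE : energy G (e i) = 0 := by
      have := degInner_self_sub_walkOp G hd (e i)
      rw [hRay, hself, hi] at this
      linarith
    funext x
    simpa using eq_of_energy_eq_zero G hG hE x _
  have hlt : μ i1 < 1 := by
    refine lt_of_le_of_ne (hle1 _) fun h1 => ?_
    have h1' : μ i0 = 1 := le_antisymm (hle1 _) (h1 ▸ hμ (Fin.mk_le_mk.2 (Nat.zero_le 1)))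
    -- The first two eigenfunctions would both be constant, yet orthogonal.
    have ha := hconst i0 h1'
    have hb := hconst i1 h1
    have hab := horth i0 i1
    have haa := hself i0
    have hbb := hself i1
    rw [if_neg (by simp [i0, i1])] at hab
    rw [ha, hb, degInner_smul_left, degInner_smul_right] at hab
    rw [ha, degInner_smul_left, degInner_smul_right] at haa
    rw [hb, degInner_smul_left, degInner_smul_right] at hbb
    rcases mul_eq_zero.1 hab with h | h
    · rw [h, zero_mul] at haa; exact zero_ne_one haa
    · rw [h, mul_zero] at hbb; exact zero_ne_one hbb
  -- Parseval's identities, and the resulting bound on the complement of the first eigenfunction.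
  have hnorm : ∀ f g, degInner G f g = ∑ i, degInner G (e i) g * degInner G f (e i) :=
    fun f g => by
      conv_lhs => rw [hrep g]
      rw [degInner_sum_right]
      exact Finset.sum_congr rfl fun i _ => degInner_smul_right G _ _ _
  have hform : ∀ f, degInner G f (walkOp G f) = ∑ i, μ i * degInner G (e i) f ^ 2 := fun f => by
    rw [hnorm f (walkOp G f)]
    refine Finset.sum_congr rfl fun i _ => ?_
    rw [degInner_walkOp_comm G hd, heig, degInner_smul_left, degInner_comm G f]
    ring
  have hmain : ∀ f, degInner G (e i0) f = 0 →
      degInner G f (walkOp G f) ≤ μ i1 * degInner G f f := fun f hf => by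
    rw [hform, hnorm f f, Finset.mul_sum]
    refine Finset.sum_le_sum fun i _ => ?_
    rw [degInner_comm G f, ← pow_two]
    by_cases hi : i = i0
    · rw [hi, hf]; simp
    · refine mul_le_mul_of_nonneg_right (hμ ?_) (sq_nonneg _)
      rw [Fin.le_def]
      have : (i : ℕ) ≠ 0 := fun h => hi (Fin.ext h)
      exact Nat.one_le_iff_ne_zero.2 this
  rw [hl]
  refine ⟨h0, hlt, ⟨e i1, fun h => ?_, ?_, heig i1⟩, fun f hf => ?_⟩
  · have := hself i1
    rw [h] at this
    simp [degInner] at this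
  · have := degInner_one_walkOp G hd (e i1)
    rw [heig, degInner_smul_right] at this
    have h2 : (1 - μ i1) * degInner G 1 (e i1) = 0 := by linarith
    exact (mul_eq_zero.1 h2).resolve_left (by linarith)
  · -- The span of `1` and `f` contains a nonzero function orthogonal to the first eigenfunction.
    set α := degInner G (e i0) f
    set β := degInner G (e i0) 1
    have h1 : degInner G (e i0) (α • 1 + (-β) • f) = 0 := by
      rw [degInner_add_right, degInner_smul_right, degInner_smul_right]
      ring
    have h2 := hmain _ h1
    have h3 : walkOp G (α • 1 + (-β) • f) = α • 1 + (-β) • walkOp G f := by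
      rw [walkOp_add, walkOp_smul, walkOp_smul, walkOp_one G hd]
    have hf' : degInner G f 1 = 0 := by rw [degInner_comm]; exact hf
    have hPf : degInner G 1 (walkOp G f) = 0 := by rw [degInner_one_walkOp G hd, hf]
    rw [h3] at h2
    simp only [degInner_add_left, degInner_add_right, degInner_smul_left, degInner_smul_right,
      hf, hf', hPf] at h2
    have h4 : 0 ≤ degInner G (1 : V → ℝ) 1 := degInner_self_nonneg G _
    have h5 : 0 ≤ (1 - μ i1) * (α ^ 2 * degInner G (1 : V → ℝ) 1) :=
      mul_nonneg (by linarith) (mul_nonneg (sq_nonneg _) h4)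
    have h6 := degInner_self_sub_walkOp G hd f
    by_cases hβ : β = 0
    · -- Constants are then orthogonal to the first eigenfunction, which is absurd.
      exfalso
      have h7 := hmain 1 hβ
      rw [walkOp_one G hd] at h7
      have h8 : 0 < degInner G (1 : V → ℝ) 1 := by
        refine lt_of_le_of_ne h4 fun h => ?_
        have := congrFun (degInner_self_eq_zero G hd h.symm) hG.nonempty.some
        simp at this
      nlinarith
    · have hβ2 : 0 < β ^ 2 := by positivity
      have h9 : β ^ 2 * degInner G f (walkOp G f) ≤ β ^ 2 * (μ i1 * degInner G f f) := by
        nlinarith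
      have := le_of_mul_le_mul_left h9 hβ2
      linarith

end Spectral

/-! ### Cheeger's inequality -/

section Cheeger

variable {V : Type*} [Fintype V] [DecidableEq V] (G : SimpleGraph V) [DecidableRel G.Adj]

theorem conductance_mul_vol_le {U : Finset V} (h0 : 0 < vol G U)
    (h1 : 2 * vol G U ≤ vol G Finset.univ) :
    conductance G * vol G U ≤ (G.interedges U Uᶜ).card := by
  have hb : BddBelow (Set.range fun U : {U : Finset V //
      0 < vol G U ∧ 2 * vol G U ≤ vol G Finset.univ} =>
      ((G.interedges U.1 U.1ᶜ).card : ℝ) / (vol G U.1 : ℝ)) := (Set.finite_range _).bddBelow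
  have h := ciInf_le hb ⟨U, h0, h1⟩
  rwa [le_div_iff₀ (by exact_mod_cast h0)] at h

theorem vol_mono {U W : Finset V} (h : U ⊆ W) : vol G U ≤ vol G W :=
  Finset.sum_le_sum_of_subset h

theorem vol_pos (hd : ∀ x, 0 < G.degree x) {U : Finset V} (hU : U.Nonempty) : 0 < vol G U :=
  Finset.sum_pos (fun x _ => hd x) hU

theorem vol_add_vol_compl (U : Finset V) : vol G U + vol G Uᶜ = vol G Finset.univ :=
  Finset.sum_add_sum_compl U _

theorem conductance_pos (hG : G.Connected) (hV : 2 ≤ Fintype.card V) : 0 < conductance G := by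
  have hd := degree_pos_of_connected G hG hV
  have hnt : Nontrivial V := Fintype.one_lt_card_iff_nontrivial.1 hV
  have hne : Nonempty {U : Finset V // 0 < vol G U ∧ 2 * vol G U ≤ vol G Finset.univ} := by
    obtain ⟨a, b, hab⟩ := exists_pair_ne V
    have h := vol_add_vol_compl G {a}
    rcases le_total (vol G {a}) (vol G {a}ᶜ) with hle | hle
    · exact ⟨⟨{a}, vol_pos G hd (Finset.singleton_nonempty a), by omega⟩⟩
    · exact ⟨⟨{a}ᶜ, vol_pos G hd ⟨b, by simpa using hab.symm⟩, by omega⟩⟩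
  obtain ⟨U, hU⟩ := exists_eq_ciInf_of_finite (f := fun U : {U : Finset V //
      0 < vol G U ∧ 2 * vol G U ≤ vol G Finset.univ} =>
      ((G.interedges U.1 U.1ᶜ).card : ℝ) / (vol G U.1 : ℝ))
  have hdef : conductance G = ((G.interedges U.1 U.1ᶜ).card : ℝ) / (vol G U.1 : ℝ) := hU.symm
  rw [hdef]
  have hvol := U.2
  refine div_pos ?_ (by exact_mod_cast hvol.1)
  have hne1 : U.1.Nonempty := by
    rw [Finset.nonempty_iff_ne_empty]
    intro h; rw [h] at hvol; simp [vol] at hvol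
  have hne2 : (U.1ᶜ).Nonempty := by
    rw [Finset.nonempty_iff_ne_empty]
    intro h
    have := vol_add_vol_compl G U.1
    rw [h] at this; simp only [vol, Finset.sum_empty] at this hvol; omega
  obtain ⟨a, ha⟩ := hne1
  obtain ⟨b, hb⟩ := hne2
  obtain ⟨p⟩ := hG.preconnected a b
  obtain ⟨e, _, he1, he2⟩ := p.exists_boundary_dart (U.1 : Set V) ha (by simpa using hb)
  have : (e.fst, e.snd) ∈ G.interedges U.1 U.1ᶜ := by
    rw [SimpleGraph.mem_interedges_iff]
    exact ⟨by simpa using he1, by simpa using he2, e.adj⟩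
  exact_mod_cast Finset.card_pos.2 ⟨_, this⟩

theorem sum_arcs_indicator_boundary (U : Finset V) :
    ∑ p ∈ arcs G, (if p.1 ∈ U ∧ p.2 ∉ U then (1 : ℝ) else 0) = (G.interedges U Uᶜ).card := by
  rw [← Finset.sum_filter, Finset.sum_const, nsmul_eq_mul, mul_one]
  congr 2
  ext p
  simp only [Finset.mem_filter, mem_arcs, SimpleGraph.mem_interedges_iff, Finset.mem_compl]
  tauto

/-- The coarea inequality. It is proved by peeling off the lowest level of `F`, whose contribution
is bounded by the definition of the conductance. -/
theorem coarea (F : V → ℝ) (hF : ∀ x, 0 ≤ F x)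
    (hvol : 2 * vol G (Finset.univ.filter fun x => 0 < F x) ≤ vol G Finset.univ) :
    2 * conductance G * ∑ x, (G.degree x : ℝ) * F x ≤ ∑ p ∈ arcs G, |F p.1 - F p.2| := by
  induction hn : (Finset.univ.filter fun x => 0 < F x).card using Nat.strong_induction_on
    generalizing F with
  | _ n ih =>
    set U := Finset.univ.filter fun x => 0 < F x with hU
    have hmem : ∀ x, x ∈ U ↔ 0 < F x := fun x => by simp [hU]
    have hout : ∀ x, x ∉ U → F x = 0 := fun x hx =>
      le_antisymm (not_lt.1 fun h => hx ((hmem x).2 h)) (hF x)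
    rcases U.eq_empty_or_nonempty with h0 | hne
    · have hz : ∀ x, F x = 0 := fun x => hout x (by rw [h0]; simp)
      simp [hz]
    · obtain ⟨z, hz, hmin⟩ := Finset.exists_min_image U F hne
      set m := F z with hm
      have hmpos : 0 < m := (hmem z).1 hz
      set F' : V → ℝ := fun x => if x ∈ U then F x - m else F x with hF'
      have hF'0 : ∀ x, 0 ≤ F' x := fun x => by
        by_cases hx : x ∈ U
        · simp only [hF', hx, if_true]; linarith [hmin x hx]
        · simp only [hF', hx, if_false]; exact hF x
      have hsub : (Finset.univ.filter fun x => 0 < F' x) ⊂ U := by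
        rw [Finset.ssubset_iff_of_subset]
        · refine ⟨z, hz, ?_⟩
          simp [hF', hz, hm]
        · intro x hx
          by_contra hxU
          have h1 : 0 < F' x := by simpa using hx
          simp only [hF', hxU, if_false, hout x hxU] at h1
          exact lt_irrefl _ h1
      have hih := ih _ (hn ▸ Finset.card_lt_card hsub) F' hF'0
        ((Nat.mul_le_mul_left 2 (vol_mono G hsub.subset)).trans hvol) rfl
      -- The two indicators cannot both be `1`; either accounts for an edge leaving `U`, and the
      -- level `m` lies between the values of `F` at its ends.
      have hpt : ∀ x y, |F x - F y| = |F' x - F' y| + m * ((if x ∈ U ∧ y ∉ U then (1 : ℝ) else 0) +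
          (if y ∈ U ∧ x ∉ U then (1 : ℝ) else 0)) := by
        intro x y
        by_cases hx : x ∈ U <;> by_cases hy : y ∈ U <;> simp only [hF', hx, hy, if_true, if_false,
          not_true, not_false_iff, and_true, and_false]
        · rw [sub_sub_sub_cancel_right]; ring
        · rw [hout y hy, sub_zero, sub_zero, abs_of_nonneg (hF x), abs_of_nonneg]
          · ring
          · linarith [hmin x hx]
        · rw [hout x hx, zero_sub, zero_sub, abs_neg, abs_neg, abs_of_nonneg (hF y), abs_of_nonneg]
          · ring
          · linarith [hmin y hy]
        · ring
      have hsum : ∑ p ∈ arcs G, |F p.1 - F p.2| =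
          ∑ p ∈ arcs G, |F' p.1 - F' p.2| + 2 * m * (G.interedges U Uᶜ).card := by
        rw [Finset.sum_congr rfl fun p _ => hpt p.1 p.2, Finset.sum_add_distrib, ← Finset.mul_sum,
          Finset.sum_add_distrib, sum_arcs_swap G fun x y => if y ∈ U ∧ x ∉ U then (1 : ℝ) else 0,
          sum_arcs_indicator_boundary]
        ring
      have hF'sum : ∑ x, (G.degree x : ℝ) * F x =
          ∑ x, (G.degree x : ℝ) * F' x + m * vol G U := by
        have hpt2 : ∀ x, (G.degree x : ℝ) * F x =
            (G.degree x : ℝ) * F' x + m * if x ∈ U then (G.degree x : ℝ) else 0 := fun x => by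
          by_cases hx : x ∈ U <;> simp only [hF', hx, if_true, if_false] <;> ring
        rw [Finset.sum_congr rfl fun x _ => hpt2 x, Finset.sum_add_distrib, ← Finset.mul_sum, vol]
        simp
      have hcond : conductance G * vol G U ≤ (G.interedges U Uᶜ).card := by
        rcases Nat.eq_zero_or_pos (vol G U) with h | h
        · rw [h]; simp
        · exact conductance_mul_vol_le G h hvol
      rw [hsum, hF'sum]
      nlinarith [mul_le_mul_of_nonneg_left hcond hmpos.le]

/-- A nonnegative function which is small in the sense of the hypothesis and at which the walk has
Rayleigh quotient at least `l` shows that the conductance is at most `2 √(1 - l)`. -/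
theorem conductance_sq_le_of_pos (hG : G.Connected) (hV : 2 ≤ Fintype.card V) {l : ℝ}
    {g : V → ℝ} (hg : ∀ x, 0 ≤ g x) (hg0 : g ≠ 0)
    (hvol : 2 * vol G (Finset.univ.filter fun x => 0 < g x) ≤ vol G Finset.univ)
    (hray : l * degInner G g g ≤ degInner G g (walkOp G g)) :
    conductance G ^ 2 ≤ 4 * (1 - l) := by
  have hd := degree_pos_of_connected G hG hV
  have hΦ := conductance_pos G hG hV
  have hpos : 0 < degInner G g g := lt_of_le_of_ne (degInner_self_nonneg G g)
    fun h => hg0 (degInner_self_eq_zero G hd h.symm)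
  have hfilter : (Finset.univ.filter fun x => 0 < g x ^ 2) =
      Finset.univ.filter fun x => 0 < g x := by
    ext x
    simp only [Finset.mem_filter, Finset.mem_univ, true_and]
    exact ⟨fun h => lt_of_le_of_ne (hg x) fun h0 => by rw [← h0] at h; simp at h,
      fun h => by positivity⟩
  have h1 := coarea G (fun x => g x ^ 2) (fun x => sq_nonneg _) (by rw [hfilter]; exact hvol)
  have h2 : ∑ x, (G.degree x : ℝ) * g x ^ 2 = degInner G g g :=
    Finset.sum_congr rfl fun _ _ => by ring
  rw [h2] at h1
  -- Cauchy–Schwarz for `|g x ^ 2 - g y ^ 2| = |g x - g y| * |g x + g y|`.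
  have h3 : (∑ p ∈ arcs G, |g p.1 ^ 2 - g p.2 ^ 2|) ^ 2 ≤
      energy G g * (4 * degInner G g g) := by
    have h4 := Finset.sum_mul_sq_le_sq_mul_sq (arcs G) (fun p => |g p.1 - g p.2|)
      (fun p => |g p.1 + g p.2|)
    have h5 : ∑ p ∈ arcs G, |g p.1 + g p.2| ^ 2 = 4 * degInner G g (walkOp G g) := by
      rw [degInner_walkOp G hd, mul_div_cancel₀ _ (by norm_num)]
      exact Finset.sum_congr rfl fun p _ => by rw [sq_abs, pow_two]
    have h6 : ∑ p ∈ arcs G, |g p.1 - g p.2| ^ 2 = energy G g := by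
      simp only [sq_abs, energy]
    rw [h5, h6] at h4
    have h7 : ∑ p ∈ arcs G, |g p.1 ^ 2 - g p.2 ^ 2| =
        ∑ p ∈ arcs G, |g p.1 - g p.2| * |g p.1 + g p.2| :=
      Finset.sum_congr rfl fun p _ => by rw [← abs_mul]; congr 1; ring
    rw [h7]
    exact h4.trans (mul_le_mul_of_nonneg_left (by linarith [walkOp_le_self G hd g])
      (energy_nonneg G g))
  have h8 : energy G g ≤ 4 * ((1 - l) * degInner G g g) := by
    linarith [degInner_self_sub_walkOp G hd g]
  have h9 : (2 * conductance G * degInner G g g) ^ 2 ≤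
      4 * ((1 - l) * degInner G g g) * (4 * degInner G g g) :=
    (pow_le_pow_left₀ (by positivity) h1 2).trans
      (h3.trans (mul_le_mul_of_nonneg_right h8 (by positivity)))
  have h10 : degInner G g g ^ 2 * conductance G ^ 2 ≤ degInner G g g ^ 2 * (4 * (1 - l)) := by
    nlinarith
  exact le_of_mul_le_mul_left h10 (by positivity)

/-- The difficult half of Cheeger's inequality, applied to the positive or to the negative part of
an eigenfunction. -/
theorem conductance_le (hG : G.Connected) (hV : 2 ≤ Fintype.card V) :
    conductance G ≤ 2 * Real.sqrt (1 - lambda2 G) := by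
  have hd := degree_pos_of_connected G hG hV
  have hne : Nonempty V := hG.nonempty
  obtain ⟨h0, h1, ⟨f, hf0, hfm, hfe⟩, _⟩ := spectral_gap G hG hV
  have key : ∀ f : V → ℝ, f ≠ 0 → degInner G 1 f = 0 → walkOp G f = lambda2 G • f →
      2 * vol G (Finset.univ.filter fun x => 0 < f x) ≤ vol G Finset.univ →
      conductance G ^ 2 ≤ 4 * (1 - lambda2 G) := by
    intro f hf0 hfm hfe hvol
    have hfilter : (Finset.univ.filter fun x => 0 < max (f x) 0) =
        Finset.univ.filter fun x => 0 < f x := by ext x; simp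
    refine conductance_sq_le_of_pos G hG hV (g := fun x => max (f x) 0)
      (fun x => le_max_right _ _) (fun hzero => hf0 ?_) (by rw [hfilter]; exact hvol) ?_
    · have hle : ∀ x, f x ≤ 0 := fun x => by simpa using congrFun hzero x
      have hz := (Finset.sum_eq_zero_iff_of_nonpos (fun x _ => by
        simpa using mul_nonpos_of_nonneg_of_nonpos (Nat.cast_nonneg (α := ℝ) (G.degree x))
          (hle x))).1 hfm
      funext x
      have hx : (0 : ℝ) < G.degree x := by exact_mod_cast hd x
      have := hz x (Finset.mem_univ x)
      simpa [hx.ne', (hd x).ne'] using this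
    · rw [degInner, degInner, Finset.mul_sum]
      refine Finset.sum_le_sum fun x _ => ?_
      rcases le_total (f x) 0 with hx | hx
      · simp [max_eq_right hx]
      · -- Truncation to the positive part only increases the values of the walk operator.
        have hw : lambda2 G * f x ≤ walkOp G (fun x => max (f x) 0) x := by
          have := congrFun hfe x
          simp only [Pi.smul_apply, smul_eq_mul] at this
          rw [← this]
          exact Finset.sum_le_sum fun y _ =>
            mul_le_mul_of_nonneg_left (le_max_left _ _) (transitionMatrix_nonneg G x y)
        simp only [max_eq_left hx]
        have hdx : (0 : ℝ) ≤ G.degree x * f x := mul_nonneg (Nat.cast_nonneg _) hx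
        nlinarith [mul_le_mul_of_nonneg_left hw hdx]
  have hsq : conductance G ^ 2 ≤ 4 * (1 - lambda2 G) := by
    by_cases hvol : 2 * vol G (Finset.univ.filter fun x => 0 < f x) ≤ vol G Finset.univ
    · exact key f hf0 hfm hfe hvol
    · refine key (-f) (neg_ne_zero.2 hf0) ?_ ?_ ?_
      · rw [← neg_one_smul ℝ f, degInner_smul_right, hfm, mul_zero]
      · rw [← neg_one_smul ℝ f, walkOp_smul, hfe, smul_comm]
      · have hsub : (Finset.univ.filter fun x => 0 < (-f) x) ⊆
            (Finset.univ.filter fun x => 0 < f x)ᶜ := by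
          intro x hx
          simp only [Finset.mem_filter, Finset.mem_univ, true_and, Pi.neg_apply,
            Finset.mem_compl] at hx ⊢
          linarith
        have h2 := vol_mono G hsub
        have h3 := vol_add_vol_compl G (Finset.univ.filter fun x => 0 < f x)
        omega
  refine abs_le_of_sq_le_sq' ?_ (by positivity) |>.2
  rw [mul_pow, Real.sq_sqrt (by linarith)]
  linarith

end Cheeger

/-! ### Heat kernel bounds -/

section HeatKernel

variable {V : Type*} [Fintype V] [DecidableEq V] (G : SimpleGraph V) [DecidableRel G.Adj]

theorem iterate_walkOp_apply (t : ℕ) (f : V → ℝ) (x : V) :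
    (walkOp G)^[t] f x = ∑ y, (transitionMatrix G ^ t) x y * f y := by
  induction t generalizing x with
  | zero => simp [Matrix.one_apply]
  | succ t ih =>
    rw [Function.iterate_succ_apply', walkOp, pow_succ']
    simp_rw [ih, Matrix.mul_apply, Finset.mul_sum, Finset.sum_mul]
    rw [Finset.sum_comm]
    exact Finset.sum_congr rfl fun _ _ => Finset.sum_congr rfl fun _ _ => by ring

theorem transitionMatrix_pow_nonneg (t : ℕ) (x y : V) : 0 ≤ (transitionMatrix G ^ t) x y := by
  induction t generalizing x with
  | zero => rw [pow_zero, Matrix.one_apply]; split_ifs <;> norm_num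
  | succ t ih =>
    rw [pow_succ', Matrix.mul_apply]
    exact Finset.sum_nonneg fun z _ => mul_nonneg (transitionMatrix_nonneg G x z) (ih z)

theorem transitionMatrix_pow_row_sum (hd : ∀ x, 0 < G.degree x) (t : ℕ) (x : V) :
    ∑ y, (transitionMatrix G ^ t) x y = 1 := by
  have h : (walkOp G)^[t] 1 = 1 := by
    induction t with
    | zero => rfl
    | succ t ih => rw [Function.iterate_succ_apply', ih, walkOp_one G hd]
  have := congrFun h x
  rw [iterate_walkOp_apply] at this
  simpa using this

/-- The density, with respect to the degree measure, of the point mass at `x`, minus its mean. -/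
def centeredDelta (x : V) : V → ℝ :=
  fun z => (if z = x then ((G.degree x : ℝ))⁻¹ else 0) - (totalVol G)⁻¹

/-- The density, with respect to the degree measure, of the lazy walk at time `t` started at `x`,
minus its mean. -/
def heat (x : V) (t : ℕ) : V → ℝ := (walkOp G)^[t] (centeredDelta G x)

theorem heat_succ (x : V) (t : ℕ) : heat G x (t + 1) = walkOp G (heat G x t) :=
  Function.iterate_succ_apply' _ _ _

theorem totalVol_pos [Nonempty V] (hd : ∀ x, 0 < G.degree x) : 0 < totalVol G :=
  Finset.sum_pos (fun x _ => by exact_mod_cast hd x) Finset.univ_nonempty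

theorem degInner_centeredDelta (hd : ∀ x, 0 < G.degree x) (f : V → ℝ) (x : V) :
    degInner G f (centeredDelta G x) = f x - (totalVol G)⁻¹ * degInner G 1 f := by
  have hx : (0 : ℝ) < G.degree x := by exact_mod_cast hd x
  simp only [degInner, centeredDelta, mul_sub, Finset.sum_sub_distrib, Finset.mul_sum]
  congr 1
  · simp; field_simp
  · exact Finset.sum_congr rfl fun y _ => by simp; ring

theorem degInner_one_heat [Nonempty V] (hd : ∀ x, 0 < G.degree x) (x : V) (t : ℕ) :
    degInner G 1 (heat G x t) = 0 := by
  induction t with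
  | zero =>
    rw [heat, Function.iterate_zero_apply, degInner_centeredDelta G hd, degInner_one_one,
      inv_mul_cancel₀ (totalVol_pos G hd).ne']
    simp
  | succ t ih => rw [heat_succ, degInner_one_walkOp G hd, ih]

/-- The semigroup property. -/
theorem degInner_heat_heat [Nonempty V] (hd : ∀ x, 0 < G.degree x) (x y : V) (s t : ℕ) :
    degInner G (heat G x s) (heat G y t) = heat G x (s + t) y := by
  induction t generalizing s with
  | zero =>
    conv_lhs => rw [heat.eq_def G y 0, Function.iterate_zero_apply]
    rw [degInner_centeredDelta G hd, degInner_one_heat G hd, mul_zero, sub_zero, add_zero]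
  | succ t ih =>
    rw [heat_succ, degInner_walkOp_comm G hd, ← heat_succ, ih,
      show s + 1 + t = s + (t + 1) by omega]

/-- Return densities decrease in time, at even times since `P ≤ 1` and at odd times since
`P ^ 2 ≤ P`. -/
theorem heat_self_succ_le [Nonempty V] (hd : ∀ x, 0 < G.degree x) (x : V) (m : ℕ) :
    heat G x (m + 1) x ≤ heat G x m x := by
  obtain ⟨j, rfl | rfl⟩ := Nat.even_or_odd' m
  · have h1 := degInner_heat_heat G hd x x j j
    have h2 := degInner_heat_heat G hd x x j (j + 1)
    have h3 := walkOp_le_self G hd (heat G x j)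
    rw [← heat_succ] at h3
    rw [← two_mul] at h1
    rw [← add_assoc, ← two_mul] at h2
    linarith
  · have h1 := degInner_heat_heat G hd x x j (j + 1)
    have h2 := degInner_heat_heat G hd x x (j + 1) (j + 1)
    have h3 := degInner_walkOp_walkOp_le G hd (heat G x j)
    rw [← heat_succ] at h3
    rw [show j + (j + 1) = 2 * j + 1 by ring] at h1
    rw [show j + 1 + (j + 1) = 2 * j + 1 + 1 by ring] at h2
    linarith

theorem heat_self_antitone [Nonempty V] (hd : ∀ x, 0 < G.degree x) (x : V) :
    Antitone fun m => heat G x m x :=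
  antitone_nat_of_succ_le fun m => heat_self_succ_le G hd x m

/-- The squared norm of the density at time `t`, which is the return density at time `2 t`. -/
def heatNorm (x : V) (t : ℕ) : ℝ := degInner G (heat G x t) (heat G x t)

theorem heatNorm_nonneg (x : V) (t : ℕ) : 0 ≤ heatNorm G x t := degInner_self_nonneg G _

theorem heatNorm_eq [Nonempty V] (hd : ∀ x, 0 < G.degree x) (x : V) (t : ℕ) :
    heatNorm G x t = heat G x (t + t) x := degInner_heat_heat G hd x x t t

theorem heatNorm_antitone [Nonempty V] (hd : ∀ x, 0 < G.degree x) (x : V) :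
    Antitone (heatNorm G x) := fun s t hst => by
  rw [heatNorm_eq G hd, heatNorm_eq G hd]
  exact heat_self_antitone G hd x (add_le_add hst hst)

theorem energy_heat_le (hd : ∀ x, 0 < G.degree x) (x : V) (t : ℕ) :
    energy G (heat G x t) / 4 ≤ heatNorm G x t - heatNorm G x (t + 1) := by
  rw [heatNorm, heatNorm, heat_succ]
  linarith [degInner_self_sub_walkOp G hd (heat G x t),
    degInner_walkOp_walkOp_le G hd (heat G x t)]

theorem heatNorm_zero_le [Nonempty V] (hd : ∀ x, 0 < G.degree x) (hδ : 0 < G.minDegree) (x : V) :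
    heatNorm G x 0 ≤ (G.minDegree : ℝ)⁻¹ := by
  rw [heatNorm_eq G hd]
  simp only [heat, add_zero, Function.iterate_zero_apply, centeredDelta, if_true]
  have h1 : ((G.degree x : ℝ))⁻¹ ≤ (G.minDegree : ℝ)⁻¹ :=
    inv_anti₀ (by exact_mod_cast hδ) (by exact_mod_cast G.minDegree_le_degree x)
  have h2 := inv_nonneg.2 (totalVol_pos G hd).le
  linarith

/-- The Sobolev inequality, applied to the heat kernel as in Nash's argument. -/
theorem heatNorm_nash (hG : G.Connected) (hV : 2 ≤ Fintype.card V) (x : V) (t : ℕ) :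
    (G.minDegree : ℝ) ^ 2 * heatNorm G x t ^ 3 ≤
      4096 * (heatNorm G x t - heatNorm G x (t + 1)) := by
  have hd := degree_pos_of_connected G hG hV
  have : Nonempty V := ⟨x⟩
  have h1 := sobolev G hG hV (degInner_one_heat G hd x t) x
  have h2 := energy_heat_le G hd x t
  have h0 := heatNorm_nonneg G x t
  have h3 : heatNorm G x t ≤ heat G x t x := by
    rw [heatNorm_eq G hd]
    exact heat_self_antitone G hd x (Nat.le_add_left t t)
  rcases h0.eq_or_lt with h | h
  · have := energy_nonneg G (heat G x t)
    rw [← h] at h2 ⊢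
    simp only [zero_sub] at h2 ⊢
    nlinarith
  · refine le_of_mul_le_mul_right ?_ h
    calc (G.minDegree : ℝ) ^ 2 * heatNorm G x t ^ 3 * heatNorm G x t
        = (G.minDegree : ℝ) ^ 2 * heatNorm G x t ^ 4 := by ring
      _ ≤ (G.minDegree : ℝ) ^ 2 * heat G x t x ^ 4 := by gcongr
      _ ≤ 1024 * (energy G (heat G x t) * heatNorm G x t) := h1
      _ ≤ 1024 * ((4 * (heatNorm G x t - heatNorm G x (t + 1))) * heatNorm G x t) := by
          gcongr; linarith
      _ = _ := by ring

theorem heatNorm_gap (hG : G.Connected) (hV : 2 ≤ Fintype.card V) (x : V) (t : ℕ) :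
    (1 - lambda2 G) * heatNorm G x t ≤ heatNorm G x t - heatNorm G x (t + 1) := by
  have hd := degree_pos_of_connected G hG hV
  have : Nonempty V := ⟨x⟩
  exact ((spectral_gap G hG hV).2.2.2 _ (degInner_one_heat G hd x t)).trans
    (energy_heat_le G hd x t)

/-- A sequence which bounds `heatNorm G x` for every vertex `x`, when `a` is the inverse minimum
degree and `γ` the spectral gap. It combines exponential decay at rate `γ` with the decay
`y' = - y ^ 3` given by the Sobolev inequality. -/
def heatMajorant (a γ : ℝ) : ℕ → ℝ
  | 0 => a
  | t + 1 =>
    heatMajorant a γ t - (γ * heatMajorant a γ t + heatMajorant a γ t ^ 3 / (64 * a) ^ 2) / 2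

/-- The map defining `heatMajorant` is monotone on `[0, a]`. -/
theorem heatMajorant_step_mono {a γ y z : ℝ} (ha : 0 < a) (hγ1 : γ ≤ 1)
    (hy : 0 ≤ y) (hyz : y ≤ z) (hza : z ≤ a) :
    y - (γ * y + y ^ 3 / (64 * a) ^ 2) / 2 ≤ z - (γ * z + z ^ 3 / (64 * a) ^ 2) / 2 := by
  have h1 : z ^ 3 / (64 * a) ^ 2 - y ^ 3 / (64 * a) ^ 2 ≤ z - y := by
    rw [← sub_div, div_le_iff₀ (by positivity)]
    have h2 : z ^ 3 - y ^ 3 = (z - y) * (z ^ 2 + z * y + y ^ 2) := by ring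
    rw [h2]
    refine mul_le_mul_of_nonneg_left ?_ (by linarith)
    nlinarith
  nlinarith

theorem heatMajorant_mem {a γ : ℝ} (ha : 0 < a) (hγ0 : 0 ≤ γ) (hγ1 : γ ≤ 1) (t : ℕ) :
    0 ≤ heatMajorant a γ t ∧ heatMajorant a γ t ≤ a := by
  induction t with
  | zero => exact ⟨ha.le, le_rfl⟩
  | succ t ih =>
    rw [heatMajorant]
    constructor
    · have := heatMajorant_step_mono ha hγ1 le_rfl ih.1 ih.2
      simpa using this
    · have h1 := mul_nonneg hγ0 ih.1
      have h2 : 0 ≤ heatMajorant a γ t ^ 3 / (64 * a) ^ 2 :=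
        div_nonneg (pow_nonneg ih.1 3) (sq_nonneg _)
      linarith [ih.2]

/-- The sum of the majorant, by comparison with the concave function `y / (y + c)`. -/
theorem sum_heatMajorant_le {a γ : ℝ} (ha : 0 < a) (hγ0 : 0 < γ) (hγ1 : γ ≤ 1) (s : ℕ) :
    ∑ t ∈ Finset.range s, heatMajorant a γ t ≤ 256 * a / Real.sqrt γ := by
  have hg : 0 < Real.sqrt γ := Real.sqrt_pos.2 hγ0
  have hgg : Real.sqrt γ * Real.sqrt γ = γ := Real.mul_self_sqrt hγ0.le
  set g := Real.sqrt γ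
  -- At `y = c` the two terms `γ y` and `y ^ 3 / (64 a) ^ 2` of the recursion are equal.
  set c := 64 * a * g with hc
  have hcpos : 0 < c := by positivity
  set W : ℝ → ℝ := fun y => y / (y + c) with hW
  have hstep : ∀ t, heatMajorant a γ t ≤
      256 * a / g * (W (heatMajorant a γ t) - W (heatMajorant a γ (t + 1))) := by
    intro t
    have h0 := (heatMajorant_mem ha hγ0.le hγ1 t).1
    have h0' := (heatMajorant_mem ha hγ0.le hγ1 (t + 1)).1
    have hdef : heatMajorant a γ t - heatMajorant a γ (t + 1) =
        (γ * heatMajorant a γ t + heatMajorant a γ t ^ 3 / (64 * a) ^ 2) / 2 := by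
      rw [heatMajorant]; ring
    set y := heatMajorant a γ t
    set z := heatMajorant a γ (t + 1)
    have hdiff : y - z = y * (c ^ 2 + y ^ 2) / (2 * (64 * a) ^ 2) := by
      rw [hdef, hc, ← hgg]; field_simp
    have hzy : z ≤ y := by
      have : 0 ≤ y * (c ^ 2 + y ^ 2) / (2 * (64 * a) ^ 2) := by positivity
      linarith
    have hWd : W y - W z = c * (y - z) / ((y + c) * (z + c)) := by
      simp only [hW]; field_simp; ring
    have h1 : c * (y - z) / ((y + c) * (y + c)) ≤ W y - W z := by
      rw [hWd]
      have : 0 ≤ c * (y - z) := mul_nonneg hcpos.le (by linarith)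
      gcongr
    have h2 : c * y / (4 * (64 * a) ^ 2) ≤ c * (y - z) / ((y + c) * (y + c)) := by
      rw [hdiff, div_le_div_iff₀ (by positivity) (by positivity)]
      have h3 : (y + c) * (y + c) ≤ 2 * (c ^ 2 + y ^ 2) := by nlinarith [sq_nonneg (y - c)]
      calc c * y * ((y + c) * (y + c)) ≤ c * y * (2 * (c ^ 2 + y ^ 2)) := by gcongr
        _ = _ := by field_simp; ring
    have h4 : 256 * a / g * (c * y / (4 * (64 * a) ^ 2)) = y := by
      rw [hc]; field_simp; ring
    rw [← h4]
    exact mul_le_mul_of_nonneg_left (h4.symm ▸ h2.trans h1) (by positivity)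
  refine (Finset.sum_le_sum fun t _ => hstep t).trans ?_
  rw [← Finset.mul_sum, Finset.sum_range_sub' fun t => W (heatMajorant a γ t)]
  have h5 : W (heatMajorant a γ 0) ≤ 1 := by
    have := (heatMajorant_mem ha hγ0.le hγ1 0).1
    simp only [hW]
    rw [div_le_one (by positivity)]
    linarith
  have h6 : 0 ≤ W (heatMajorant a γ s) := by
    have := (heatMajorant_mem ha hγ0.le hγ1 s).1
    simp only [hW]; positivity
  calc _ ≤ 256 * a / g * 1 := mul_le_mul_of_nonneg_left (by linarith) (by positivity)
    _ = _ := mul_one _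

/-- The average of the two bounds on the decrease of `heatNorm`, by the Sobolev inequality and by
the spectral gap, is compared with the recursion of the majorant. -/
theorem heatNorm_le_majorant (hG : G.Connected) (hV : 2 ≤ Fintype.card V) (x : V) (t : ℕ) :
    heatNorm G x t ≤ heatMajorant (G.minDegree : ℝ)⁻¹ (1 - lambda2 G) t := by
  have hd := degree_pos_of_connected G hG hV
  have hδ := minDegree_pos_of_connected G hG hV
  have hδ' : (0 : ℝ) < G.minDegree := by exact_mod_cast hδ
  have hne : Nonempty V := ⟨x⟩
  have hgap := spectral_gap G hG hV
  have ha : (0 : ℝ) < (G.minDegree : ℝ)⁻¹ := inv_pos.2 hδ'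
  induction t with
  | zero => exact heatNorm_zero_le G hd hδ x
  | succ t ih =>
    have h1 := heatNorm_nash G hG hV x t
    have h2 := heatNorm_gap G hG hV x t
    refine le_trans ?_ (heatMajorant_step_mono ha (by linarith [hgap.1]) (heatNorm_nonneg G x t) ih
      (heatMajorant_mem ha (by linarith [hgap.2.1]) (by linarith [hgap.1]) t).2)
    have h3 : heatNorm G x t ^ 3 / (64 * (G.minDegree : ℝ)⁻¹) ^ 2 ≤
        heatNorm G x t - heatNorm G x (t + 1) := by
      rw [div_le_iff₀ (by positivity), mul_pow, inv_pow, ← mul_assoc, ← div_eq_mul_inv,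
        le_div_iff₀ (by positivity)]
      linarith
    linarith

/-- The off-diagonal heat kernel is bounded by the diagonal one, by Cauchy–Schwarz. -/
theorem heat_le_majorant (hG : G.Connected) (hV : 2 ≤ Fintype.card V) (x y : V) (t : ℕ) :
    heat G x t y ≤ heatMajorant (G.minDegree : ℝ)⁻¹ (1 - lambda2 G) (t / 2) := by
  have hd := degree_pos_of_connected G hG hV
  have hne : Nonempty V := ⟨x⟩
  have hx := heatNorm_le_majorant G hG hV x (t / 2)
  have hy := (heatNorm_antitone G hd y (show t / 2 ≤ t - t / 2 by omega)).trans
    (heatNorm_le_majorant G hG hV y (t / 2))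
  have h1 := degInner_sq_le G (heat G x (t / 2)) (heat G y (t - t / 2))
  rw [degInner_heat_heat G hd, show t / 2 + (t - t / 2) = t by omega] at h1
  have h0 := (heatNorm_nonneg G x (t / 2)).trans hx
  refine abs_le_of_sq_le_sq' (h1.trans ?_) h0 |>.2
  rw [pow_two]
  exact mul_le_mul hx hy (heatNorm_nonneg G _ _) h0

theorem transitionMatrix_pow_eq_heat (hd : ∀ x, 0 < G.degree x) (t : ℕ) (x y : V) :
    (transitionMatrix G ^ t) x y = G.degree y * (heat G y t x + (totalVol G)⁻¹) := by
  have hy : (0 : ℝ) < G.degree y := by exact_mod_cast hd y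
  rw [heat, iterate_walkOp_apply]
  simp only [centeredDelta, mul_sub, Finset.sum_sub_distrib, mul_ite, mul_zero,
    ← Finset.sum_mul, transitionMatrix_pow_row_sum G hd]
  simp
  field_simp

theorem sum_range_div_two_le {f : ℕ → ℝ} {b : ℝ}
    (hb : ∀ s, ∑ t ∈ Finset.range s, f t ≤ b) (s : ℕ) (h0 : ∀ t, 0 ≤ f t) :
    ∑ t ∈ Finset.range s, f (t / 2) ≤ 2 * b := by
  have h1 : ∀ s, ∑ t ∈ Finset.range (2 * s), f (t / 2) = 2 * ∑ t ∈ Finset.range s, f t := by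
    intro s
    induction s with
    | zero => simp
    | succ s ih =>
      rw [show 2 * (s + 1) = 2 * s + 1 + 1 by ring, Finset.sum_range_succ, Finset.sum_range_succ,
        ih, Finset.sum_range_succ, show 2 * s / 2 = s by omega, show (2 * s + 1) / 2 = s by omega]
      ring
  calc _ ≤ ∑ t ∈ Finset.range (2 * s), f (t / 2) :=
        Finset.sum_le_sum_of_subset_of_nonneg (Finset.range_mono (by omega)) fun _ _ _ => h0 _
    _ ≤ _ := by rw [h1]; linarith [hb s]

/-- An upper bound, uniform over all pairs of vertices, for the `t`-step transition probability. -/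
def kernelBound (t : ℕ) : ℝ :=
  G.maxDegree * (heatMajorant (G.minDegree : ℝ)⁻¹ (1 - lambda2 G) (t / 2) + (totalVol G)⁻¹)

theorem kernelBound_nonneg (hG : G.Connected) (hV : 2 ≤ Fintype.card V) (t : ℕ) :
    0 ≤ kernelBound G t := by
  have hd := degree_pos_of_connected G hG hV
  have hne := hG.nonempty
  have hgap := spectral_gap G hG hV
  have hδ : (0 : ℝ) < G.minDegree := by exact_mod_cast minDegree_pos_of_connected G hG hV
  have h1 := (heatMajorant_mem (inv_pos.2 hδ) (by linarith [hgap.2.1] : 0 ≤ 1 - lambda2 G)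
    (by linarith [hgap.1]) (t / 2)).1
  have := inv_nonneg.2 (totalVol_pos G hd).le
  exact mul_nonneg (Nat.cast_nonneg _) (by linarith)

theorem transitionMatrix_pow_le (hG : G.Connected) (hV : 2 ≤ Fintype.card V) (t : ℕ) (x y : V) :
    (transitionMatrix G ^ t) x y ≤ kernelBound G t := by
  have hd := degree_pos_of_connected G hG hV
  have hk := kernelBound_nonneg G hG hV t
  have hle := heat_le_majorant G hG hV y x t
  have hΔ : (G.degree y : ℝ) ≤ G.maxDegree := by exact_mod_cast G.degree_le_maxDegree y
  have hpos : (0 : ℝ) < G.degree y := by exact_mod_cast hd y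
  have h0 := transitionMatrix_pow_nonneg G t x y
  rw [transitionMatrix_pow_eq_heat G hd] at h0 ⊢
  have h1 : 0 ≤ heat G y t x + (totalVol G)⁻¹ := nonneg_of_mul_nonneg_right h0 hpos
  exact mul_le_mul hΔ (by linarith) h1 (Nat.cast_nonneg _)

theorem card_mul_minDegree_le : (Fintype.card V : ℝ) * G.minDegree ≤ totalVol G := by
  rw [totalVol, ← nsmul_eq_mul, ← Finset.card_univ]
  exact Finset.card_nsmul_le_sum _ _ _ fun x _ => by exact_mod_cast G.minDegree_le_degree x

theorem totalVol_le : totalVol G ≤ (Fintype.card V : ℝ) * G.maxDegree := by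
  rw [totalVol, ← nsmul_eq_mul, ← Finset.card_univ]
  exact Finset.sum_le_card_nsmul _ _ _ fun x _ => by exact_mod_cast G.degree_le_maxDegree x

/-- A bound for the expected number of visits to a vertex, or of meetings with a trajectory, within
`s` steps: a transient part of order `Γ / √(1 - λ₂)` and a stationary part. -/
theorem sum_kernelBound_le (hG : G.Connected) (hV : 2 ≤ Fintype.card V) (s : ℕ) :
    ∑ t ∈ Finset.range s, kernelBound G t ≤
      512 * degreeRatio G / Real.sqrt (1 - lambda2 G) +
        degreeRatio G * s / Fintype.card V := by
  have hgap := spectral_gap G hG hV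
  have hδ : (0 : ℝ) < G.minDegree := by exact_mod_cast minDegree_pos_of_connected G hG hV
  have hn : (0 : ℝ) < Fintype.card V := by exact_mod_cast (by omega : 0 < Fintype.card V)
  have hg : 0 < Real.sqrt (1 - lambda2 G) := Real.sqrt_pos.2 (by linarith [hgap.2.1])
  have ha := inv_pos.2 hδ
  have h1 := sum_range_div_two_le (sum_heatMajorant_le ha (by linarith [hgap.2.1])
    (by linarith [hgap.1] : 1 - lambda2 G ≤ 1)) s
    fun t => (heatMajorant_mem ha (by linarith [hgap.2.1]) (by linarith [hgap.1]) t).1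
  simp only [kernelBound]
  rw [← Finset.mul_sum, Finset.sum_add_distrib, Finset.sum_const, Finset.card_range, nsmul_eq_mul,
    mul_add]
  refine add_le_add ((mul_le_mul_of_nonneg_left h1 (Nat.cast_nonneg _)).trans_eq ?_) ?_
  · rw [degreeRatio]; field_simp; ring
  · have h2 : (totalVol G)⁻¹ ≤ ((Fintype.card V : ℝ) * G.minDegree)⁻¹ :=
      inv_anti₀ (by positivity) (card_mul_minDegree_le G)
    calc (G.maxDegree : ℝ) * (s * (totalVol G)⁻¹)
        ≤ G.maxDegree * (s * ((Fintype.card V : ℝ) * G.minDegree)⁻¹) := by gcongr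
      _ = _ := by rw [degreeRatio]; field_simp

end HeatKernel

/-! ### Avoiding a moving target -/

section Avoid

variable {V : Type*} [Fintype V] [DecidableEq V] (G : SimpleGraph V) [DecidableRel G.Adj]

/-- The quantity `Γ n / √(1 - λ₂)`, up to constants an upper bound for the hitting time. -/
def hitScale : ℝ := degreeRatio G * Fintype.card V / Real.sqrt (1 - lambda2 G)

/-- The probability that the lazy walk `X` started at `x` satisfies `X i ≠ h i` for all `i < t`. -/
def avoid : ℕ → V → (ℕ → V) → ℝ
  | 0, _, _ => 1
  | t + 1, x, h => if x = h 0 then 0 else walkOp G (fun y => avoid t y fun i => h (i + 1)) x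

theorem one_le_degreeRatio (hG : G.Connected) (hV : 2 ≤ Fintype.card V) : 1 ≤ degreeRatio G := by
  have hδ : (0 : ℝ) < G.minDegree := by exact_mod_cast minDegree_pos_of_connected G hG hV
  have := hG.nonempty
  rw [degreeRatio, one_le_div hδ]
  exact_mod_cast G.minDegree_le_maxDegree

theorem sqrt_gap_mem (hG : G.Connected) (hV : 2 ≤ Fintype.card V) :
    0 < Real.sqrt (1 - lambda2 G) ∧ Real.sqrt (1 - lambda2 G) ≤ 1 := by
  have hgap := spectral_gap G hG hV
  exact ⟨Real.sqrt_pos.2 (by linarith [hgap.2.1]), Real.sqrt_le_one.2 (by linarith [hgap.1])⟩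

theorem card_le_hitScale (hG : G.Connected) (hV : 2 ≤ Fintype.card V) :
    (Fintype.card V : ℝ) ≤ hitScale G := by
  have h1 := one_le_degreeRatio G hG hV
  have h2 := sqrt_gap_mem G hG hV
  have hn : (0 : ℝ) ≤ Fintype.card V := Nat.cast_nonneg _
  rw [hitScale, le_div_iff₀ h2.1]
  nlinarith [mul_le_mul_of_nonneg_left h2.2 hn, mul_le_mul_of_nonneg_right h1 hn]

theorem two_le_hitScale (hG : G.Connected) (hV : 2 ≤ Fintype.card V) : 2 ≤ hitScale G :=
  le_trans (by exact_mod_cast hV) (card_le_hitScale G hG hV)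

theorem walkOp_mono {f g : V → ℝ} (h : ∀ y, f y ≤ g y) (x : V) : walkOp G f x ≤ walkOp G g x :=
  Finset.sum_le_sum fun y _ => mul_le_mul_of_nonneg_left (h y) (transitionMatrix_nonneg G x y)

theorem walkOp_const (hd : ∀ x, 0 < G.degree x) (c : ℝ) (x : V) :
    walkOp G (fun _ => c) x = c := by
  rw [walkOp, ← Finset.sum_mul, transitionMatrix_row_sum G x (hd x), one_mul]

theorem avoid_nonneg (t : ℕ) (x : V) (h : ℕ → V) : 0 ≤ avoid G t x h := by
  induction t generalizing x h with
  | zero => exact zero_le_one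
  | succ t ih =>
    rw [avoid]
    split_ifs
    · exact le_rfl
    · exact Finset.sum_nonneg fun y _ => mul_nonneg (transitionMatrix_nonneg G x y) (ih _ _)

theorem avoid_le_one (hd : ∀ x, 0 < G.degree x) (t : ℕ) (x : V) (h : ℕ → V) :
    avoid G t x h ≤ 1 := by
  induction t generalizing x h with
  | zero => exact le_rfl
  | succ t ih =>
    rw [avoid]
    split_ifs
    · exact zero_le_one
    · exact (walkOp_mono G (fun y => ih y _) x).trans_eq (walkOp_const G hd 1 x)

theorem degInner_le_of_sq_le {f : V → ℝ} {M : ℝ} (h : ∀ x, f x ^ 2 ≤ M) :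
    degInner G f f ≤ totalVol G * M := by
  rw [degInner, totalVol, Finset.sum_mul]
  exact Finset.sum_le_sum fun x _ => by
    rw [mul_assoc, ← pow_two]; exact mul_le_mul_of_nonneg_left (h x) (Nat.cast_nonneg _)

/-- The Poincaré inequality for functions which vanish at a vertex. -/
theorem degInner_le_energy_of_eq_zero (hG : G.Connected) (hV : 2 ≤ Fintype.card V) {f : V → ℝ}
    {v : V} (hv : f v = 0) : degInner G f f ≤ 64 * hitScale G * energy G f := by
  have hd := degree_pos_of_connected G hG hV
  have hne := hG.nonempty
  have hvol := totalVol_pos G hd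
  have hδ : (0 : ℝ) < G.minDegree := by exact_mod_cast minDegree_pos_of_connected G hG hV
  have hs := (sqrt_gap_mem G hG hV).1
  have hgap := spectral_gap G hG hV
  have hss : Real.sqrt (1 - lambda2 G) ^ 2 = 1 - lambda2 G :=
    Real.sq_sqrt (by linarith [hgap.2.1])
  set s := Real.sqrt (1 - lambda2 G) with hsdef
  set m := degInner G 1 f / totalVol G with hm
  -- After centring, the Sobolev and Poincaré inequalities bound the supremum by the energy alone;
  -- the zero of `f` allows one to return from `g` to `f`.
  set g : V → ℝ := fun x => f x - m with hg
  have hg0 : degInner G 1 g = 0 := by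
    have : g = f + (-m) • 1 := by funext x; simp [hg]; ring
    rw [this, degInner_add_right, degInner_smul_right, degInner_one_one, hm]
    field_simp; ring
  have hE : energy G g = energy G f := energy_sub_const G f m
  have hD := energy_nonneg G f
  have hP := hgap.2.2.2 g hg0
  rw [hE] at hP
  have hsup : ∀ x, g x ^ 2 ≤ 16 * energy G f / (G.minDegree * s) := by
    intro x
    have h1 := sobolev G hG hV hg0 x
    rw [hE] at h1
    rw [le_div_iff₀ (by positivity)]
    refine abs_le_of_sq_le_sq' ?_ (by positivity) |>.2
    calc (g x ^ 2 * (G.minDegree * s)) ^ 2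
        = (1 - lambda2 G) * ((G.minDegree : ℝ) ^ 2 * g x ^ 4) := by rw [← hss]; ring
      _ ≤ (1 - lambda2 G) * (1024 * (energy G f * degInner G g g)) :=
          mul_le_mul_of_nonneg_left h1 (by linarith [hgap.2.1])
      _ = 1024 * energy G f * ((1 - lambda2 G) * degInner G g g) := by ring
      _ ≤ 1024 * energy G f * (energy G f / 4) := mul_le_mul_of_nonneg_left hP (by positivity)
      _ = _ := by ring
  have hf : ∀ x, f x ^ 2 ≤ 64 * energy G f / (G.minDegree * s) := by
    intro x
    have h1 : f x = g x - g v := by simp [hg, hv]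
    have h2 : 64 * energy G f / (G.minDegree * s) =
        4 * (16 * energy G f / (G.minDegree * s)) := by ring
    rw [h1, h2]
    nlinarith [hsup x, hsup v, sq_nonneg (g x + g v)]
  refine (degInner_le_of_sq_le G hf).trans ?_
  calc totalVol G * (64 * energy G f / (G.minDegree * s))
      ≤ (Fintype.card V * G.maxDegree) * (64 * energy G f / (G.minDegree * s)) :=
        mul_le_mul_of_nonneg_right (totalVol_le G) (by positivity)
    _ = _ := by rw [hitScale, degreeRatio, ← hsdef]; field_simp

/-- The contraction factor of the lazy walk killed at a vertex. -/
def killRate : ℝ := 1 - 1 / (256 * hitScale G)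

theorem killRate_mem (hG : G.Connected) (hV : 2 ≤ Fintype.card V) :
    0 ≤ killRate G ∧ killRate G ≤ Real.exp (-(1 / (256 * hitScale G))) := by
  have h := two_le_hitScale G hG hV
  constructor
  · rw [killRate, sub_nonneg, div_le_one (by linarith)]
    linarith
  · rw [killRate]
    have := Real.add_one_le_exp (-(1 / (256 * hitScale G)))
    linarith

theorem degInner_walkOp_le_killRate (hG : G.Connected) (hV : 2 ≤ Fintype.card V) {f : V → ℝ}
    {v : V} (hv : f v = 0) : degInner G f (walkOp G f) ≤ killRate G * degInner G f f := by
  have h := two_le_hitScale G hG hV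
  have h1 := degInner_le_energy_of_eq_zero G hG hV hv
  have h2 := degInner_self_sub_walkOp G (degree_pos_of_connected G hG hV) f
  have h3 : degInner G f f / (256 * hitScale G) ≤ energy G f / 4 := by
    rw [div_le_iff₀ (by linarith)]
    linarith
  rw [killRate, sub_mul, one_div_mul_eq_div]
  linarith

/-- The norm of the avoidance probability decays exponentially, uniformly over all trajectories of
the target. Each step is bounded through the Cauchy–Schwarz inequality for the positive
semidefinite form `⟨f, P g⟩` by the form on functions vanishing at a single vertex. -/
theorem degInner_avoid_le (hG : G.Connected) (hV : 2 ≤ Fintype.card V) (s : ℕ) (h : ℕ → V) :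
    degInner G (fun x => avoid G (s + 1) x h) (fun x => avoid G (s + 1) x h) ≤
      killRate G ^ (2 * s) * totalVol G := by
  have hd := degree_pos_of_connected G hG hV
  have hθ := (killRate_mem G hG hV).1
  induction s generalizing h with
  | zero =>
    have := degInner_le_of_sq_le G (f := fun x => avoid G (0 + 1) x h) (M := 1) fun x =>
      pow_le_one₀ (avoid_nonneg G _ x h) (avoid_le_one G hd _ x h)
    simpa using this
  | succ s ih =>
    have ih' := ih fun i => h (i + 1)
    set a : V → ℝ := fun x => avoid G (s + 1 + 1) x h with ha
    set b : V → ℝ := fun x => avoid G (s + 1) x fun i => h (i + 1) with hb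
    have ha0 : a (h 0) = 0 := by simp [ha, avoid]
    have hb0 : b (h (0 + 1)) = 0 := by simp [hb, avoid]
    -- `a` is the function `P b` restricted to the complement of `h 0`.
    have hab : degInner G a a = degInner G a (walkOp G b) := by
      refine Finset.sum_congr rfl fun x _ => ?_
      by_cases hx : x = h 0
      · rw [hx, ha0]; simp
      · congr 1
        simp only [ha]
        rw [avoid, if_neg hx]
    have h1 := degInner_walkOp_sq_le G hd a b
    rw [← hab] at h1
    have h2 := degInner_walkOp_le_killRate G hG hV ha0
    have h3 := degInner_walkOp_le_killRate G hG hV hb0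
    have h4 := degInner_self_nonneg G a
    have h5 := degInner_self_nonneg G b
    have h6 := degInner_walkOp_self_nonneg G hd b
    have h7 : degInner G a a ≤ killRate G ^ 2 * degInner G b b := by
      rcases h4.eq_or_lt with h | h
      · rw [← h]; positivity
      · refine le_of_mul_le_mul_left ?_ h
        calc degInner G a a * degInner G a a = degInner G a a ^ 2 := (pow_two _).symm
          _ ≤ _ := h1
          _ ≤ (killRate G * degInner G a a) * (killRate G * degInner G b b) :=
            mul_le_mul h2 h3 h6 (by positivity)
          _ = _ := by ring
    refine h7.trans ((mul_le_mul_of_nonneg_left ih' (sq_nonneg _)).trans_eq ?_)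
    ring

/-- The collisions during the first `t` steps may be ignored. -/
theorem avoid_add_le (t s : ℕ) (x : V) (h : ℕ → V) :
    avoid G (t + s) x h ≤ (walkOp G)^[t] (fun y => avoid G s y fun i => h (t + i)) x := by
  induction t generalizing x h with
  | zero => simp
  | succ t ih =>
    have hnn : ∀ z, 0 ≤ (walkOp G)^[t] (fun y => avoid G s y fun i => h (t + 1 + i)) z := by
      intro z
      rw [iterate_walkOp_apply]
      exact Finset.sum_nonneg fun y _ =>
        mul_nonneg (transitionMatrix_pow_nonneg G t z y) (avoid_nonneg G _ _ _)
    rw [show t + 1 + s = t + s + 1 by ring, avoid, Function.iterate_succ_apply']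
    split_ifs
    · exact Finset.sum_nonneg fun y _ => mul_nonneg (transitionMatrix_nonneg G x y) (hnn y)
    · refine walkOp_mono G (fun y => (ih y _).trans_eq ?_) x
      simp only [add_right_comm t 1]

theorem heat_comm [Nonempty V] (hd : ∀ x, 0 < G.degree x) (x y : V) (t : ℕ) :
    heat G x t y = heat G y t x := by
  have h1 := degInner_heat_heat G hd x y t 0
  have h2 := degInner_heat_heat G hd y x 0 t
  rw [add_zero] at h1
  rw [zero_add] at h2
  rw [← h1, ← h2, degInner_comm]

/-- Mixing in the mean square: after `hitScale G` steps the density of the walk is bounded in norm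
by a constant multiple of the stationary one. -/
theorem iterate_walkOp_sq_le (hG : G.Connected) (hV : 2 ≤ Fintype.card V) {t : ℕ}
    (ht : hitScale G ≤ t) (f : V → ℝ) (x : V) :
    (walkOp G)^[t] f x ^ 2 ≤ 257 / totalVol G * degInner G f f := by
  have hd := degree_pos_of_connected G hG hV
  have hne := hG.nonempty
  have hvol := totalVol_pos G hd
  have hδ : (0 : ℝ) < G.minDegree := by exact_mod_cast minDegree_pos_of_connected G hG hV
  have hs := (sqrt_gap_mem G hG hV).1
  have hgap := spectral_gap G hG hV
  set u : V → ℝ := heat G x t + (totalVol G)⁻¹ • 1 with hu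
  have h1 : (walkOp G)^[t] f x = degInner G u f := by
    rw [iterate_walkOp_apply]
    refine Finset.sum_congr rfl fun y _ => ?_
    rw [transitionMatrix_pow_eq_heat G hd, heat_comm G hd]
    simp [hu]
  have h2 : degInner G u u = heatNorm G x t + (totalVol G)⁻¹ := by
    have h3 := degInner_one_heat G hd x t
    have h4 : degInner G (heat G x t) 1 = 0 := by rw [degInner_comm]; exact h3
    simp only [hu, degInner_add_left, degInner_add_right, degInner_smul_left, degInner_smul_right,
      h3, h4, degInner_one_one, heatNorm]
    field_simp
    ring
  -- The norm is decreasing in time, so that it is at most its average over the first `t` steps.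
  have h5 : t * heatNorm G x t ≤ 256 * (G.minDegree : ℝ)⁻¹ / Real.sqrt (1 - lambda2 G) := by
    refine le_trans ?_ (sum_heatMajorant_le (inv_pos.2 hδ)
      (by linarith [hgap.2.1] : 0 < 1 - lambda2 G) (by linarith [hgap.1]) t)
    have h6 := Finset.card_nsmul_le_sum (Finset.range t)
      (heatMajorant (G.minDegree : ℝ)⁻¹ (1 - lambda2 G)) (heatNorm G x t) fun i hi =>
        (heatNorm_antitone G hd x (Finset.mem_range.1 hi).le).trans
          (heatNorm_le_majorant G hG hV x i)
    simpa using h6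
  have hH := two_le_hitScale G hG hV
  have ht0 : (0 : ℝ) < t := by linarith
  have h6 : totalVol G * heatNorm G x t ≤ 256 := by
    have h0 := heatNorm_nonneg G x t
    refine le_of_mul_le_mul_left ?_ ht0
    calc t * (totalVol G * heatNorm G x t) = totalVol G * (t * heatNorm G x t) := by ring
      _ ≤ totalVol G * (256 * (G.minDegree : ℝ)⁻¹ / Real.sqrt (1 - lambda2 G)) :=
        mul_le_mul_of_nonneg_left h5 hvol.le
      _ ≤ (Fintype.card V * G.maxDegree) *
          (256 * (G.minDegree : ℝ)⁻¹ / Real.sqrt (1 - lambda2 G)) :=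
        mul_le_mul_of_nonneg_right (totalVol_le G) (by positivity)
      _ = hitScale G * 256 := by rw [hitScale, degreeRatio]; field_simp
      _ ≤ t * 256 := by gcongr
  rw [h1]
  refine (degInner_sq_le G u f).trans (mul_le_mul_of_nonneg_right ?_ (degInner_self_nonneg G f))
  rw [h2, le_div_iff₀ hvol, add_mul, inv_mul_cancel₀ hvol.ne']
  linarith

/-- A number of steps, of the order of `hitScale G`, during which the lazy walk meets any given
trajectory with probability at least one half. -/
def halfTime : ℕ := ⌈hitScale G⌉₊ + (⌈1024 * hitScale G⌉₊ + 1)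

theorem halfTime_le (hG : G.Connected) (hV : 2 ≤ Fintype.card V) :
    (halfTime G : ℝ) ≤ 1027 * hitScale G := by
  have h := two_le_hitScale G hG hV
  have h1 := Nat.ceil_lt_add_one (by linarith : 0 ≤ hitScale G)
  have h2 := Nat.ceil_lt_add_one (by linarith : 0 ≤ 1024 * hitScale G)
  rw [halfTime]
  push_cast
  linarith

theorem halfTime_pos : 0 < halfTime G := by rw [halfTime]; omega

/-- The first `hitScale G` steps turn the pointwise value into a norm, and this norm decays during
the remaining steps. -/
theorem avoid_halfTime_le (hG : G.Connected) (hV : 2 ≤ Fintype.card V) (x : V) (h : ℕ → V) :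
    avoid G (halfTime G) x h ≤ 1 / 2 := by
  have hH := two_le_hitScale G hG hV
  have hd := degree_pos_of_connected G hG hV
  have hne := hG.nonempty
  have hvol := totalVol_pos G hd
  obtain ⟨hθ0, hθ⟩ := killRate_mem G hG hV
  refine (avoid_add_le G _ _ x h).trans ?_
  have h1 := iterate_walkOp_sq_le G hG hV (Nat.le_ceil (hitScale G))
    (fun y => avoid G (⌈1024 * hitScale G⌉₊ + 1) y fun i => h (⌈hitScale G⌉₊ + i)) x
  have h2 := degInner_avoid_le G hG hV ⌈1024 * hitScale G⌉₊ fun i => h (⌈hitScale G⌉₊ + i)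
  have h3 : killRate G ^ (2 * ⌈1024 * hitScale G⌉₊) ≤ Real.exp (-8) := by
    refine (pow_le_pow_left₀ hθ0 hθ _).trans ?_
    rw [← Real.exp_nat_mul, Real.exp_le_exp]
    push_cast
    have h4 := Nat.le_ceil (1024 * hitScale G)
    have h5 : (8 : ℝ) ≤ 2 * ⌈1024 * hitScale G⌉₊ * (1 / (256 * hitScale G)) := by
      rw [mul_one_div, le_div_iff₀ (by linarith)]
      linarith
    linarith
  -- `257 / 1028 = (1 / 2) ^ 2`, with the constant `257` of `iterate_walkOp_sq_le`.
  have h6 : Real.exp (-8) ≤ 1 / 1028 := by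
    rw [Real.exp_neg, ← one_div]
    refine one_div_le_one_div_of_le (by norm_num) ?_
    have h7 : Real.exp 8 = Real.exp 1 ^ 8 := by rw [← Real.exp_nat_mul]; norm_num
    rw [h7]
    calc (1028 : ℝ) ≤ 2.7 ^ 8 := by norm_num
      _ ≤ _ := pow_le_pow_left₀ (by norm_num) (by linarith [Real.exp_one_gt_d9]) 8
  refine abs_le_of_sq_le_sq' (h1.trans ?_) (by norm_num) |>.2
  calc _ ≤ 257 / totalVol G * (1 / 1028 * totalVol G) := by
        refine mul_le_mul_of_nonneg_left (h2.trans ?_) (by positivity)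
        exact mul_le_mul_of_nonneg_right (h3.trans h6) hvol.le
    _ = _ := by field_simp; norm_num

theorem avoid_add_le_mul {c : ℝ} (t s : ℕ) (hc : ∀ y h, avoid G s y h ≤ c) (x : V) (h : ℕ → V) :
    avoid G (t + s) x h ≤ avoid G t x h * c := by
  induction t generalizing x h with
  | zero => simpa [avoid] using hc x h
  | succ t ih =>
    rw [show t + 1 + s = t + s + 1 by ring, avoid, avoid]
    split_ifs
    · simp
    · refine (walkOp_mono G (fun y => ih y _) x).trans_eq ?_
      simp only [walkOp, Finset.sum_mul, mul_assoc]

theorem avoid_mul_halfTime_le (hG : G.Connected) (hV : 2 ≤ Fintype.card V) (j : ℕ) (x : V)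
    (h : ℕ → V) : avoid G (j * halfTime G) x h ≤ (1 / 2) ^ j := by
  induction j generalizing x h with
  | zero => simp [avoid]
  | succ j ih =>
    rw [add_mul, one_mul, pow_succ]
    refine (avoid_add_le_mul G _ _ (fun y h => avoid_halfTime_le G hG hV y h) x h).trans ?_
    exact mul_le_mul_of_nonneg_right (ih x h) (by norm_num)

theorem avoid_antitone (hd : ∀ x, 0 < G.degree x) (x : V) (h : ℕ → V) :
    Antitone fun t => avoid G t x h := by
  intro t s hts
  obtain ⟨k, rfl⟩ := Nat.exists_eq_add_of_le hts
  exact (avoid_add_le_mul G t k (fun y h => avoid_le_one G hd k y h) x h).trans_eq (mul_one _)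

theorem avoid_le_half_pow (hG : G.Connected) (hV : 2 ≤ Fintype.card V) (t : ℕ) (x : V)
    (h : ℕ → V) : avoid G t x h ≤ (1 / 2) ^ (t / halfTime G) :=
  (avoid_antitone G (degree_pos_of_connected G hG hV) x h (Nat.div_mul_le_self t _)).trans
    (avoid_mul_halfTime_le G hG hV _ x h)

end Avoid

/-! ### Product measures and expectations over trajectories -/

section Product

variable {V : Type*} [Fintype V] [DecidableEq V]

/-- The marginal, on the coordinates selected by an injection `r`, of a product of probability
vectors `m k` is the product of the vectors `m (r w)`. -/
theorem sum_prod_marginal {κ W : Type*} [Fintype κ] [DecidableEq κ] [Fintype W] [DecidableEq W]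
    (m : κ → V → ℝ) (hm : ∀ k, ∑ z, m k z = 1) (r : W → κ) (hr : Function.Injective r)
    (ψ : (W → V) → ℝ) :
    ∑ y : κ → V, (∏ k, m k (y k)) * ψ (fun w => y (r w)) =
      ∑ Y : W → V, (∏ w, m (r w) (Y w)) * ψ Y := by
  have key : ∀ Y : W → V, ∏ w, m (r w) (Y w) =
      ∑ y : κ → V, if (fun w => y (r w)) = Y then ∏ k, m k (y k) else 0 := by
    intro Y
    set T : κ → Finset V := fun k => Finset.univ.filter fun z => ∀ w, r w = k → z = Y w with hT
    have h1 : ∏ w, m (r w) (Y w) = ∏ k, ∑ z ∈ T k, m k z := by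
      refine Fintype.prod_of_injective r hr _ _ (fun k hk => ?_) fun w => ?_
      · have : T k = Finset.univ := by
          ext z
          simp only [hT, Finset.mem_filter, Finset.mem_univ, true_and, iff_true]
          exact fun w hw => (hk ⟨w, hw⟩).elim
        rw [this, hm]
      · have : T (r w) = {Y w} := by
          ext z
          simp only [hT, Finset.mem_filter, Finset.mem_univ, true_and, Finset.mem_singleton]
          exact ⟨fun h => h w rfl, fun h w' hw' => by rw [h, hr hw']⟩
        rw [this, Finset.sum_singleton]
    rw [h1, Finset.prod_univ_sum, ← Finset.sum_filter]
    refine Finset.sum_congr ?_ fun _ _ => rfl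
    ext y
    simp only [hT, Fintype.mem_piFinset, Finset.mem_filter, Finset.mem_univ, true_and]
    exact ⟨fun h => funext fun w => h _ w rfl, fun h k w hw => by rw [← hw, ← h]⟩
  simp_rw [key, Finset.sum_mul]
  rw [Finset.sum_comm]
  refine Finset.sum_congr rfl fun y _ => ?_
  simp

theorem sum_prod_eq_one {κ : Type*} [Fintype κ] [DecidableEq κ]
    (m : κ → V → ℝ) (hm : ∀ k, ∑ z, m k z = 1) : ∑ y : κ → V, ∏ k, m k (y k) = 1 := by
  have h := Finset.prod_univ_sum (fun _ : κ => (Finset.univ : Finset V)) m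
  rw [Fintype.piFinset_univ] at h
  rw [← h]
  exact Finset.prod_eq_one fun k _ => hm k

end Product

section Path

variable {V : Type*} [Fintype V] [DecidableEq V] (G : SimpleGraph V) [DecidableRel G.Adj]

/-- The trajectory which is at `b` at time `0` and follows `h` afterwards. -/
def consPath (b : V) (h : ℕ → V) : ℕ → V
  | 0 => b
  | i + 1 => h i

/-- The expectation of a functional of the trajectory of the lazy walk started at `b`, stopped
after `s` steps. -/
def pathE : ℕ → V → ((ℕ → V) → ℝ) → ℝ
  | 0, b, φ => φ fun _ => b
  | s + 1, b, φ => walkOp G (fun y => pathE s y fun h => φ (consPath b h)) b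

theorem pathE_mono (s : ℕ) (b : V) {φ ψ : (ℕ → V) → ℝ} (h : ∀ p, φ p ≤ ψ p) :
    pathE G s b φ ≤ pathE G s b ψ := by
  induction s generalizing b φ ψ with
  | zero => exact h _
  | succ s ih => exact walkOp_mono G (fun y => ih y fun p => h _) b

theorem pathE_const (hd : ∀ x, 0 < G.degree x) (s : ℕ) (b : V) (c : ℝ) :
    pathE G s b (fun _ => c) = c := by
  induction s generalizing b with
  | zero => rfl
  | succ s ih => simp only [pathE, ih]; exact walkOp_const G hd c b

theorem pathE_nonneg (hd : ∀ x, 0 < G.degree x) (s : ℕ) (b : V) {φ : (ℕ → V) → ℝ}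
    (h : ∀ p, 0 ≤ φ p) : 0 ≤ pathE G s b φ := by
  rw [← pathE_const G hd s b 0]
  exact pathE_mono G s b h

theorem pathE_sum {ι : Type*} (I : Finset ι) (s : ℕ) (b : V) (φ : ι → (ℕ → V) → ℝ) :
    pathE G s b (fun h => ∑ i ∈ I, φ i h) = ∑ i ∈ I, pathE G s b (φ i) := by
  induction s generalizing b φ with
  | zero => rfl
  | succ s ih =>
    simp only [pathE, ih, walkOp, Finset.mul_sum]
    exact Finset.sum_comm

theorem pathE_const_mul (s : ℕ) (b : V) (c : ℝ) (φ : (ℕ → V) → ℝ) :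
    pathE G s b (fun h => c * φ h) = c * pathE G s b φ := by
  induction s generalizing b φ with
  | zero => rfl
  | succ s ih =>
    simp only [pathE, ih, walkOp, Finset.mul_sum]
    exact Finset.sum_congr rfl fun _ _ => by ring

theorem pathE_sub (s : ℕ) (b : V) (φ ψ : (ℕ → V) → ℝ) :
    pathE G s b (fun h => φ h - ψ h) = pathE G s b φ - pathE G s b ψ := by
  induction s generalizing b φ ψ with
  | zero => rfl
  | succ s ih => simp only [pathE, ih, walkOp, mul_sub, Finset.sum_sub_distrib]

theorem pathE_eval (hd : ∀ x, 0 < G.degree x) {t s : ℕ} (hts : t ≤ s) (b : V) (g : V → ℝ) :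
    pathE G s b (fun h => g (h t)) = (walkOp G)^[t] g b := by
  induction s generalizing t b with
  | zero => rw [Nat.le_zero.1 hts]; rfl
  | succ s ih =>
    cases t with
    | zero => simp only [pathE, consPath, pathE_const G hd]; exact walkOp_const G hd _ b
    | succ t =>
      simp only [pathE, consPath, ih (Nat.succ_le_succ_iff.1 hts)]
      rw [Function.iterate_succ_apply']

end Path

/-! ### The number of coalescing walks -/

section Coalescence

variable {V : Type*} [Fintype V] [DecidableEq V] (G : SimpleGraph V) [DecidableRel G.Adj]

/-- The expected value of `φ` after one step of the coalescence process. -/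
def coalOp (φ : Finset V → ℝ) (A : Finset V) : ℝ :=
  ∑ Y : V → V, (∏ v, transitionMatrix G v (Y v)) * φ (A.image Y)

/-- The number of walks, as a real number. -/
def cardR (A : Finset V) : ℝ := A.card

theorem coalOp_le_coalOp {φ ψ : Finset V → ℝ} {A B : Finset V}
    (h : ∀ Y : V → V, φ (A.image Y) ≤ ψ (B.image Y)) : coalOp G φ A ≤ coalOp G ψ B :=
  Finset.sum_le_sum fun Y _ => mul_le_mul_of_nonneg_left (h Y)
    (Finset.prod_nonneg fun v _ => transitionMatrix_nonneg G v _)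

theorem coalOp_const (hd : ∀ x, 0 < G.degree x) (c : ℝ) (A : Finset V) :
    coalOp G (fun _ => c) A = c := by
  rw [coalOp, ← Finset.sum_mul, sum_prod_eq_one _ fun v => transitionMatrix_row_sum G v (hd v),
    one_mul]

theorem monotone_iterate_coalOp_card (s : ℕ) : Monotone ((coalOp G)^[s] cardR) := by
  induction s with
  | zero =>
    intro A B h
    change (A.card : ℝ) ≤ B.card
    exact_mod_cast Finset.card_le_card h
  | succ s ih =>
    rw [Function.iterate_succ_apply']
    exact fun A B h => coalOp_le_coalOp G fun Y => ih (Finset.image_subset_image h)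

/-- Adding walks which never merge: let walks `a i` be immortal and independent, and let the walks
from `B` be killed when they meet one of them. If these walks initially cover `A`, then they
dominate the coalescence process from `A`: they can be coupled so that all positions of the
latter are covered. A walk from `b` survives for `s` steps when each of the immortal walks avoids
its trajectory. -/
theorem iterate_coalOp_card_le (hd : ∀ x, 0 < G.degree x) {ι : Type*} [Fintype ι] [DecidableEq ι]
    (s : ℕ) (a : ι → V) (A B : Finset V) (hA : A ⊆ Finset.univ.image a ∪ B) :
    (coalOp G)^[s] cardR A ≤
      Fintype.card ι + ∑ b ∈ B, pathE G s b fun h => ∏ i, avoid G s (a i) h := by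
  induction s generalizing a A B with
  | zero =>
    have h1 := (Finset.card_le_card hA).trans (Finset.card_union_le _ _)
    have h2 : (Finset.univ.image a).card ≤ Fintype.card ι := Finset.card_image_le
    simp only [Function.iterate_zero_apply, cardR, pathE, avoid, Finset.prod_const_one,
      Finset.sum_const, nsmul_eq_mul, mul_one]
    exact_mod_cast h1.trans (Nat.add_le_add_right h2 _)
  | succ s ih =>
    set C := Finset.univ.image a with hC
    set B' := B \ C with hB'
    set φ := (coalOp G)^[s] cardR with hφ
    have hφm : Monotone φ := monotone_iterate_coalOp_card G s
    have hA' : A ⊆ C ∪ B' := by rw [hB', Finset.union_sdiff_self_eq_union]; exact hA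
    -- Each vertex of `C` follows the step of one immortal walk located at it.
    have hr : ∀ v, ∃ k : ι ⊕ V, Sum.elim a id k = v ∧ (v ∈ C → ∃ i, k = Sum.inl i) ∧
        (v ∉ C → k = Sum.inr v) := by
      intro v
      by_cases hv : v ∈ C
      · obtain ⟨i, _, hi⟩ := Finset.mem_image.1 hv
        exact ⟨Sum.inl i, hi, fun _ => ⟨i, rfl⟩, fun h => (h hv).elim⟩
      · exact ⟨Sum.inr v, rfl, fun h => (hv h).elim, fun _ => rfl⟩
    choose r hr1 hr2 hr3 using hr
    have hrinj : Function.Injective r := fun v w h => by rw [← hr1 v, h, hr1 w]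
    -- All immortal walks and one walk at each vertex move independently. The selection `r` of one
    -- walk per vertex makes a step of the coalescence process a marginal of this product.
    set m : ι ⊕ V → V → ℝ := fun k z => transitionMatrix G (Sum.elim a id k) z with hm
    have hm1 : ∀ k, ∑ z, m k z = 1 := fun k => transitionMatrix_row_sum G _ (hd _)
    have hmnn : ∀ y : ι ⊕ V → V, 0 ≤ ∏ k, m k (y k) :=
      fun y => Finset.prod_nonneg fun k _ => transitionMatrix_nonneg G _ _
    have h1 : (coalOp G)^[s + 1] cardR A ≤ coalOp G φ (C ∪ B') := by
      rw [Function.iterate_succ_apply']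
      exact coalOp_le_coalOp G fun Y => hφm (Finset.image_subset_image hA')
    have h2 : coalOp G φ (C ∪ B') =
        ∑ y : ι ⊕ V → V, (∏ k, m k (y k)) * φ ((C ∪ B').image fun v => y (r v)) := by
      rw [sum_prod_marginal m hm1 r hrinj fun Y => φ ((C ∪ B').image Y)]
      simp only [hm, hr1]
      rfl
    have h3 : ∀ y : ι ⊕ V → V, φ ((C ∪ B').image fun v => y (r v)) ≤ Fintype.card ι +
        ∑ b ∈ B', pathE G s (y (Sum.inr b)) fun h => ∏ i, avoid G s (y (Sum.inl i)) h := by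
      intro y
      have hsub : (C ∪ B').image (fun v => y (r v)) ⊆
          Finset.univ.image (fun i => y (Sum.inl i)) ∪ B'.image fun b => y (Sum.inr b) := by
        intro z hz
        obtain ⟨v, hv, rfl⟩ := Finset.mem_image.1 hz
        by_cases hvC : v ∈ C
        · obtain ⟨i, hi⟩ := hr2 v hvC
          exact Finset.mem_union_left _ (Finset.mem_image.2 ⟨i, Finset.mem_univ _, by rw [hi]⟩)
        · refine Finset.mem_union_right _ (Finset.mem_image.2 ⟨v, ?_, by rw [hr3 v hvC]⟩)
          exact (Finset.mem_union.1 hv).resolve_left hvC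
      refine (ih (fun i => y (Sum.inl i)) _ _ hsub).trans (add_le_add le_rfl ?_)
      exact Finset.sum_image_le_of_nonneg fun z _ => pathE_nonneg G hd s z fun p =>
        Finset.prod_nonneg fun i _ => avoid_nonneg G s _ p
    -- Only the steps of the walk from `b` (`none`) and of the immortal walks (`some i`) matter.
    have h4 : ∀ b ∈ B', ∑ y : ι ⊕ V → V, (∏ k, m k (y k)) *
        pathE G s (y (Sum.inr b)) (fun h => ∏ i, avoid G s (y (Sum.inl i)) h) =
        pathE G (s + 1) b fun h => ∏ i, avoid G (s + 1) (a i) h := by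
      intro b hb
      have hbC : ∀ i, a i ≠ b := fun i hi => (Finset.mem_sdiff.1 hb).2
        (hi ▸ Finset.mem_image_of_mem a (Finset.mem_univ i))
      set r' : Option ι → ι ⊕ V := fun o => o.elim (Sum.inr b) Sum.inl with hr'
      have hr'inj : Function.Injective r' := by
        rintro (_ | i) (_ | j) h <;> simp [hr'] at h ⊢
        exact h
      have h5 := sum_prod_marginal m hm1 r' hr'inj
        fun Y => pathE G s (Y none) fun h => ∏ i, avoid G s (Y (some i)) h
      rw [show (fun y : ι ⊕ V → V => (∏ k, m k (y k)) *
        pathE G s (y (Sum.inr b)) (fun h => ∏ i, avoid G s (y (Sum.inl i)) h)) = fun y =>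
        (∏ k, m k (y k)) * (fun Y : Option ι → V => pathE G s (Y none)
          fun h => ∏ i, avoid G s (Y (some i)) h) (fun w => y (r' w)) from rfl, h5,
        ← Equiv.piOptionEquivProd.symm.sum_comp, Fintype.sum_prod_type]
      refine Finset.sum_congr rfl fun z _ => ?_
      simp only [Fintype.prod_option, Equiv.piOptionEquivProd, Equiv.coe_fn_symm_mk, hr', hm,
        Option.elim_none, Option.elim_some, Sum.elim_inl, Sum.elim_inr, id, mul_assoc]
      rw [← Finset.mul_sum]
      congr 1
      simp_rw [← pathE_const_mul]
      rw [← pathE_sum]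
      congr 1
      funext h
      have h6 := Finset.prod_univ_sum (fun _ : ι => (Finset.univ : Finset V))
        fun i z => transitionMatrix G (a i) z * avoid G s z h
      rw [Fintype.piFinset_univ] at h6
      simp_rw [← Finset.prod_mul_distrib]
      rw [← h6]
      refine Finset.prod_congr rfl fun i _ => ?_
      have hi : a i ≠ consPath b h 0 := hbC i
      rw [avoid, if_neg hi]
      rfl
    rw [h2] at h1
    refine h1.trans ((Finset.sum_le_sum fun y _ =>
      mul_le_mul_of_nonneg_left (h3 y) (hmnn y)).trans ?_)
    simp_rw [mul_add, Finset.sum_add_distrib, ← Finset.sum_mul, sum_prod_eq_one m hm1, one_mul,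
      Finset.mul_sum]
    rw [Finset.sum_comm, Finset.sum_congr rfl h4]
    refine add_le_add le_rfl (Finset.sum_le_sum_of_subset_of_nonneg Finset.sdiff_subset
      fun b _ _ => pathE_nonneg G hd _ b fun p =>
        Finset.prod_nonneg fun i _ => avoid_nonneg G _ _ p)

end Coalescence

/-! ### The decay of the number of walks -/

section Decay

variable {V : Type*} [Fintype V] [DecidableEq V] (G : SimpleGraph V) [DecidableRel G.Adj]

/-- With a single immortal walk: during `halfTime G` steps, each of the other walks meets it with
probability at least one half. -/
theorem iterate_coalOp_card_le_half (hG : G.Connected) (hV : 2 ≤ Fintype.card V) {A : Finset V}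
    (hA : A.Nonempty) :
    (coalOp G)^[halfTime G] cardR A ≤ (cardR A + 1) / 2 := by
  obtain ⟨a, ha⟩ := hA
  have hd := degree_pos_of_connected G hG hV
  have hsub : A ⊆ Finset.univ.image (fun _ : Unit => a) ∪ A.erase a := by
    intro x hx
    by_cases hxa : x = a
    · simp [hxa]
    · simp [hxa, hx]
  refine (iterate_coalOp_card_le G hd (halfTime G) (fun _ : Unit => a) A _ hsub).trans ?_
  have h1 : ∀ b ∈ A.erase a, pathE G (halfTime G) b
      (fun h => ∏ _i : Unit, avoid G (halfTime G) a h) ≤ 1 / 2 := fun b _ => by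
    refine (pathE_mono G _ b fun h => ?_).trans_eq (pathE_const G hd (halfTime G) b (1 / 2))
    simpa using avoid_halfTime_le G hG hV a h
  have h2 := Finset.sum_le_card_nsmul _ _ _ h1
  have h3 : ((A.erase a).card : ℝ) = A.card - 1 := by
    rw [Finset.card_erase_of_mem ha, Nat.cast_sub (Finset.card_pos.2 ⟨a, ha⟩), Nat.cast_one]
  rw [nsmul_eq_mul, h3] at h2
  simp only [Fintype.card_unit, Nat.cast_one, cardR]
  linarith

/-- The domination by immortal walks, averaged over all ways of choosing the immortal walks among
the walks of `A`. -/
theorem two_pow_mul_iterate_coalOp_card_le (hd : ∀ x, 0 < G.degree x) (s : ℕ) (A : Finset V) :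
    2 ^ A.card * (coalOp G)^[s] cardR A ≤ 2 ^ A.card * (A.card : ℝ) -
      ∑ b ∈ A, (2 ^ (A.card - 1) -
        pathE G s b fun h => ∏ i ∈ A.erase b, (1 + avoid G s i h)) := by
  have h1 : ∀ I ∈ A.powerset, (coalOp G)^[s] cardR A ≤ (A.card : ℝ) -
      ∑ b ∈ A \ I, (1 - pathE G s b fun h => ∏ i ∈ I, avoid G s i h) := by
    intro I hI
    have hIA := Finset.mem_powerset.1 hI
    have hsub : A ⊆ Finset.univ.image (fun x : {x // x ∈ I} => (x : V)) ∪ A \ I := by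
      intro x hx
      by_cases hxI : x ∈ I
      · exact Finset.mem_union_left _ (Finset.mem_image.2 ⟨⟨x, hxI⟩, Finset.mem_univ _, rfl⟩)
      · exact Finset.mem_union_right _ (Finset.mem_sdiff.2 ⟨hx, hxI⟩)
    refine (iterate_coalOp_card_le G hd s _ A _ hsub).trans_eq ?_
    have hcard : (I.card : ℝ) + (A \ I).card = A.card := by
      rw [← Nat.cast_add, add_comm, Finset.card_sdiff_add_card_eq_card hIA]
    rw [Finset.sum_sub_distrib, Finset.sum_const, nsmul_eq_mul, mul_one, Fintype.card_coe]
    have hprod : ∀ h, ∏ i : {x // x ∈ I}, avoid G s i h = ∏ i ∈ I, avoid G s i h :=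
      fun h => Finset.prod_coe_sort I fun i => avoid G s i h
    simp_rw [hprod]
    linarith
  have h2 := Finset.sum_le_sum h1
  rw [Finset.sum_const, Finset.card_powerset, nsmul_eq_mul, Finset.sum_sub_distrib,
    Finset.sum_const, Finset.card_powerset, nsmul_eq_mul] at h2
  push_cast at h2
  refine h2.trans_eq ?_
  congr 1
  rw [Finset.sum_comm' (t' := A) (s' := fun b => (A.erase b).powerset)]
  · refine Finset.sum_congr rfl fun b hb => ?_
    rw [Finset.sum_sub_distrib, Finset.sum_const, Finset.card_powerset, nsmul_eq_mul, mul_one,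
      Finset.card_erase_of_mem hb]
    simp_rw [Finset.prod_one_add, pathE_sum]
    push_cast
    rfl
  · intro I b
    simp only [Finset.mem_powerset, Finset.mem_sdiff, Finset.subset_erase]
    tauto

/-- The expected number of collisions with a trajectory is at most the probability of a collision
times the largest expected number of collisions after the first one. -/
theorem sum_pow_le_mul_one_sub_avoid (hG : G.Connected) (hV : 2 ≤ Fintype.card V) {K : ℝ} (s : ℕ)
    (hK : ∑ t ∈ Finset.range s, kernelBound G t ≤ K) (x : V) (h : ℕ → V) :
    ∑ t ∈ Finset.range s, (transitionMatrix G ^ t) x (h t) ≤ K * (1 - avoid G s x h) := by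
  have hd := degree_pos_of_connected G hG hV
  induction s generalizing x h with
  | zero => simp [avoid]
  | succ s ih =>
    by_cases hx : x = h 0
    · rw [avoid, if_pos hx, sub_zero, mul_one]
      exact (Finset.sum_le_sum fun t _ => transitionMatrix_pow_le G hG hV t x (h t)).trans hK
    · rw [avoid, if_neg hx, Finset.sum_range_succ']
      have hK' : ∑ t ∈ Finset.range s, kernelBound G t ≤ K := by
        rw [Finset.sum_range_succ] at hK
        linarith [kernelBound_nonneg G hG hV s]
      have h1 : ∑ t ∈ Finset.range s, (transitionMatrix G ^ (t + 1)) x (h (t + 1)) =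
          walkOp G (fun y => ∑ t ∈ Finset.range s, (transitionMatrix G ^ t) y (h (t + 1))) x := by
        simp only [walkOp, pow_succ' (transitionMatrix G), Matrix.mul_apply, Finset.mul_sum]
        exact Finset.sum_comm
      rw [h1, pow_zero, Matrix.one_apply_ne hx, add_zero]
      refine (walkOp_mono G (fun y => ih hK' y fun i => h (i + 1)) x).trans_eq ?_
      simp only [walkOp, mul_sub, mul_one, Finset.sum_sub_distrib, ← Finset.sum_mul,
        transitionMatrix_row_sum G x (hd x), Finset.mul_sum]
      rw [one_mul]
      congr 1
      exact Finset.sum_congr rfl fun _ _ => by ring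

/-- The expected number of independent walks, one started at each vertex of `A`, which are at `z`
at time `t`. -/
def walkDensity (A : Finset V) (t : ℕ) (z : V) : ℝ := ∑ i ∈ A, (transitionMatrix G ^ t) i z

theorem sum_walkDensity (hd : ∀ x, 0 < G.degree x) (A : Finset V) (t : ℕ) :
    ∑ z, walkDensity G A t z = A.card := by
  simp only [walkDensity]
  rw [Finset.sum_comm]
  simp [transitionMatrix_pow_row_sum G hd]

/-- The indicator function of the vertices `z` at which the density of walks is at least half of the
average density. -/
def isDense (A : Finset V) (t : ℕ) (z : V) : ℝ :=
  if (A.card : ℝ) / (2 * Fintype.card V) ≤ walkDensity G A t z then 1 else 0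

/-- At each time, at least half of the walks are expected to be at dense vertices. -/
theorem half_card_le_sum_isDense (hd : ∀ x, 0 < G.degree x) [Nonempty V] (A : Finset V) (t : ℕ) :
    (A.card : ℝ) / 2 ≤ ∑ b ∈ A, (walkOp G)^[t] (isDense G A t) b := by
  have h1 : ∑ b ∈ A, (walkOp G)^[t] (isDense G A t) b =
      ∑ z, walkDensity G A t z * isDense G A t z := by
    simp only [iterate_walkOp_apply, walkDensity, Finset.sum_mul]
    exact Finset.sum_comm
  have h2 : ∀ z, walkDensity G A t z - (A.card : ℝ) / (2 * Fintype.card V) ≤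
      walkDensity G A t z * isDense G A t z := by
    intro z
    rw [isDense]
    split_ifs with h
    · rw [mul_one]
      have : (0 : ℝ) ≤ (A.card : ℝ) / (2 * Fintype.card V) := by positivity
      linarith
    · rw [mul_zero]; linarith
  have h3 := Finset.sum_le_sum fun z (_ : z ∈ Finset.univ) => h2 z
  have hn : (0 : ℝ) < Fintype.card V := by exact_mod_cast Fintype.card_pos
  have h4 : (Fintype.card V : ℝ) * ((A.card : ℝ) / (2 * Fintype.card V)) = A.card / 2 := by
    field_simp
  rw [Finset.sum_sub_distrib, sum_walkDensity G hd, Finset.sum_const, nsmul_eq_mul,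
    Finset.card_univ, h4] at h3
  rw [h1]
  linarith

/-- When the time `s` is long enough, a trajectory which spends the fraction `N` of the time
at dense vertices is met by many of the walks of `A`, in expectation at least `8 N`. -/
theorem prod_one_add_avoid_le (hG : G.Connected) (hV : 2 ≤ Fintype.card V) {A : Finset V} {s : ℕ}
    {K : ℝ} (hK0 : 0 < K) (hs : 0 < s) (hK : ∑ t ∈ Finset.range s, kernelBound G t ≤ K)
    (hsK : 16 * Fintype.card V * K ≤ s * A.card) {b : V} (hb : b ∈ A) (h : ℕ → V) :
    ∏ i ∈ A.erase b, (1 + avoid G s i h) ≤ 2 ^ (A.card - 1) * ((33 / 20) *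
      (1 - 15 / 16 * ((s : ℝ)⁻¹ * ∑ t ∈ Finset.range s, isDense G A t (h t)))) := by
  have hd := degree_pos_of_connected G hG hV
  have hs' : (0 : ℝ) < s := by exact_mod_cast hs
  have hn : (0 : ℝ) < Fintype.card V := by exact_mod_cast (by omega : 0 < Fintype.card V)
  set N := (s : ℝ)⁻¹ * ∑ t ∈ Finset.range s, isDense G A t (h t) with hN
  have hdense : ∀ t z, 0 ≤ isDense G A t z ∧ isDense G A t z ≤ 1 := fun t z => by
    rw [isDense]; split_ifs <;> norm_num
  have hN0 : 0 ≤ N := mul_nonneg (by positivity) (Finset.sum_nonneg fun t _ => (hdense t _).1)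
  have hN1 : N ≤ 1 := by
    have h1 := Finset.sum_le_card_nsmul (Finset.range s) (fun t => isDense G A t (h t)) 1
      fun t _ => (hdense t _).2
    rw [Finset.card_range, nsmul_eq_mul, mul_one] at h1
    rw [hN, inv_mul_le_iff₀ hs', mul_one]
    exact h1
  have hQ : 8 * N ≤ ∑ i ∈ A, (1 - avoid G s i h) := by
    have h1 : ∑ t ∈ Finset.range s, walkDensity G A t (h t) ≤
        K * ∑ i ∈ A, (1 - avoid G s i h) := by
      simp only [walkDensity]
      rw [Finset.sum_comm, Finset.mul_sum]
      exact Finset.sum_le_sum fun i _ => sum_pow_le_mul_one_sub_avoid G hG hV s hK i h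
    have h2 : (A.card : ℝ) / (2 * Fintype.card V) * (s * N) ≤
        ∑ t ∈ Finset.range s, walkDensity G A t (h t) := by
      rw [hN, mul_inv_cancel_left₀ hs'.ne', Finset.mul_sum]
      refine Finset.sum_le_sum fun t _ => ?_
      rw [isDense]
      split_ifs with hc
      · rwa [mul_one]
      · rw [mul_zero]
        exact Finset.sum_nonneg fun i _ => transitionMatrix_pow_nonneg G t i _
    refine le_of_mul_le_mul_left ?_ hK0
    refine le_trans ?_ (h2.trans h1)
    have h3 : 8 * K ≤ (A.card : ℝ) / (2 * Fintype.card V) * s := by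
      rw [div_mul_eq_mul_div, le_div_iff₀ (by positivity)]
      linarith
    nlinarith [mul_le_mul_of_nonneg_right h3 hN0]
  -- With `q = 1 - avoid`, the probability of a collision: `2 - q ≤ 2 exp (- q / 2)`.
  have hfac : ∀ i, 1 + avoid G s i h ≤ 2 * Real.exp (-((1 - avoid G s i h) / 2)) := fun i => by
    linarith [Real.add_one_le_exp (-((1 - avoid G s i h) / 2))]
  have hprod : ∏ i ∈ A.erase b, (1 + avoid G s i h) ≤
      2 ^ (A.card - 1) * Real.exp (∑ i ∈ A.erase b, -((1 - avoid G s i h) / 2)) := by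
    refine (Finset.prod_le_prod (fun i _ => by linarith [avoid_nonneg G s i h])
      fun i _ => hfac i).trans_eq ?_
    rw [Finset.prod_mul_distrib, Finset.prod_const, Finset.card_erase_of_mem hb, Real.exp_sum]
  -- The term `1 / 2` pays for the missing walk from `b` itself; the rest is written as a convex
  -- combination of `0` and `-4`.
  have hexp : ∑ i ∈ A.erase b, -((1 - avoid G s i h) / 2) ≤ 1 / 2 + (1 - N) * 0 + N * (-4) := by
    rw [Finset.sum_neg_distrib, ← Finset.sum_div]
    have := Finset.add_sum_erase A (fun i => 1 - avoid G s i h) hb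
    have h0 := avoid_nonneg G s b h
    linarith
  have hhalf : Real.exp (1 / 2) ≤ 33 / 20 := by
    refine abs_le_of_sq_le_sq' ?_ (by norm_num) |>.2
    rw [← Real.exp_nat_mul]
    norm_num
    linarith [Real.exp_one_lt_d9]
  have h4 : Real.exp (-4) ≤ 1 / 16 := by
    rw [Real.exp_neg, ← one_div]
    refine one_div_le_one_div_of_le (by norm_num) ?_
    have : Real.exp 4 = Real.exp 1 ^ 4 := by rw [← Real.exp_nat_mul]; norm_num
    rw [this]
    calc (16 : ℝ) = 2 ^ 4 := by norm_num
      _ ≤ _ := pow_le_pow_left₀ (by norm_num) (by linarith [Real.exp_one_gt_d9]) 4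
  have hconv : Real.exp ((1 - N) * 0 + N * (-4)) ≤ 1 - 15 / 16 * N := by
    have := convexOn_exp.2 (Set.mem_univ (0 : ℝ)) (Set.mem_univ (-4 : ℝ))
      (by linarith : 0 ≤ 1 - N) hN0 (by ring)
    simp only [smul_eq_mul, Real.exp_zero] at this
    nlinarith [mul_le_mul_of_nonneg_left h4 hN0]
  refine hprod.trans (mul_le_mul_of_nonneg_left ?_ (by positivity))
  refine (Real.exp_le_exp.2 hexp).trans ?_
  rw [add_assoc, Real.exp_add]
  exact mul_le_mul hhalf hconv (Real.exp_nonneg _) (by norm_num)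

/-- When there are many walks, their expected number decreases by a constant factor in a time which
is inversely proportional to it. -/
theorem iterate_coalOp_card_le_of_large (hG : G.Connected) (hV : 2 ≤ Fintype.card V)
    {A : Finset V} (hA : 32 * degreeRatio G ≤ A.card) {s : ℕ}
    (hs : 16384 * hitScale G ≤ s * A.card) :
    (coalOp G)^[s] cardR A ≤ 19 / 20 * A.card := by
  have hd := degree_pos_of_connected G hG hV
  have hne := hG.nonempty
  have hn : (0 : ℝ) < Fintype.card V := by exact_mod_cast (by omega : 0 < Fintype.card V)
  have hΓ := one_le_degreeRatio G hG hV
  have hH := two_le_hitScale G hG hV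
  have hg := (sqrt_gap_mem G hG hV).1
  have hApos : (0 : ℝ) < A.card := by linarith
  have hApos' : 0 < A.card := by exact_mod_cast hApos
  have hs0 : 0 < s := by
    rcases Nat.eq_zero_or_pos s with h | h
    · rw [h, Nat.cast_zero, zero_mul] at hs; linarith
    · exact h
  have hs' : (0 : ℝ) < s := by exact_mod_cast hs0
  -- `16 n K ≤ s k`, where `k` is the number of walks: the transient part of `K` is at most half of
  -- this by `hs`, and the stationary part by `32 Γ ≤ k`.
  set K := 512 * degreeRatio G / Real.sqrt (1 - lambda2 G) +
    degreeRatio G * s / Fintype.card V with hKdef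
  have hK0 : 0 < K := by positivity
  have hnK : Fintype.card V * K = 512 * hitScale G + degreeRatio G * s := by
    rw [hKdef, hitScale]; field_simp
  have hsK : 16 * Fintype.card V * K ≤ s * A.card := by
    rw [mul_assoc, hnK]
    nlinarith [mul_le_mul_of_nonneg_left hA hs'.le]
  have h1 : ∀ b ∈ A, pathE G s b (fun h => ∏ i ∈ A.erase b, (1 + avoid G s i h)) ≤
      2 ^ (A.card - 1) * ((33 / 20) * (1 - 15 / 16 * ((s : ℝ)⁻¹ * ∑ t ∈ Finset.range s,
        (walkOp G)^[t] (isDense G A t) b))) := by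
    intro b hb
    refine (pathE_mono G s b fun h => prod_one_add_avoid_le G hG hV hK0 hs0
      (sum_kernelBound_le G hG hV s) hsK hb h).trans_eq ?_
    rw [pathE_const_mul, pathE_const_mul, pathE_sub, pathE_const G hd, pathE_const_mul,
      pathE_const_mul, pathE_sum]
    congr 5
    exact Finset.sum_congr rfl fun t ht =>
      pathE_eval G hd (Finset.mem_range.1 ht).le b _
  have h2 : s * ((A.card : ℝ) / 2) ≤
      ∑ b ∈ A, ∑ t ∈ Finset.range s, (walkOp G)^[t] (isDense G A t) b := by
    rw [Finset.sum_comm]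
    have := Finset.card_nsmul_le_sum (Finset.range s)
      (fun t => ∑ b ∈ A, (walkOp G)^[t] (isDense G A t) b) _
      fun t _ => half_card_le_sum_isDense G hd A t
    simpa using this
  have h3 := two_pow_mul_iterate_coalOp_card_le G hd s A
  have h4 := Finset.sum_le_sum h1
  have h5 : (2 : ℝ) ^ A.card = 2 * 2 ^ (A.card - 1) := by
    rw [← pow_succ', Nat.sub_add_cancel hApos']
  have hp : (0 : ℝ) < 2 ^ (A.card - 1) := by positivity
  rw [← Finset.mul_sum, ← Finset.mul_sum, Finset.sum_sub_distrib, ← Finset.mul_sum,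
    ← Finset.mul_sum, Finset.sum_const, nsmul_eq_mul, mul_one] at h4
  have h6 : (A.card : ℝ) / 2 ≤ (s : ℝ)⁻¹ *
      ∑ b ∈ A, ∑ t ∈ Finset.range s, (walkOp G)^[t] (isDense G A t) b := by
    rw [le_inv_mul_iff₀ hs']; exact h2
  rw [Finset.sum_sub_distrib, Finset.sum_const, nsmul_eq_mul, h5] at h3
  have h7 : ∑ b ∈ A, pathE G s b (fun h => ∏ i ∈ A.erase b, (1 + avoid G s i h)) ≤
      2 ^ (A.card - 1) * (33 / 20 * (A.card - 15 / 16 * (A.card / 2))) := by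
    refine h4.trans (mul_le_mul_of_nonneg_left ?_ hp.le)
    linarith
  refine le_of_mul_le_mul_left ?_ hp
  nlinarith

end Decay

/-! ### The coalescence time -/

section Potential

variable {V : Type*} [Fintype V] [DecidableEq V] (G : SimpleGraph V) [DecidableRel G.Adj]

/-- The probability that the coalescence process started from `A` has not been at a set with one
element at any time `i < t`. -/
def coalTail : ℕ → Finset V → ℝ
  | 0, _ => 1
  | t + 1, A => if A.card = 1 then 0 else coalOp G (coalTail t) A

theorem coalTail_mem (hd : ∀ x, 0 < G.degree x) (t : ℕ) (A : Finset V) :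
    0 ≤ coalTail G t A ∧ coalTail G t A ≤ 1 := by
  induction t generalizing A with
  | zero => exact ⟨zero_le_one, le_rfl⟩
  | succ t ih =>
    rw [coalTail]
    split_ifs
    · exact ⟨le_rfl, zero_le_one⟩
    · constructor
      · rw [← coalOp_const G hd 0 A]
        exact coalOp_le_coalOp G fun Y => (ih _).1
      · refine (coalOp_le_coalOp G fun Y => (ih _).2).trans_eq (coalOp_const G hd 1 A)

theorem coalTail_add_le (hd : ∀ x, 0 < G.degree x) (t s : ℕ) (A : Finset V) :
    coalTail G (t + s) A ≤ (coalOp G)^[s] (coalTail G t) A := by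
  induction s generalizing A with
  | zero => exact le_rfl
  | succ s ih =>
    have h1 : coalTail G (t + (s + 1)) A ≤ coalOp G (coalTail G (t + s)) A := by
      rw [← add_assoc, coalTail]
      split_ifs
      · rw [← coalOp_const G hd 0 A]
        exact coalOp_le_coalOp G fun Y => (coalTail_mem G hd _ _).1
      · exact le_rfl
    rw [Function.iterate_succ_apply']
    exact h1.trans (coalOp_le_coalOp G fun Y => ih _)

theorem iterate_coalOp_sum (I : Finset ℕ) (s : ℕ) (φ : ℕ → Finset V → ℝ) (A : Finset V) :
    (coalOp G)^[s] (fun B => ∑ i ∈ I, φ i B) A = ∑ i ∈ I, (coalOp G)^[s] (φ i) A := by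
  induction s generalizing A with
  | zero => rfl
  | succ s ih =>
    simp only [Function.iterate_succ_apply']
    rw [coalOp]
    simp_rw [ih, Finset.mul_sum]
    exact Finset.sum_comm

theorem iterate_coalOp_affine (hd : ∀ x, 0 < G.degree x) (s : ℕ) (a c : ℝ) (A : Finset V) :
    (coalOp G)^[s] (fun B => a + c * cardR B) A = a + c * (coalOp G)^[s] cardR A := by
  induction s generalizing A with
  | zero => rfl
  | succ s ih =>
    simp only [Function.iterate_succ_apply']
    rw [coalOp]
    simp_rw [ih, mul_add, Finset.sum_add_distrib]
    rw [← Finset.sum_mul, sum_prod_eq_one _ fun v => transitionMatrix_row_sum G v (hd v), one_mul,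
      coalOp, Finset.mul_sum]
    congr 1
    exact Finset.sum_congr rfl fun _ _ => by ring

/-- Only nonempty sets which are not larger are reached from a nonempty set. -/
theorem iterate_coalOp_le {φ ψ : Finset V → ℝ} (s : ℕ) {A : Finset V} (hA : A.Nonempty)
    (h : ∀ B : Finset V, B.Nonempty → B.card ≤ A.card → φ B ≤ ψ B) :
    (coalOp G)^[s] φ A ≤ (coalOp G)^[s] ψ A := by
  induction s generalizing A with
  | zero => exact h A hA le_rfl
  | succ s ih =>
    simp only [Function.iterate_succ_apply']
    exact coalOp_le_coalOp G fun Y => ih (hA.image Y)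
      fun B hB hBA => h B hB (hBA.trans Finset.card_image_le)

/-- An upper bound for the expected coalescence time from `k` walks. The second term accounts for
the time until at most `32 Γ` walks are left, during which the number of walks decreases like the
solution of `k' = - k ^ 2 / H` with `H = hitScale G`, and the first one for the time after that,
during which the number of walks is essentially halved every `halfTime` steps. The
numerical constant is `19 * 16385`: see `coalPotential_drift_large`. -/
def coalPotential (k : ℝ) : ℝ :=
  4 * halfTime G * Real.log (min k (32 * degreeRatio G)) + 311315 * hitScale G * (1 - 1 / k)

theorem coalPotential_nonneg (hG : G.Connected) (hV : 2 ≤ Fintype.card V) {k : ℝ} (hk : 1 ≤ k) :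
    0 ≤ coalPotential G k := by
  have hΓ := one_le_degreeRatio G hG hV
  have hH := two_le_hitScale G hG hV
  have h1 : 0 ≤ Real.log (min k (32 * degreeRatio G)) :=
    Real.log_nonneg (le_min hk (by linarith))
  have h2 : 0 ≤ 1 - 1 / k := by
    rw [sub_nonneg, div_le_one (by linarith)]; exact hk
  exact add_nonneg (mul_nonneg (by positivity) h1) (mul_nonneg (by linarith) h2)

theorem log_le_tangent {x y : ℝ} (hx : 0 < x) (hy : 0 < y) :
    Real.log y ≤ Real.log x + (y - x) / x := by
  have := Real.log_le_sub_one_of_pos (div_pos hy hx)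
  rw [Real.log_div hy.ne' hx.ne'] at this
  rw [sub_div, div_self hx.ne']
  linarith

/-- The tangent line inequality for the convex function `1 / y`. -/
theorem tangent_le_one_div {x y : ℝ} (hx : 0 < x) (hy : 0 < y) :
    2 / x - y / x ^ 2 ≤ 1 / y := by
  rw [div_sub_div _ _ hx.ne' (by positivity), div_le_div_iff₀ (by positivity) hy]
  nlinarith [sq_nonneg (x - y)]

/-- While few walks are left, the logarithmic term of the potential pays for `halfTime G` steps. The
logarithm is replaced by its tangent, so that only the expected number of walks matters. -/
theorem coalPotential_drift_small (hG : G.Connected) (hV : 2 ≤ Fintype.card V) {A : Finset V}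
    (hA : 2 ≤ A.card) (hA' : (A.card : ℝ) ≤ 32 * degreeRatio G) :
    halfTime G + (coalOp G)^[halfTime G] (fun B => coalPotential G B.card) A ≤
      coalPotential G A.card := by
  have hd := degree_pos_of_connected G hG hV
  have hH := two_le_hitScale G hG hV
  have hne : A.Nonempty := Finset.card_pos.1 (by omega)
  have hk : (2 : ℝ) ≤ A.card := by exact_mod_cast hA
  set k : ℝ := (A.card : ℝ) with hkdef
  set S : ℝ := (halfTime G : ℝ) with hS
  have hS0 : 0 < S := by rw [hS]; exact_mod_cast halfTime_pos G
  -- As `2 ≤ k`, the expected number `(k + 1) / 2` of remaining walks is at most `x`.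
  set x : ℝ := 3 * k / 4 with hx
  have hx0 : 0 < x := by rw [hx]; linarith
  have h1 := iterate_coalOp_card_le_half G hG hV hne
  have h2 : (coalOp G)^[halfTime G] (fun B => coalPotential G B.card) A ≤
      (coalOp G)^[halfTime G] (fun B => (4 * S * (Real.log x - 1) +
        311315 * hitScale G * (1 - 1 / k)) + 4 * S / x * cardR B) A := by
    refine iterate_coalOp_le G _ hne fun B hB hBA => ?_
    have hB1 : (1 : ℝ) ≤ B.card := by exact_mod_cast Finset.card_pos.2 hB
    have hBk : (B.card : ℝ) ≤ k := by rw [hkdef]; exact_mod_cast hBA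
    have h3 := log_le_tangent hx0 (by linarith : (0 : ℝ) < B.card)
    have h4 : 1 / k ≤ 1 / (B.card : ℝ) := one_div_le_one_div_of_le (by linarith) hBk
    have h5 : 4 * S / x * cardR B = 4 * S * ((B.card - x) / x + 1) := by
      rw [cardR]; field_simp; ring
    rw [coalPotential, min_eq_left (hBk.trans hA'), h5]
    have h6 := mul_le_mul_of_nonneg_left h3 (by linarith : 0 ≤ 4 * S)
    have h7 : 311315 * hitScale G * (1 - 1 / (B.card : ℝ)) ≤
        311315 * hitScale G * (1 - 1 / k) :=
      mul_le_mul_of_nonneg_left (by linarith) (by linarith)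
    linarith
  rw [iterate_coalOp_affine G hd] at h2
  have h3 : (coalOp G)^[halfTime G] cardR A ≤ x := by
    refine h1.trans ?_
    rw [cardR, hx]; linarith
  have h4 : 4 * S / x * (coalOp G)^[halfTime G] cardR A ≤ 4 * S := by
    calc _ ≤ 4 * S / x * x := mul_le_mul_of_nonneg_left h3 (by positivity)
      _ = _ := by field_simp
  have h5 : Real.log x ≤ Real.log k - 1 / 4 := by
    have := log_le_tangent (by linarith : 0 < k) hx0
    have h6 : (x - k) / k = -(1 / 4) := by rw [hx]; field_simp; ring
    rw [h6] at this
    linarith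
  have h6 := mul_le_mul_of_nonneg_left h5 (by linarith : 0 ≤ 4 * S)
  have h7 : coalPotential G k = 4 * S * Real.log k + 311315 * hitScale G * (1 - 1 / k) := by
    rw [coalPotential, min_eq_left hA']
  rw [h7]
  linarith

/-- While many walks are left, the hyperbolic term of the potential pays for the time in which their
expected number decreases by a twentieth. -/
theorem coalPotential_drift_large (hG : G.Connected) (hV : 2 ≤ Fintype.card V) {A : Finset V}
    (hA : 32 * degreeRatio G ≤ A.card) :
    (⌈16384 * hitScale G / A.card⌉₊ : ℝ) +
      (coalOp G)^[⌈16384 * hitScale G / A.card⌉₊] (fun B => coalPotential G B.card) A ≤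
      coalPotential G A.card := by
  have hd := degree_pos_of_connected G hG hV
  have hH := two_le_hitScale G hG hV
  have hΓ := one_le_degreeRatio G hG hV
  have hk : (32 : ℝ) ≤ A.card := by linarith
  have hne : A.Nonempty := Finset.card_pos.1 (by exact_mod_cast (by linarith : (0 : ℝ) < A.card))
  -- This is used to absorb the rounding of the number of steps.
  have hkH : (A.card : ℝ) ≤ hitScale G :=
    le_trans (by exact_mod_cast Finset.card_le_univ A) (card_le_hitScale G hG hV)
  set k : ℝ := (A.card : ℝ) with hkdef
  have hk0 : 0 < k := by linarith
  set s : ℕ := ⌈16384 * hitScale G / k⌉₊ with hs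
  have hs1 : (s : ℝ) ≤ 16385 * hitScale G / k := by
    have h1 := Nat.ceil_lt_add_one (by positivity : 0 ≤ 16384 * hitScale G / k)
    have h2 : 1 ≤ hitScale G / k := by rwa [one_le_div hk0]
    have h3 : 16385 * hitScale G / k = 16384 * hitScale G / k + hitScale G / k := by ring
    rw [h3]
    linarith
  have hs2 : 16384 * hitScale G ≤ s * A.card := by
    have := Nat.le_ceil (16384 * hitScale G / k)
    rwa [div_le_iff₀ hk0] at this
  have h1 := iterate_coalOp_card_le_of_large G hG hV hA hs2
  set x : ℝ := 19 * k / 20 with hx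
  have hx0 : 0 < x := by rw [hx]; linarith
  have h2 : (coalOp G)^[s] (fun B => coalPotential G B.card) A ≤
      (coalOp G)^[s] (fun B => (4 * halfTime G * Real.log (32 * degreeRatio G) +
        311315 * hitScale G * (1 - 2 / x)) + 311315 * hitScale G / x ^ 2 * cardR B) A := by
    refine iterate_coalOp_le G _ hne fun B hB _ => ?_
    have hB1 : (1 : ℝ) ≤ B.card := by exact_mod_cast Finset.card_pos.2 hB
    have h3 := tangent_le_one_div hx0 (by linarith : (0 : ℝ) < B.card)
    have h4 : Real.log (min (B.card : ℝ) (32 * degreeRatio G)) ≤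
        Real.log (32 * degreeRatio G) :=
      Real.log_le_log (lt_min (by linarith) (by linarith)) (min_le_right _ _)
    have h5 : 311315 * hitScale G / x ^ 2 * cardR B =
        311315 * hitScale G * (B.card / x ^ 2) := by rw [cardR]; ring
    rw [coalPotential, h5]
    have h6 := mul_le_mul_of_nonneg_left h4 (by positivity : (0 : ℝ) ≤ 4 * halfTime G)
    have h7 := mul_le_mul_of_nonneg_left h3 (by linarith : 0 ≤ 311315 * hitScale G)
    linarith
  rw [iterate_coalOp_affine G hd] at h2
  have h3 : 311315 * hitScale G / x ^ 2 * (coalOp G)^[s] cardR A ≤ 311315 * hitScale G / x := by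
    calc _ ≤ 311315 * hitScale G / x ^ 2 * x := by
          refine mul_le_mul_of_nonneg_left (h1.trans_eq ?_) (by positivity)
          rw [hx]; ring
      _ = _ := by field_simp
  have h4 : coalPotential G k = 4 * halfTime G * Real.log (32 * degreeRatio G) +
      311315 * hitScale G * (1 - 1 / k) := by
    rw [coalPotential, min_eq_right hA]
  -- The gain `1 / x - 1 / k` equals `1 / (19 k)`.
  have h5 : 311315 * hitScale G * (1 - 2 / x) + 311315 * hitScale G / x + 16385 * hitScale G / k =
      311315 * hitScale G * (1 - 1 / k) := by
    rw [hx]; field_simp; ring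
  rw [h4]
  linarith

/-- The partial sums of the tail probabilities are expectations of truncated coalescence times. -/
theorem sum_coalTail_le (hG : G.Connected) (hV : 2 ≤ Fintype.card V) (N : ℕ) {A : Finset V}
    (hA : A.Nonempty) :
    ∑ t ∈ Finset.range N, coalTail G (t + 1) A ≤ coalPotential G A.card := by
  have hd := degree_pos_of_connected G hG hV
  induction N using Nat.strong_induction_on generalizing A with
  | _ N ih =>
    have hA1 := Finset.card_pos.2 hA
    have hpot := coalPotential_nonneg G hG hV (k := A.card) (by exact_mod_cast hA1)
    rcases Nat.eq_zero_or_pos N with h0 | hN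
    · rw [h0, Finset.sum_range_zero]; exact hpot
    rcases Nat.eq_or_lt_of_le hA1 with h1 | h2
    · have hz : ∑ t ∈ Finset.range N, coalTail G (t + 1) A = 0 :=
        Finset.sum_eq_zero fun t _ => by rw [coalTail, if_pos h1.symm]
      rw [hz]; exact hpot
    obtain ⟨s, hs0, hs⟩ : ∃ s : ℕ, 0 < s ∧
        (s : ℝ) + (coalOp G)^[s] (fun B => coalPotential G B.card) A ≤
          coalPotential G A.card := by
      rcases le_total (A.card : ℝ) (32 * degreeRatio G) with h | h
      · exact ⟨_, halfTime_pos G, coalPotential_drift_small G hG hV h2 h⟩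
      · refine ⟨_, Nat.ceil_pos.2 ?_, coalPotential_drift_large G hG hV h⟩
        have := two_le_hitScale G hG hV
        have : (0 : ℝ) < A.card := by exact_mod_cast hA1
        positivity
    refine le_trans ?_ hs
    have h3 : ∑ t ∈ Finset.range N, coalTail G (t + 1) A ≤
        ∑ t ∈ Finset.range (s + (N - s)), coalTail G (t + 1) A :=
      Finset.sum_le_sum_of_subset_of_nonneg (Finset.range_mono (by omega))
        fun t _ _ => (coalTail_mem G hd _ _).1
    refine h3.trans ?_
    rw [Finset.sum_range_add]
    refine add_le_add ?_ ?_
    · refine (Finset.sum_le_sum fun t _ => (coalTail_mem G hd (t + 1) A).2).trans_eq ?_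
      simp
    · calc ∑ t ∈ Finset.range (N - s), coalTail G (s + t + 1) A
          ≤ ∑ t ∈ Finset.range (N - s), (coalOp G)^[s] (coalTail G (t + 1)) A :=
            Finset.sum_le_sum fun t _ => by
              rw [show s + t + 1 = t + 1 + s by ring]
              exact coalTail_add_le G hd _ _ _
        _ = (coalOp G)^[s] (fun B => ∑ t ∈ Finset.range (N - s), coalTail G (t + 1) B) A :=
            (iterate_coalOp_sum G _ s (fun t => coalTail G (t + 1)) A).symm
        _ ≤ _ := iterate_coalOp_le G s hA fun B hB _ => ih (N - s) (by omega) hB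

theorem coalPotential_le (hG : G.Connected) (hV : 2 ≤ Fintype.card V) {k : ℝ} (hk : 1 ≤ k) :
    coalPotential G k ≤ 400000 * (hitScale G * (1 + Real.log (degreeRatio G))) := by
  have hΓ := one_le_degreeRatio G hG hV
  have hH := two_le_hitScale G hG hV
  have hS := halfTime_le G hG hV
  have hL := Real.log_nonneg hΓ
  have h1 : Real.log (min k (32 * degreeRatio G)) ≤ 5 + Real.log (degreeRatio G) := by
    refine (Real.log_le_log (lt_min (by linarith) (by linarith)) (min_le_right _ _)).trans ?_
    rw [Real.log_mul (by norm_num) (by linarith), show (32 : ℝ) = 2 ^ 5 by norm_num, Real.log_pow]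
    have := Real.log_le_sub_one_of_pos (show (0 : ℝ) < 2 by norm_num)
    push_cast
    linarith
  have h2 : 311315 * hitScale G * (1 - 1 / k) ≤ 311315 * hitScale G := by
    have : 0 ≤ 1 / k := by positivity
    nlinarith
  have h3 : 4 * halfTime G * Real.log (min k (32 * degreeRatio G)) ≤
      4 * (1027 * hitScale G) * (5 + Real.log (degreeRatio G)) :=
    mul_le_mul (by linarith) h1 (Real.log_nonneg (le_min hk (by linarith))) (by linarith)
  have h4 : 0 ≤ hitScale G * Real.log (degreeRatio G) := mul_nonneg (by linarith) hL
  rw [coalPotential]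
  nlinarith

/-- The probability that two independent lazy walks have not met at any time `i < t`. -/
def meetTail : ℕ → V × V → ℝ
  | 0, _ => 1
  | t + 1, p => if p.1 = p.2 then 0 else
      ∑ x, ∑ y, transitionMatrix G p.1 x * transitionMatrix G p.2 y * meetTail t (x, y)

/-- Two walks which have not met are two elements of the set of coalescing walks. -/
theorem meetTail_le_coalTail (hd : ∀ x, 0 < G.degree x) (t : ℕ) {u v : V} {A : Finset V}
    (hu : u ∈ A) (hv : v ∈ A) : meetTail G t (u, v) ≤ coalTail G t A := by
  induction t generalizing u v A with
  | zero => exact le_rfl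
  | succ t ih =>
    by_cases huv : u = v
    · rw [meetTail, if_pos huv]
      exact (coalTail_mem G hd _ _).1
    · have hcard : A.card ≠ 1 := fun h => huv (Finset.card_le_one.1 h.le u hu v hv)
      rw [meetTail, if_neg huv, coalTail, if_neg hcard, coalOp]
      have h1 := sum_prod_marginal (transitionMatrix G)
        (fun v => transitionMatrix_row_sum G v (hd v))
        (fun b : Bool => if b then u else v)
        (by intro a b hab; cases a <;> cases b <;> simp_all [eq_comm])
        fun Y => meetTail G t (Y true, Y false)
      have h2 : ∑ Y : Bool → V, (∏ w, transitionMatrix G (if w then u else v) (Y w)) *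
          meetTail G t (Y true, Y false) = ∑ x, ∑ y,
          transitionMatrix G u x * transitionMatrix G v y * meetTail G t (x, y) := by
        rw [← (Equiv.boolArrowEquivProd V).symm.sum_comp, Fintype.sum_prod_type_right]
        refine Finset.sum_congr rfl fun x _ => Finset.sum_congr rfl fun y _ => ?_
        simp [Equiv.boolArrowEquivProd]
      rw [← h2, ← h1]
      refine Finset.sum_le_sum fun Y _ => mul_le_mul_of_nonneg_left ?_
        (Finset.prod_nonneg fun v _ => transitionMatrix_nonneg G v _)
      exact ih (Finset.mem_image_of_mem Y hu) (Finset.mem_image_of_mem Y hv)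

end Potential

/-! ### Expected first times of Markov chains -/

section Markov

open MeasureTheory ProbabilityTheory

variable {S : Type*} [Fintype S]

/-- The first time at which `E` holds, as the number of times before it; both sides are `∞` if there
is none. -/
theorem iInf_natCast_eq_tsum (E : ℕ → Prop) [∀ t, Decidable (∀ i ≤ t, ¬ E i)] :
    (⨅ (t : ℕ) (_ : E t), (t : ℝ≥0∞)) = ∑' t, if ∀ i ≤ t, ¬ E i then (1 : ℝ≥0∞) else 0 := by
  classical
  by_cases h : ∃ t, E t
  · have hiff : ∀ t, (∀ i ≤ t, ¬ E i) ↔ t < Nat.find h := fun t => by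
      rw [Nat.lt_find_iff]
    have h1 : (∑' t, if ∀ i ≤ t, ¬ E i then (1 : ℝ≥0∞) else 0) = Nat.find h := by
      rw [tsum_eq_sum (s := Finset.range (Nat.find h))]
      · rw [Finset.sum_congr rfl fun t ht =>
          if_pos ((hiff t).2 (Finset.mem_range.1 ht)), Finset.sum_const, Finset.card_range]
        simp
      · intro t ht
        rw [if_neg]
        rwa [hiff, ← Finset.mem_range]
    rw [h1]
    refine le_antisymm (iInf₂_le _ (Nat.find_spec h)) (le_iInf₂ fun t ht => ?_)
    exact_mod_cast Nat.find_min' h ht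
  · push Not at h
    simp only [h, not_false_eq_true, implies_true, if_true, iInf_false, iInf_top]
    exact (ENNReal.tsum_const_eq_top_of_ne_zero (α := ℕ) one_ne_zero).symm

theorem lintegral_iInf_eq_tsum [MeasurableSpace S] (μ : Measure (ℕ → S))
    (E : ℕ → (ℕ → S) → Prop) (hE : ∀ t, MeasurableSet {ω | E t ω}) :
    ∫⁻ ω, (⨅ (t : ℕ) (_ : E t ω), (t : ℝ≥0∞)) ∂μ = ∑' t, μ {ω | ∀ i ≤ t, ¬ E i ω} := by
  classical
  have hm : ∀ t, MeasurableSet {ω | ∀ i ≤ t, ¬ E i ω} := fun t => by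
    have : {ω | ∀ i ≤ t, ¬ E i ω} = ⋂ i, ⋂ (_ : i ≤ t), {ω | E i ω}ᶜ := by ext ω; simp
    rw [this]
    exact MeasurableSet.iInter fun i => MeasurableSet.iInter fun _ => (hE i).compl
  simp_rw [iInf_natCast_eq_tsum]
  rw [lintegral_tsum fun t =>
    (Measurable.ite (hm t) measurable_const measurable_const).aemeasurable]
  refine tsum_congr fun t => ?_
  rw [← lintegral_indicator_one (hm t)]
  refine lintegral_congr fun ω => ?_
  by_cases h : ∀ i ≤ t, ¬ E i ω
  · rw [if_pos h, Set.indicator_of_mem (by exact h), Pi.one_apply]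
  · rw [if_neg h, Set.indicator_of_notMem (by exact h)]

/-- One step of the chain with one-step distributions `step`, killed in `E`, acting on
functions. -/
def killedStep (step : S → PMF S) (E : S → Prop) [DecidablePred E] (f : S → ℝ≥0∞) :
    S → ℝ≥0∞ :=
  fun x => if E x then 0 else ∑ y, step x y * f y

section Law

variable [MeasurableSpace S] [DiscreteMeasurableSpace S] (step : S → PMF S)

theorem lintegral_stepKernel (t : ℕ) (y : Finset.Iic t → S) (f : S → ℝ≥0∞) :
    ∫⁻ z, f z ∂(stepKernel step t y) =
      ∑ z, step (y ⟨t, Finset.mem_Iic.2 le_rfl⟩) z * f z := by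
  change ∫⁻ z, f z ∂((step (y ⟨t, Finset.mem_Iic.2 le_rfl⟩)).toMeasure) = _
  rw [lintegral_fintype]
  refine Finset.sum_congr rfl fun z _ => ?_
  rw [PMF.toMeasure_apply_singleton _ _ (measurableSet_singleton z), mul_comm]

/-- The law of the first `t + 1` states of the chain started at `s`. -/
def pastLaw (s : S) (t : ℕ) : Measure (Finset.Iic t → S) :=
  Kernel.partialTraj (X := fun _ => S) (stepKernel step) 0 t fun _ => s

theorem chainLaw_map_past (s : S) (t : ℕ) :
    (chainLaw step s).map (fun ω (i : Finset.Iic t) => ω i) = pastLaw step s t :=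
  Kernel.traj_map_frestrictLe_apply (X := fun _ => S) (κ := stepKernel step) 0 t fun _ => s

theorem chainLaw_map_past_prod (s : S) (t : ℕ) :
    (chainLaw step s).map (fun ω => ((fun i : Finset.Iic t => ω i), ω (t + 1))) =
      pastLaw step s t ⊗ₘ stepKernel step t :=
  (Kernel.partialTraj_compProd_eq_map_traj (X := fun _ => S) (κ := stepKernel step)
    (Nat.zero_le t) (x₀ := fun _ => s)).symm

instance (s : S) (t : ℕ) : IsProbabilityMeasure (pastLaw step s t) := by
  rw [pastLaw]; infer_instance

/-- The Markov property, for functionals of the past times functions of the next state. -/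
theorem lintegral_chainLaw_succ (s : S) (t : ℕ) {g : (Finset.Iic t → S) → ℝ≥0∞}
    (hg : Measurable g) (f : S → ℝ≥0∞) :
    ∫⁻ ω, g (fun i => ω i) * f (ω (t + 1)) ∂(chainLaw step s) =
      ∫⁻ ω, g (fun i => ω i) * ∑ y, step (ω t) y * f y ∂(chainLaw step s) := by
  have hf : Measurable f := Measurable.of_discrete
  have hF : Measurable fun p : (Finset.Iic t → S) × S => g p.1 * f p.2 :=
    (hg.comp measurable_fst).mul (hf.comp measurable_snd)
  have hmap1 : Measurable fun (ω : ℕ → S) (i : Finset.Iic t) => ω i :=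
    measurable_pi_lambda _ fun i => measurable_pi_apply _
  have hmap : Measurable fun ω : ℕ → S => ((fun i : Finset.Iic t => ω i), ω (t + 1)) :=
    hmap1.prodMk (measurable_pi_apply _)
  have hG : Measurable fun y : Finset.Iic t → S => g y *
      ∑ z, step (y ⟨t, Finset.mem_Iic.2 le_rfl⟩) z * f z :=
    hg.mul ((Measurable.of_discrete (f := fun x : S => ∑ z, step x z * f z)).comp
      (measurable_pi_apply _))
  have h1 := lintegral_map (μ := chainLaw step s) hF hmap
  rw [chainLaw_map_past_prod, Measure.lintegral_compProd hF] at h1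
  have h2 := lintegral_map (μ := chainLaw step s) hG hmap1
  rw [chainLaw_map_past] at h2
  rw [← h1, ← h2]
  refine lintegral_congr fun y => ?_
  simp only
  rw [lintegral_const_mul _ hf, lintegral_stepKernel]

theorem lintegral_chainLaw_zero (s : S) (f : S → ℝ≥0∞) :
    ∫⁻ ω, f (ω 0) ∂(chainLaw step s) = f s := by
  have hf : Measurable f := Measurable.of_discrete
  have hmap1 : Measurable fun (ω : ℕ → S) (i : Finset.Iic 0) => ω i :=
    measurable_pi_lambda _ fun i => measurable_pi_apply _
  have hG : Measurable fun y : Finset.Iic 0 → S => f (y ⟨0, Finset.mem_Iic.2 le_rfl⟩) :=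
    hf.comp (measurable_pi_apply _)
  have h := lintegral_map (μ := chainLaw step s) hG hmap1
  rw [chainLaw_map_past, pastLaw, Kernel.partialTraj_self, Kernel.id_apply,
    lintegral_dirac' _ hG] at h
  exact h.symm

theorem lintegral_chainLaw_killed (s : S) (E : S → Prop) [DecidablePred E] (t : ℕ)
    (f : S → ℝ≥0∞) :
    ∫⁻ ω, (if ∀ i < t, ¬ E (ω i) then 1 else 0) * f (ω t) ∂(chainLaw step s) =
      (killedStep step E)^[t] f s := by
  induction t generalizing f with
  | zero => simpa using lintegral_chainLaw_zero step s f
  | succ t ih =>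
    have hE : MeasurableSet {x : S | E x} := MeasurableSet.of_discrete
    have hm : Measurable fun y : Finset.Iic t → S =>
        (if ∀ i : Finset.Iic t, ¬ E (y i) then (1 : ℝ≥0∞) else 0) := by
      refine Measurable.ite ?_ measurable_const measurable_const
      have : {y : Finset.Iic t → S | ∀ i : Finset.Iic t, ¬ E (y i)} =
          ⋂ i, (fun y : Finset.Iic t → S => y i) ⁻¹' {x | E x}ᶜ := by ext y; simp
      rw [this]
      exact MeasurableSet.iInter fun i => measurable_pi_apply i hE.compl
    have h1 := lintegral_chainLaw_succ step s t hm f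
    have h2 : ∀ ω : ℕ → S, (∀ i : Finset.Iic t, ¬ E (ω i)) ↔ ∀ i < t + 1, ¬ E (ω i) := fun ω =>
      ⟨fun h i hi => h ⟨i, Finset.mem_Iic.2 (Nat.lt_succ_iff.1 hi)⟩,
        fun h i => h i (Nat.lt_succ_iff.2 (Finset.mem_Iic.1 i.2))⟩
    simp only [h2] at h1
    rw [h1, Function.iterate_succ_apply, ← ih]
    refine lintegral_congr fun ω => ?_
    have h3 : (∀ i < t + 1, ¬ E (ω i)) ↔ (∀ i < t, ¬ E (ω i)) ∧ ¬ E (ω t) :=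
      Nat.forall_lt_succ_right
    rw [killedStep]
    by_cases ha : ∀ i < t, ¬ E (ω i) <;> by_cases hb : E (ω t)
    · rw [if_neg (by tauto), if_pos hb]; simp
    · rw [if_pos (by tauto), if_pos ha, if_neg hb]
    · rw [if_neg (by tauto), if_neg ha]; simp
    · rw [if_neg (by tauto), if_neg ha]; simp

theorem chainLaw_avoid (s : S) (E : S → Prop) [DecidablePred E] (t : ℕ) :
    chainLaw step s {ω | ∀ i ≤ t, ¬ E (ω i)} = (killedStep step E)^[t + 1] (fun _ => 1) s := by
  rw [← lintegral_chainLaw_killed]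
  have hm : MeasurableSet {ω : ℕ → S | ∀ i ≤ t, ¬ E (ω i)} := by
    have : {ω : ℕ → S | ∀ i ≤ t, ¬ E (ω i)} =
        ⋂ i, ⋂ (_ : i ≤ t), (fun ω : ℕ → S => ω i) ⁻¹' {x | E x}ᶜ := by ext ω; simp
    rw [this]
    exact MeasurableSet.iInter fun i => MeasurableSet.iInter fun _ =>
      measurable_pi_apply i (MeasurableSet.of_discrete (s := {x | E x})).compl
  rw [← lintegral_indicator_one hm]
  refine lintegral_congr fun ω => ?_
  simp only [mul_one, Nat.lt_succ_iff]
  by_cases h : ∀ i ≤ t, ¬ E (ω i)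
  · rw [if_pos h, Set.indicator_of_mem (by exact h), Pi.one_apply]
  · rw [if_neg h, Set.indicator_of_notMem (by exact h)]

end Law

/-- The expected hitting time of `E` as the sum of its tail probabilities. -/
theorem expectedFirstTime_eq_tsum (step : S → PMF S) (s : S) (E : S → Prop) [DecidablePred E] :
    expectedFirstTime step s (fun t ω => E (ω t)) =
      ∑' t, (killedStep step E)^[t + 1] (fun _ => 1) s := by
  let _ : MeasurableSpace S := ⊤
  have : DiscreteMeasurableSpace S := ⟨fun _ => trivial⟩
  have h := lintegral_iInf_eq_tsum (chainLaw step s) (fun t ω => E (ω t)) fun t =>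
    measurable_pi_apply t (MeasurableSet.of_discrete (s := {x | E x}))
  simp_rw [chainLaw_avoid] at h
  exact h

/-- The union bound for the expected time until all states have been visited. -/
theorem expectedFirstTime_cover_le [DecidableEq S] (step : S → PMF S) (s : S) :
    expectedFirstTime step s (fun t ω => ∀ v, ∃ i ≤ t, ω i = v) ≤
      ∑' t, min 1 (∑ v, (killedStep step (· = v))^[t + 1] (fun _ => 1) s) := by
  let _ : MeasurableSpace S := ⊤
  have : DiscreteMeasurableSpace S := ⟨fun _ => trivial⟩
  have hprob : IsProbabilityMeasure (chainLaw step s) := by rw [chainLaw]; infer_instance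
  have h := lintegral_iInf_eq_tsum (chainLaw step s) (fun t ω => ∀ v, ∃ i ≤ t, ω i = v) fun t => by
    have : {ω : ℕ → S | ∀ v, ∃ i ≤ t, ω i = v} =
        ⋂ v, ⋃ i, ⋃ (_ : i ≤ t), (fun ω : ℕ → S => ω i) ⁻¹' {v} := by ext ω; simp
    rw [this]
    exact MeasurableSet.iInter fun v => MeasurableSet.iUnion fun i => MeasurableSet.iUnion fun _ =>
      measurable_pi_apply i (MeasurableSet.of_discrete (s := {v}))
  refine h.trans_le (ENNReal.tsum_le_tsum fun t => le_min prob_le_one ?_)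
  simp_rw [← chainLaw_avoid]
  refine (measure_mono ?_).trans (measure_iUnion_fintype_le _ _)
  intro ω hω
  have h1 : ¬ ∀ v, ∃ i ≤ t, ω i = v := hω t le_rfl
  push Not at h1
  obtain ⟨v, hv⟩ := h1
  exact Set.mem_iUnion.2 ⟨v, hv⟩

end Markov

/-! ### The lazy walk, the pair of walks and the coalescence process -/

section Chains

variable {V : Type*} [Fintype V] [DecidableEq V] (G : SimpleGraph V) [DecidableRel G.Adj]

theorem sum_pmf_map_mul {α β : Type*} [Fintype α] [Fintype β] [DecidableEq β]
    (p : PMF α) (f : α → β) (F : β → ℝ≥0∞) : ∑ b, p.map f b * F b = ∑ a, p a * F (f a) := by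
  simp_rw [PMF.map_apply, tsum_fintype, Finset.sum_mul]
  rw [Finset.sum_comm]
  refine Finset.sum_congr rfl fun a _ => ?_
  rw [Finset.sum_eq_single (f a)]
  · rw [if_pos rfl]
  · intro b _ hb; rw [if_neg hb, zero_mul]
  · intro h; exact (h (Finset.mem_univ _)).elim

theorem sum_pmf_bind_mul {α β : Type*} [Fintype α] [Fintype β] (p : PMF α) (f : α → PMF β)
    (F : β → ℝ≥0∞) : ∑ b, p.bind f b * F b = ∑ a, p a * ∑ b, f a b * F b := by
  simp_rw [PMF.bind_apply, tsum_fintype, Finset.sum_mul, Finset.mul_sum]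
  rw [Finset.sum_comm]
  exact Finset.sum_congr rfl fun a _ => Finset.sum_congr rfl fun b _ => by ring

theorem walkStep_apply (hd : ∀ x, 0 < G.degree x) (x y : V) :
    walkStep G x y = ENNReal.ofReal (transitionMatrix G x y) := by
  rw [walkStep, dif_pos (hd x), PMF.ofFintype_apply]

theorem sum_walkStep_ofReal (hd : ∀ x, 0 < G.degree x) (x : V) {f : V → ℝ} (hf : ∀ y, 0 ≤ f y) :
    ∑ y, walkStep G x y * ENNReal.ofReal (f y) = ENNReal.ofReal (walkOp G f x) := by
  rw [walkOp, ENNReal.ofReal_sum_of_nonneg fun y _ =>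
    mul_nonneg (transitionMatrix_nonneg G x y) (hf y)]
  refine Finset.sum_congr rfl fun y _ => ?_
  rw [walkStep_apply G hd, ENNReal.ofReal_mul (transitionMatrix_nonneg G x y)]

theorem killedStep_walk (hd : ∀ x, 0 < G.degree x) (v : V) (t : ℕ) (u : V) :
    (killedStep (walkStep G) (· = v))^[t] (fun _ => 1) u =
      ENNReal.ofReal (avoid G t u fun _ => v) := by
  induction t generalizing u with
  | zero => simp [avoid]
  | succ t ih =>
    rw [Function.iterate_succ_apply', killedStep, avoid]
    split_ifs
    · simp
    · simp_rw [ih]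
      exact sum_walkStep_ofReal G hd u fun y => avoid_nonneg G t y _

theorem meetTail_nonneg (t : ℕ) (p : V × V) : 0 ≤ meetTail G t p := by
  induction t generalizing p with
  | zero => exact zero_le_one
  | succ t ih =>
    rw [meetTail]
    split_ifs
    · exact le_rfl
    · exact Finset.sum_nonneg fun x _ => Finset.sum_nonneg fun y _ => mul_nonneg
        (mul_nonneg (transitionMatrix_nonneg G _ _) (transitionMatrix_nonneg G _ _)) (ih _)

theorem killedStep_pair (hd : ∀ x, 0 < G.degree x) (t : ℕ) (p : V × V) :
    (killedStep (pairStep G) fun p => p.1 = p.2)^[t] (fun _ => 1) p =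
      ENNReal.ofReal (meetTail G t p) := by
  induction t generalizing p with
  | zero => simp [meetTail]
  | succ t ih =>
    rw [Function.iterate_succ_apply', killedStep, meetTail]
    split_ifs
    · simp
    · simp_rw [ih, pairStep, sum_pmf_bind_mul, sum_pmf_map_mul]
      have h : ∀ x, ∑ y, walkStep G p.2 y * ENNReal.ofReal (meetTail G t (x, y)) =
          ENNReal.ofReal (walkOp G (fun y => meetTail G t (x, y)) p.2) := fun x =>
        sum_walkStep_ofReal G hd p.2 fun y => meetTail_nonneg G t _
      simp_rw [h]
      refine (sum_walkStep_ofReal G hd p.1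
        (f := fun x => walkOp G (fun y => meetTail G t (x, y)) p.2)
        fun x => Finset.sum_nonneg fun y _ =>
          mul_nonneg (transitionMatrix_nonneg G _ _) (meetTail_nonneg G t _)).trans ?_
      congr 1
      simp only [walkOp, Finset.mul_sum, mul_assoc]

theorem jointStep_apply (hd : ∀ x, 0 < G.degree x) (Y : V → V) :
    jointStep G Y = ENNReal.ofReal (∏ v, transitionMatrix G v (Y v)) := by
  rw [jointStep, PMF.ofFintype_apply, ENNReal.ofReal_prod_of_nonneg fun v _ =>
    transitionMatrix_nonneg G v _]
  exact Finset.prod_congr rfl fun v _ => walkStep_apply G hd v _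

theorem killedStep_coalescence (hd : ∀ x, 0 < G.degree x) (t : ℕ) (A : Finset V) :
    (killedStep (coalescenceStep G) fun A => A.card = 1)^[t] (fun _ => 1) A =
      ENNReal.ofReal (coalTail G t A) := by
  induction t generalizing A with
  | zero => simp [coalTail]
  | succ t ih =>
    rw [Function.iterate_succ_apply', killedStep, coalTail]
    split_ifs
    · simp
    · simp_rw [ih, coalescenceStep, sum_pmf_map_mul]
      have h0 : ∀ Y : V → V, 0 ≤ ∏ v, transitionMatrix G v (Y v) := fun Y =>
        Finset.prod_nonneg fun v _ => transitionMatrix_nonneg G v _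
      rw [coalOp, ENNReal.ofReal_sum_of_nonneg fun Y _ =>
        mul_nonneg (h0 Y) (coalTail_mem G hd _ _).1]
      refine Finset.sum_congr rfl fun Y _ => ?_
      rw [jointStep_apply G hd, ENNReal.ofReal_mul (h0 Y)]

theorem tsum_div_eq {n : ℕ} (hn : 0 < n) (g : ℕ → ℝ≥0∞) :
    ∑' t, g (t / n) = n * ∑' j, g j := by
  have : NeZero n := ⟨hn.ne'⟩
  rw [← (Nat.divModEquiv n).symm.tsum_eq, ENNReal.tsum_prod', ← ENNReal.tsum_mul_left]
  refine tsum_congr fun j => ?_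
  rw [tsum_fintype]
  have : ∀ r : Fin n, ((Nat.divModEquiv n).symm (j, r)) / n = j := fun r => by
    rw [Nat.divModEquiv_symm_apply, mul_comm, Nat.mul_add_div hn, Nat.div_eq_of_lt r.2, add_zero]
  simp_rw [this]
  simp

theorem tsum_half_pow : ∑' j : ℕ, ((2 : ℝ≥0∞)⁻¹) ^ j = 2 := by
  rw [ENNReal.tsum_geometric, ENNReal.one_sub_inv_two, inv_inv]

theorem ofReal_avoid_succ_le (hG : G.Connected) (hV : 2 ≤ Fintype.card V) (t : ℕ) (x : V)
    (h : ℕ → V) :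
    ENNReal.ofReal (avoid G (t + 1) x h) ≤ ((2 : ℝ≥0∞)⁻¹) ^ (t / halfTime G) := by
  have h1 := (avoid_antitone G (degree_pos_of_connected G hG hV) x h (Nat.le_succ t)).trans
    (avoid_le_half_pow G hG hV t x h)
  refine (ENNReal.ofReal_le_ofReal h1).trans_eq ?_
  rw [ENNReal.ofReal_pow (by norm_num), one_div, ENNReal.ofReal_inv_of_pos (by norm_num)]
  simp

theorem natCast_halfTime_le (hG : G.Connected) (hV : 2 ≤ Fintype.card V) :
    (halfTime G : ℝ≥0∞) ≤ ENNReal.ofReal (1027 * hitScale G) := by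
  rw [← ENNReal.ofReal_natCast]
  exact ENNReal.ofReal_le_ofReal (halfTime_le G hG hV)

theorem hittingTime_le (hG : G.Connected) (hV : 2 ≤ Fintype.card V) :
    hittingTime G ≤ ENNReal.ofReal (2054 * hitScale G) := by
  have hd := degree_pos_of_connected G hG hV
  refine iSup_le fun u => iSup_le fun v => ?_
  rw [expectedFirstTime_eq_tsum (walkStep G) u (· = v)]
  simp_rw [killedStep_walk G hd]
  refine (ENNReal.tsum_le_tsum fun t => ofReal_avoid_succ_le G hG hV t u _).trans ?_
  rw [tsum_div_eq (halfTime_pos G) fun j => ((2 : ℝ≥0∞)⁻¹) ^ j, tsum_half_pow]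
  refine (mul_le_mul_left (natCast_halfTime_le G hG hV) 2).trans_eq ?_
  rw [← ENNReal.ofReal_ofNat 2, ← ENNReal.ofReal_mul' (by norm_num)]
  congr 1; ring

theorem meetingTime_le_coalescenceTime (hG : G.Connected) (hV : 2 ≤ Fintype.card V) :
    meetingTime G ≤ coalescenceTime G := by
  have hd := degree_pos_of_connected G hG hV
  refine iSup_le fun u => iSup_le fun v => ?_
  rw [coalescenceTime, expectedFirstTime_eq_tsum (pairStep G) (u, v) fun p => p.1 = p.2,
    expectedFirstTime_eq_tsum (coalescenceStep G) Finset.univ fun A => A.card = 1]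
  simp_rw [killedStep_pair G hd, killedStep_coalescence G hd]
  exact ENNReal.tsum_le_tsum fun t => ENNReal.ofReal_le_ofReal
    (meetTail_le_coalTail G hd _ (Finset.mem_univ _) (Finset.mem_univ _))

theorem coalescenceTime_le (hG : G.Connected) (hV : 2 ≤ Fintype.card V) :
    coalescenceTime G ≤
      ENNReal.ofReal (400000 * (hitScale G * (1 + Real.log (degreeRatio G)))) := by
  have hd := degree_pos_of_connected G hG hV
  have hne := hG.nonempty
  rw [coalescenceTime,
    expectedFirstTime_eq_tsum (coalescenceStep G) Finset.univ fun A => A.card = 1]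
  simp_rw [killedStep_coalescence G hd]
  refine ENNReal.tsum_le_of_sum_range_le fun N => ?_
  rw [← ENNReal.ofReal_sum_of_nonneg fun t _ => (coalTail_mem G hd _ _).1]
  refine ENNReal.ofReal_le_ofReal ((sum_coalTail_le G hG hV N Finset.univ_nonempty).trans ?_)
  refine coalPotential_le G hG hV ?_
  exact_mod_cast Finset.card_pos.2 Finset.univ_nonempty

/-- After `log₂ n` periods, the union bound over the `n` vertices becomes effective. -/
theorem tsum_min_one_le {n J : ℕ} (hJ : n ≤ 2 ^ J) :
    ∑' j : ℕ, min 1 ((n : ℝ≥0∞) * ((2 : ℝ≥0∞)⁻¹) ^ j) ≤ J + 2 := by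
  rw [← ENNReal.summable.sum_add_tsum_nat_add' (k := J)]
  refine add_le_add ?_ ?_
  · refine (Finset.sum_le_sum fun j _ => min_le_left _ _).trans_eq ?_
    simp
  · refine le_trans (ENNReal.tsum_le_tsum fun j => (min_le_right _ _).trans ?_) tsum_half_pow.le
    have h : (n : ℝ≥0∞) * 2⁻¹ ^ J ≤ 1 := by
      have h1 : (n : ℝ≥0∞) ≤ 2 ^ J := by exact_mod_cast hJ
      calc (n : ℝ≥0∞) * 2⁻¹ ^ J ≤ 2 ^ J * 2⁻¹ ^ J := by gcongr
        _ = 1 := by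
          rw [← mul_pow, ENNReal.mul_inv_cancel (by norm_num) (by norm_num), one_pow]
    calc (n : ℝ≥0∞) * 2⁻¹ ^ (j + J) = (n * 2⁻¹ ^ J) * 2⁻¹ ^ j := by rw [pow_add]; ring
      _ ≤ 1 * 2⁻¹ ^ j := by gcongr
      _ = _ := one_mul _

theorem clog_two_add_two_le {n : ℕ} (hn : 2 ≤ n) : (Nat.clog 2 n : ℝ) + 2 ≤ 6 * Real.log n := by
  have h1 := Nat.pow_pred_clog_lt_self (by norm_num : 1 < 2) (by omega : 1 < n)
  have hc : 1 ≤ Nat.clog 2 n := Nat.clog_pos (by norm_num) hn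
  have h2 : ((Nat.clog 2 n : ℝ) - 1) * Real.log 2 ≤ Real.log n := by
    have h3 : ((2 : ℝ) ^ (Nat.clog 2 n).pred) ≤ n := by exact_mod_cast h1.le
    have h4 := Real.log_le_log (by positivity) h3
    rw [Real.log_pow, Nat.pred_eq_sub_one, Nat.cast_sub hc, Nat.cast_one] at h4
    exact h4
  have h5 : Real.log 2 ≤ Real.log n := Real.log_le_log (by norm_num) (by exact_mod_cast hn)
  have h6 := Real.log_two_gt_d9
  have h7 : (0 : ℝ) ≤ (Nat.clog 2 n : ℝ) - 1 := by
    have : (1 : ℝ) ≤ Nat.clog 2 n := by exact_mod_cast hc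
    linarith
  nlinarith

theorem coverTime_le (hG : G.Connected) (hV : 2 ≤ Fintype.card V) :
    coverTime G ≤ ENNReal.ofReal (6162 * (hitScale G * Real.log (Fintype.card V))) := by
  have hd := degree_pos_of_connected G hG hV
  have hH := two_le_hitScale G hG hV
  refine iSup_le fun u => (expectedFirstTime_cover_le (walkStep G) u).trans ?_
  simp_rw [killedStep_walk G hd]
  have h1 : ∀ t : ℕ, min 1 (∑ v, ENNReal.ofReal (avoid G (t + 1) u fun _ => v)) ≤
      min 1 ((Fintype.card V : ℝ≥0∞) * ((2 : ℝ≥0∞)⁻¹) ^ (t / halfTime G)) := fun t => by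
    refine min_le_min le_rfl ?_
    refine (Finset.sum_le_card_nsmul _ _ _ fun v _ =>
      ofReal_avoid_succ_le G hG hV t u _).trans_eq ?_
    rw [nsmul_eq_mul, Finset.card_univ]
  refine (ENNReal.tsum_le_tsum h1).trans ?_
  rw [tsum_div_eq (halfTime_pos G) fun j =>
    min 1 ((Fintype.card V : ℝ≥0∞) * ((2 : ℝ≥0∞)⁻¹) ^ j)]
  refine (mul_le_mul' (natCast_halfTime_le G hG hV)
    (tsum_min_one_le (Nat.le_pow_clog (by norm_num) (Fintype.card V)))).trans ?_
  have h2 : ((Nat.clog 2 (Fintype.card V) : ℝ≥0∞)) + 2 ≤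
      ENNReal.ofReal (6 * Real.log (Fintype.card V)) := by
    rw [← ENNReal.ofReal_natCast, ← ENNReal.ofReal_ofNat 2,
      ← ENNReal.ofReal_add (Nat.cast_nonneg _) (by norm_num)]
    exact ENNReal.ofReal_le_ofReal (clog_two_add_two_le hV)
  refine (mul_le_mul' le_rfl h2).trans_eq ?_
  rw [← ENNReal.ofReal_mul (by linarith)]
  congr 1; ring

/-- By Cheeger's inequality, the spectral gap may be replaced by the conductance. -/
theorem hitScale_le (hG : G.Connected) (hV : 2 ≤ Fintype.card V) :
    hitScale G ≤ 2 * (degreeRatio G * Fintype.card V / conductance G) := by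
  have hΦ := conductance_pos G hG hV
  have hs := (sqrt_gap_mem G hG hV).1
  have hΓ := one_le_degreeRatio G hG hV
  have hc := conductance_le G hG hV
  rw [hitScale, ← mul_div_assoc, div_le_div_iff₀ hs hΦ]
  have : (0 : ℝ) ≤ degreeRatio G * Fintype.card V := by positivity
  nlinarith [mul_le_mul_of_nonneg_left hc this]

end Chains

end LazyWalk

end

theorem theorem1p4 :
    ∃ C : ℝ, 0 < C ∧
      ∀ (V : Type*) [Fintype V] [DecidableEq V] (G : SimpleGraph V) [DecidableRel G.Adj],
        G.Connected → 2 ≤ Fintype.card V →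
        ∀ (n Γ gap Φ : ℝ), n = (Fintype.card V : ℝ) → Γ = LazyWalk.degreeRatio G →
          gap = 1 - LazyWalk.lambda2 G → Φ = LazyWalk.conductance G →
          LazyWalk.hittingTime G ≤ ENNReal.ofReal (C * (Γ * n / Real.sqrt gap)) ∧
          Γ * n / Real.sqrt gap ≤ C * (Γ * n / Φ) ∧
          LazyWalk.hittingTime G ≤ ENNReal.ofReal (C * (Γ * n / Φ)) ∧
          LazyWalk.meetingTime G ≤ LazyWalk.coalescenceTime G ∧
          LazyWalk.coalescenceTime G ≤
            ENNReal.ofReal (C * (Γ * n * (1 + Real.log Γ) / Real.sqrt gap)) ∧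
          LazyWalk.coalescenceTime G ≤ ENNReal.ofReal (C * (Γ * n * (1 + Real.log Γ) / Φ)) ∧
          LazyWalk.coverTime G ≤ ENNReal.ofReal (C * (Γ * n * Real.log n / Φ)) := by
  -- Twice the largest of the constants in the bounds by `hitScale`; the factor two is from
  -- Cheeger's inequality `hitScale_le`.
  refine ⟨800000, by norm_num, ?_⟩
  rintro V _ _ G _ hG hV n Γ gap Φ rfl rfl rfl rfl
  have hΓ := LazyWalk.one_le_degreeRatio G hG hV
  have hH := LazyWalk.two_le_hitScale G hG hV
  have hΦ := LazyWalk.hitScale_le G hG hV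
  have hlogΓ := Real.log_nonneg hΓ
  have hlogn : 0 ≤ Real.log (Fintype.card V) :=
    Real.log_nonneg (by exact_mod_cast (by omega : 1 ≤ Fintype.card V))
  have hdef : LazyWalk.degreeRatio G * (Fintype.card V : ℝ) /
      Real.sqrt (1 - LazyWalk.lambda2 G) = LazyWalk.hitScale G := rfl
  set H := LazyWalk.hitScale G
  set Q := LazyWalk.degreeRatio G * (Fintype.card V : ℝ) / LazyWalk.conductance G with hQ
  have hcoal1 : LazyWalk.degreeRatio G * (Fintype.card V : ℝ) *
      (1 + Real.log (LazyWalk.degreeRatio G)) / Real.sqrt (1 - LazyWalk.lambda2 G) =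
      H * (1 + Real.log (LazyWalk.degreeRatio G)) := by
    rw [← hdef, div_mul_eq_mul_div]
  have hcoal2 : LazyWalk.degreeRatio G * (Fintype.card V : ℝ) *
      (1 + Real.log (LazyWalk.degreeRatio G)) / LazyWalk.conductance G =
      Q * (1 + Real.log (LazyWalk.degreeRatio G)) := by
    rw [hQ, div_mul_eq_mul_div]
  have hcov : LazyWalk.degreeRatio G * (Fintype.card V : ℝ) *
      Real.log (Fintype.card V) / LazyWalk.conductance G =
      Q * Real.log (Fintype.card V) := by
    rw [hQ, div_mul_eq_mul_div]
  have h1 := mul_le_mul_of_nonneg_right hΦ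
    (by linarith : 0 ≤ 1 + Real.log (LazyWalk.degreeRatio G))
  have h2 := mul_le_mul_of_nonneg_right hΦ hlogn
  have h3 : 0 ≤ H * (1 + Real.log (LazyWalk.degreeRatio G)) :=
    mul_nonneg (by linarith) (by linarith)
  have h4 : 0 ≤ H * Real.log (Fintype.card V) := mul_nonneg (by linarith) hlogn
  rw [hdef, hcoal1, hcoal2, hcov]
  refine ⟨(LazyWalk.hittingTime_le G hG hV).trans (ENNReal.ofReal_le_ofReal ?_), ?_,
    (LazyWalk.hittingTime_le G hG hV).trans (ENNReal.ofReal_le_ofReal ?_),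
    LazyWalk.meetingTime_le_coalescenceTime G hG hV,
    (LazyWalk.coalescenceTime_le G hG hV).trans (ENNReal.ofReal_le_ofReal ?_),
    (LazyWalk.coalescenceTime_le G hG hV).trans (ENNReal.ofReal_le_ofReal ?_),
    (LazyWalk.coverTime_le G hG hV).trans (ENNReal.ofReal_le_ofReal ?_)⟩ <;>
  linarith
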